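/- **Setting.** Let $M$ be (a coordinate patch of) a smooth $n$-manifold, and let $(E,\langle\cdot,\cdot\rangle,\rho,\circ,H)$ be a 4-form twisted Courant algebroid over $M$. Thus $E\to M$ is a vector bundle with a non-degenerate symmetric fibre metric, anchor $\rho:E\to TM$ and Dorfman bracket $\circ$; for sections $e,e',e''$ and vector fields $v$, - $\rho(e\circ e')=[\rho(e),\rho(e')]$ and $\rho\circ\rho^*=0$, where $2\langle\rho^*\alpha,e\rangle=\alpha(\rho(e))$; - $2\langle e\circ e,e'\rangle=\rho(e')\langle e,e\rangle$ and $\rho(e)\langle e',e''\rangle=\langle e\circ e',e''\rangle+\langle e',e\circ e''\rangle$; - $H$ is a closed 4-form and $2\langle e\circ(e'\circ e'')-(e\circ e')\circ e''-e'\circ(e\circ e''),e'''\rangle=H(\rho(e'''),\rho(e),\rho(e'),\rho(e''))$. Let $[e,e']=\frac12(e\circ e'-e'\circ e)$ be the Courant bracket. Let $\nabla$ be a connection on $TM\oplus E$ whose $E$-part preserves the fibre metric. Put $\nabla^E_ee'=\nabla_{\rho(e)}e'$ and $\bar\nabla^E_ev=\rho(\nabla_ve)+[\rho(e),v]$, and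 define the Gualtieri torsion, the basic curvature, its twist and the derivative of the anchor by $$\mathcal T(e_1,e_2,e_3)=\langle\nabla^E_{e_1}e_2-\nabla^E_{e_2}e_1-[e_1,e_2],e_3\rangle+\tfrac12\big(\langle\nabla^E_{e_3}e_1,e_2\rangle-\langle\nabla^E_{e_3}e_2,e_1\rangle\big),$$ $$\begin{aligned}\mathcal S(v;e_1,e_2,e_3)={}&\langle\nabla_v[e_1,e_2]-[\nabla_ve_1,e_2]-[e_1,\nabla_ve_2]-\nabla_{\bar\nabla^E_{e_2}v}e_1+\nabla_{\bar\nabla^E_{e_1}v}e_2,e_3\rangle\\&+\tfrac12\big(\langle\nabla_{\bar\nabla^E_{e_3}v}e_1,e_2\rangle-\langle\nabla_{\bar\nabla^E_{e_3}v}e_2,e_1\rangle\big),\end{aligned}$$ $$\widetilde{\mathcal S}(v;e_1,e_2,e_3)=\mathcal S(v;e_1,e_2,e_3)+\tfrac12H(v,\rho(e_1),\rho(e_2),\rho(e_3)),\qquad(\nabla_v\rho)(e)=\nabla_v(\rho(e))-\rho(\nabla_ve).$$ Let $x^\mu$ be coordinates on $M$ and $\mathfrak e_a$ a frame of $E$ such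 that $\eta_{ab}=2\langle\mathfrak e_a,\mathfrak e_b\rangle$ is constant, with inverse $\eta^{ab}$. Components: $\rho(\mathfrak e_a)=\rho_a{}^\mu\partial_\mu$, $[\mathfrak e_a,\mathfrak e_b]=C^c_{ab}\mathfrak e_c$, $C_{abc}=\eta_{cd}C^d_{ab}$, $\nabla_{\partial_\mu}\mathfrak e_a=\omega_{\mu a}{}^b\mathfrak e_b$, $\omega_{\mu ab}=\omega_{\mu a}{}^c\eta_{cb}$, $\nabla_{\partial_\mu}\partial_\sigma=\Gamma^\nu_{\mu\sigma}\partial_\nu$, $\mathcal T_{abc}=\mathcal T(\mathfrak e_a,\mathfrak e_b,\mathfrak e_c)$, $\mathcal T^a_{bc}=\mathcal T_{bcd}\eta^{da}$, $\widetilde{\mathcal S}_{\mu abc}=\widetilde{\mathcal S}(\partial_\mu;\mathfrak e_a,\mathfrak e_b,\mathfrak e_c)$, $\nabla_\mu\rho_a{}^\nu=((\nabla_{\partial_\mu}\rho)(\mathfrak e_a))^\nu$, $R_{ab\mu\nu}=2\langle\mathfrak e_a,R(\partial_\mu,\partial_\nu)\mathfrak e_b\rangle$ with $R$ the curvature of $\nabla$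 on $E$. A bundle index on $H$ stands for contraction with the anchor: $H_{\mu abc}=H(\partial_\mu,\rho(\mathfrak e_a),\rho(\mathfrak e_b),\rho(\mathfrak e_c))$, and likewise $H_{\mu\nu ab}$, $H_{\mu\nu\sigma a}$. Round and square brackets on indices denote (anti)symmetrization with weight $\frac12$. **The target.** Let $\mathcal M$ be the graded manifold with coordinates $x^\mu,a^a,b_\mu$ of degrees $0,1,2$, collectively $x^\alpha$ of degree $|\alpha|$. Let $Q^H$ be the degree-1 derivation of its functions with $$\begin{aligned}Q^Hx^\mu&=\rho_a{}^\mu a^a,\qquad Q^Ha^a=-\eta^{ab}\rho_b{}^\mu b_\mu-\tfrac12C^a_{bc}a^ba^c,\\Q^Hb_\mu&=-\partial_\mu\rho_a{}^\nu\,b_\nu a^a-\tfrac16(\partial_\mu C_{abc}+H_{\mu abc})a^aa^ba^c.\end{aligned}$$ Put $b^\nabla_\mu=b_\mu+\frac12\omega_{\mu ab}a^aa^b$. Define the covariant derivations $$\mathrm D_a=\frac{\partial}{\partial a^a}+\omega_{\mu ba}a^b\frac{\partial}{\partial b_\mu},\qquad\mathrm D^\mu=\frac{\partial}{\partial b_\mu},$$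 $$\mathrm D_\mu=\partial_\mu-\tfrac12\partial_\mu\omega_{\nu bc}a^ba^c\frac{\partial}{\partial b_\nu}+\Gamma^\sigma_{\nu\mu}b^\nabla_\sigma\frac{\partial}{\partial b_\nu}-\omega_{\mu b}{}^ca^b\mathrm D_c,$$ collectively $\mathrm D_\alpha=(\mathrm D_\mu,\mathrm D_a,\mathrm D^\mu)$, and the covariant components $$\begin{aligned}Q_\nabla^\mu&=\rho_a{}^\mu a^a,\qquad Q_\nabla^a=-\eta^{ab}\rho_b{}^\mu b^\nabla_\mu+\mathcal T^a_{bc}a^ba^c,\\Q^\nabla_\mu&=-\nabla_\mu\rho_a{}^\nu\,b^\nabla_\nu a^a-\tfrac13\widetilde{\mathcal S}_{\mu abc}a^aa^ba^c.\end{aligned}$$ **Fields and ghosts.** Consider the algebra of local forms on the source $T[1]\Sigma$ generated over the pull-backs $X^*f$ of functions $f$ on $M$ by the following symbols together with their exterior derivatives, with bidegrees (form degree, ghost degree): fields $X^\mu\,(0,0)$, $A^a\,(1,0)$, $B_\mu\,(2,0)$, ghosts $\epsilon^a\,(0,1)$, $\psi_\mu\,(1,1)$, ghosts for ghosts $\widetilde\psi_\mu\,(0,2)$.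 Elements of bidegrees $(f,g)$, $(f',g')$ commute up to $(-1)^{ff'+gg'}$. (No other relation is imposed, so every identity below holds for all field configurations.) Let $\mathrm d$ be the exterior derivative, and $$F^\mu=\mathrm dX^\mu-\rho_a{}^\mu A^a,\qquad G^a=\mathrm dA^a+\eta^{ab}\rho_b{}^\mu B_\mu+\tfrac12C^a_{bc}A^bA^c.$$ The BRST operator $s_0$ is the derivation of bidegree $(0,1)$ commuting with $\mathrm d$ with $$\begin{aligned} s_0X^\mu&=\rho_a{}^\mu\epsilon^a,\qquad s_0\epsilon^a=-\eta^{ab}\rho_b{}^\mu\widetilde\psi_\mu-\tfrac12C^a_{bc}\epsilon^b\epsilon^c,\\ s_0A^a&=\mathrm d\epsilon^a+\eta^{ab}\rho_b{}^\mu\psi_\mu+C^a_{bc}A^b\epsilon^c,\\ s_0\widetilde\psi_\mu&=-\partial_\mu\rho_a{}^\nu\,\widetilde\psi_\nu\epsilon^a-\tfrac16(\partial_\mu C_{abc}+H_{\mu abc})\epsilon^a\epsilon^b\epsilon^c,\\ s_0\psi_\mu&=\mathrm d\widetilde\psi_\mu+\partial_\mu\rho_a{}^\nu(\widetilde\psi_\nu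 A^a+\psi_\nu\epsilon^a)+\tfrac12(\partial_\mu C_{abc}+H_{\mu abc})A^a\epsilon^b\epsilon^c+\tfrac14H_{\mu\nu ab}\epsilon^a\epsilon^bF^\nu,\\ s_0B_\mu&=-\mathrm d\psi_\mu-\partial_\mu\rho_a{}^\nu(B_\nu\epsilon^a-\psi_\nu A^a)-\tfrac12(\partial_\mu C_{abc}+H_{\mu abc})A^aA^b\epsilon^c-\tfrac12H_{\mu\nu ab}\epsilon^aA^bF^\nu-\tfrac16H_{\mu\nu\sigma a}\epsilon^aF^\nu F^\sigma. \end{aligned}$$ The covariant redefinitions are $$B^\nabla_\mu=B_\mu+\tfrac12\omega_{\mu ab}A^aA^b,\quad\psi^\nabla_\mu=\psi_\mu+\omega_{\mu ab}A^a\epsilon^b,\quad\widetilde\psi^\nabla_\mu=\widetilde\psi_\mu+\tfrac12\omega_{\mu ab}\epsilon^a\epsilon^b.$$ Let $\bar s_0u^a=s_0u^a+\omega_{\mu b}{}^as_0X^\mu\,u^b$ and $\bar s_0u_\mu=s_0u_\mu-\Gamma^\nu_{\mu\sigma}s_0X^\sigma\,u_\nu$ be the components of the BRST transformations of $u^a\otimes\mathfrak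 e_a$ and $u_\mu\otimes\mathrm dx^\mu$, let $\mathrm Du^a=\mathrm du^a+\omega_{\mu b}{}^a\mathrm dX^\mu u^b$ and $\mathrm Du_\mu=\mathrm du_\mu-\Gamma^\nu_{\mu\sigma}\mathrm dX^\sigma u_\nu$ be the exterior covariant derivatives, and let $\kappa_{\mu\nu ab}=\partial_{(\mu}\omega_{\nu)ab}+\omega_{[\mu a}{}^d\omega_{\nu]bd}$. The covariant BRST transformation is $s_0^\nabla=\bar s_0$ on $X,\epsilon,\widetilde\psi^\nabla$ (where $\bar s_0X^\mu=s_0X^\mu$) and $$\begin{aligned} s_0^\nabla A^a&=\bar s_0A^a+\omega_{\mu b}{}^aF^\mu\epsilon^b,\\ s_0^\nabla\psi^\nabla_\mu&=\bar s_0\psi^\nabla_\mu-\Gamma^\nu_{\mu\sigma}\widetilde\psi^\nabla_\nu F^\sigma+\tfrac12\kappa_{\mu\nu ab}F^\nu\epsilon^a\epsilon^b,\\ s_0^\nabla B^\nabla_\mu&=\bar s_0B^\nabla_\mu-\Gamma^\nu_{\mu\sigma}\psi^\nabla_\nu F^\sigma-\kappa_{\mu\nu ab}F^\nu A^a\epsilon^b-\omega_{\mu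 ab}G^a\epsilon^b. \end{aligned}$$ Finally put $$\begin{aligned} s^\nabla_{\rm triv}\psi^\nabla_\mu&=\tfrac14(H_{\mu\nu ab}-R_{ab\mu\nu})\epsilon^a\epsilon^bF^\nu,\\ s^\nabla_{\rm triv}B^\nabla_\mu&=-\tfrac12(H_{\mu\nu ab}-R_{ab\mu\nu})\epsilon^aA^bF^\nu-\tfrac16H_{\mu\nu\sigma a}\epsilon^aF^\nu F^\sigma, \end{aligned}$$ and let $s^\nabla_{\rm triv}$ vanish on $X$, $A$ and $\epsilon^a$. Write $\phi^\alpha_\nabla=(X^\mu,A^a,B^\nabla_\mu)$, $\epsilon^\alpha_\nabla=(0,\epsilon^a,-\psi^\nabla_\mu)$, $\widetilde\epsilon^\alpha_\nabla=(0,0,-\widetilde\psi^\nabla_\mu)$. **Proposition.** 1. $Q^H=Q_\nabla^\alpha\mathrm D_\alpha$. 2. With functions on $\mathcal M$ pulled back by $x^\mu\mapsto X^\mu$, $a^a\mapsto A^a$, $b_\mu\mapsto B_\mu$, $$\begin{aligned} s_0^\nabla\phi^\alpha_\nabla&=\mathrm D\epsilon^\alpha_\nabla+\epsilon^\beta_\nabla\mathrm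 D_\beta Q^\alpha_\nabla+s^\nabla_{\rm triv}\phi^\alpha_\nabla,\\ s_0^\nabla\epsilon^\alpha_\nabla&=\mathrm D\widetilde\epsilon^\alpha_\nabla-\widetilde\epsilon^\beta_\nabla\mathrm D_\beta Q^\alpha_\nabla-\tfrac12\epsilon^\beta_\nabla\epsilon^\gamma_\nabla\mathrm D_\beta\mathrm D_\gamma Q^\alpha_\nabla+s^\nabla_{\rm triv}\epsilon^\alpha_\nabla,\\ s_0^\nabla\widetilde\epsilon^\alpha_\nabla&=\widetilde\epsilon^\beta_\nabla\epsilon^\gamma_\nabla\mathrm D_\beta\mathrm D_\gamma Q^\alpha_\nabla+\tfrac1{3!}\epsilon^\beta_\nabla\epsilon^\gamma_\nabla\epsilon^\delta_\nabla\mathrm D_\beta\mathrm D_\gamma\mathrm D_\delta Q^\alpha_\nabla. \end{aligned}$$ Multiple products are read with the Koszul sign rule: each $\mathrm D_\beta$, of form degree $-|\beta|$, is moved to the right past the later ghosts, $\epsilon^\gamma_\nabla$ having form degree $|\gamma|-1$. 3. Explicitly, $$\begin{aligned} s_0^\nabla X^\mu&=\rho_a{}^\mu\epsilon^a,\\ s_0^\nabla\epsilon^a&=-\eta^{ab}\rho_b{}^\mu\widetilde\psi^\nabla_\mu+\mathcal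 T^a_{bc}\epsilon^b\epsilon^c,\\ s_0^\nabla A^a&=\mathrm D\epsilon^a+\eta^{ab}\rho_b{}^\mu\psi^\nabla_\mu-2\mathcal T^a_{bc}A^b\epsilon^c,\\ s_0^\nabla\widetilde\psi^\nabla_\mu&=-\nabla_\mu\rho_a{}^\nu\,\widetilde\psi^\nabla_\nu\epsilon^a-\tfrac13\widetilde{\mathcal S}_{\mu abc}\epsilon^a\epsilon^b\epsilon^c,\\ s_0^\nabla\psi^\nabla_\mu&=\mathrm D\widetilde\psi^\nabla_\mu+\nabla_\mu\rho_a{}^\nu(\widetilde\psi^\nabla_\nu A^a+\psi^\nabla_\nu\epsilon^a)+\widetilde{\mathcal S}_{\mu abc}A^a\epsilon^b\epsilon^c+s^\nabla_{\rm triv}\psi^\nabla_\mu,\\ s_0^\nabla B^\nabla_\mu&=-\mathrm D\psi^\nabla_\mu+\nabla_\mu\rho_a{}^\nu(\psi^\nabla_\nu A^a-B^\nabla_\nu\epsilon^a)-\widetilde{\mathcal S}_{\mu abc}A^aA^b\epsilon^c+s^\nabla_{\rm triv}B^\nabla_\mu. \end{aligned}$$ 4. The trivial terms vanish on the stationary surface: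 all $s^\nabla_{\rm triv}\phi^\alpha_\nabla$ and $s^\nabla_{\rm triv}\epsilon^\alpha_\nabla$ lie in the ideal generated by the $F^\mu$. 5. The transformations do not depend on the coordinates or the frame. Let $x'^{\mu}$, $\mathfrak e'_a$ be other coordinates and another frame with constant $\eta'_{ab}$, and let $\mathfrak e_a=\Lambda_a{}^{a'}\mathfrak e'_{a'}$, $\Lambda_\mu{}^{\mu'}=\partial x'^{\mu'}/\partial x^\mu$, $\lambda_{\mu ab}=\partial_\mu(\Lambda^{-1})_a{}^c\,\Lambda_c{}^d\,\eta'_{db}$. There is exactly one algebra homomorphism that fixes all $X^*f$, commutes with $\mathrm d$ and replaces $A^a,\epsilon^a$ by $(\Lambda^{-1})_{a'}{}^aA'^{a'},(\Lambda^{-1})_{a'}{}^a\epsilon'^{a'}$, and $$\begin{aligned}B_\mu&\ \text{by}\ \Lambda_\mu{}^{\mu'}B'_{\mu'}+\tfrac12\lambda_{\mu ab}A'^aA'^b,\\\psi_\mu&\ \text{by}\ \Lambda_\mu{}^{\mu'}\psi'_{\mu'}+\lambda_{\mu ab}A'^a\epsilon'^b,\\\widetilde\psi_\mu&\ \text{by}\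 \Lambda_\mu{}^{\mu'}\widetilde\psi'_{\mu'}+\tfrac12\lambda_{\mu ab}\epsilon'^a\epsilon'^b.\end{aligned}$$ Under it $B^\nabla_\mu,\psi^\nabla_\mu,\widetilde\psi^\nabla_\mu$ and $s_0^\nabla B^\nabla_\mu,s_0^\nabla\psi^\nabla_\mu,s_0^\nabla\widetilde\psi^\nabla_\mu$ transform homogeneously with $\Lambda_\mu{}^{\mu'}$; $s_0^\nabla A^a,s_0^\nabla\epsilon^a$ transform homogeneously with $(\Lambda^{-1})_{a'}{}^a$; and the transformation $s_0(X^*f)$ of every function $f$ is unchanged. -/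

import Mathlib

open scoped Manifold ContDiff

namespace TCSM

noncomputable section

/-! ## Bigraded commutative algebras over a ring of functions

`GAlg 𝒞 deg` is the free bigraded-commutative algebra over the ring of functions `𝒞` on generators
`G` with bidegrees `deg : G → ℤ × ℤ` (form degree, ghost degree). Elements of bidegrees `(f, g)` and
`(f', g')` commute up to the (Deligne) sign `(-1) ^ (f * f' + g * g')`. -/

/-- The exponent of the Deligne sign of two bidegrees. -/
def pair (p q : ℤ × ℤ) : ℤ := p.1 * q.1 + p.2 * q.2

/-- The sign `(-1) ^ k`. -/
def sgn (k : ℤ) : ℝ := (-1) ^ k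

inductive SignRel (𝒞 : Type*) [CommRing 𝒞] [Algebra ℝ 𝒞] {G : Type*} (deg : G → ℤ × ℤ) :
    FreeAlgebra ℝ (𝒞 ⊕ G) → FreeAlgebra ℝ (𝒞 ⊕ G) → Prop
  | add (f g : 𝒞) : SignRel 𝒞 deg (FreeAlgebra.ι ℝ (Sum.inl (f + g)))
      (FreeAlgebra.ι ℝ (Sum.inl f) + FreeAlgebra.ι ℝ (Sum.inl g))
  | mul (f g : 𝒞) : SignRel 𝒞 deg (FreeAlgebra.ι ℝ (Sum.inl (f * g)))
      (FreeAlgebra.ι ℝ (Sum.inl f) * FreeAlgebra.ι ℝ (Sum.inl g))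
  | const (c : ℝ) : SignRel 𝒞 deg (FreeAlgebra.ι ℝ (Sum.inl (algebraMap ℝ 𝒞 c)))
      (algebraMap ℝ _ c)
  | central (f : 𝒞) (x : G) : SignRel 𝒞 deg
      (FreeAlgebra.ι ℝ (Sum.inl f) * FreeAlgebra.ι ℝ (Sum.inr x))
      (FreeAlgebra.ι ℝ (Sum.inr x) * FreeAlgebra.ι ℝ (Sum.inl f))
  | swap (x y : G) : SignRel 𝒞 deg
      (FreeAlgebra.ι ℝ (Sum.inr x) * FreeAlgebra.ι ℝ (Sum.inr y))
      (sgn (pair (deg x) (deg y)) • (FreeAlgebra.ι ℝ (Sum.inr y) * FreeAlgebra.ι ℝ (Sum.inr x)))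

/-- The free bigraded-commutative `𝒞`-algebra on generators `G` of bidegree `deg`. -/
def GAlg (𝒞 : Type*) [CommRing 𝒞] [Algebra ℝ 𝒞] {G : Type*} (deg : G → ℤ × ℤ) : Type _ :=
  RingQuot (SignRel 𝒞 deg)

section GAlg

variable {𝒞 : Type*} [CommRing 𝒞] [Algebra ℝ 𝒞] {G : Type*} {deg : G → ℤ × ℤ}

instance : Ring (GAlg 𝒞 deg) := inferInstanceAs (Ring (RingQuot (SignRel 𝒞 deg)))
instance : Algebra ℝ (GAlg 𝒞 deg) := inferInstanceAs (Algebra ℝ (RingQuot (SignRel 𝒞 deg)))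

/-- The quotient map from the free algebra. -/
def mk : FreeAlgebra ℝ (𝒞 ⊕ G) →ₐ[ℝ] GAlg 𝒞 deg := RingQuot.mkAlgHom ℝ (SignRel 𝒞 deg)

theorem mk_rel {x y : FreeAlgebra ℝ (𝒞 ⊕ G)} (h : SignRel 𝒞 deg x y) :
    (mk x : GAlg 𝒞 deg) = mk y := RingQuot.mkAlgHom_rel ℝ h

/-- The inclusion of the functions. -/
def fn : 𝒞 →ₐ[ℝ] GAlg 𝒞 deg :=
  AlgHom.ofLinearMap
    { toFun := fun f => mk (FreeAlgebra.ι ℝ (Sum.inl f))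
      map_add' := fun f g => by rw [mk_rel (SignRel.add f g), map_add]
      map_smul' := fun c f => by
        rw [Algebra.smul_def, mk_rel (SignRel.mul _ f), map_mul, mk_rel (SignRel.const c),
          AlgHom.commutes, RingHom.id_apply, Algebra.smul_def] }
    (by
      have h := mk_rel (deg := deg) (SignRel.const (𝒞 := 𝒞) 1)
      simpa using h)
    (fun f g => by
      have h := mk_rel (deg := deg) (SignRel.mul f g)
      simpa using h)

/-- The generators. -/
def gen (x : G) : GAlg 𝒞 deg := mk (FreeAlgebra.ι ℝ (Sum.inr x))

/-- Functions act by multiplication: `f • z = fn f * z`. -/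
instance : Module 𝒞 (GAlg 𝒞 deg) :=
  Module.compHom (GAlg 𝒞 deg) (fn : 𝒞 →ₐ[ℝ] GAlg 𝒞 deg).toRingHom

theorem fsmul_def (f : 𝒞) (z : GAlg 𝒞 deg) : f • z = fn f * z := rfl

theorem fn_central (f : 𝒞) (x : G) :
    (fn f : GAlg 𝒞 deg) * gen x = gen x * fn f := by
  have h := mk_rel (deg := deg) (SignRel.central f x)
  rwa [map_mul, map_mul] at h

theorem gen_swap (x y : G) : (gen x : GAlg 𝒞 deg) * gen y
    = sgn (pair (deg x) (deg y)) • (gen y * gen x) := by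
  have h := mk_rel (𝒞 := 𝒞) (SignRel.swap (deg := deg) x y)
  rwa [map_mul, map_smul, map_mul] at h

/-- The universal property. -/
def lift {W : Type*} [Ring W] [Algebra ℝ W] (φ : 𝒞 →ₐ[ℝ] W) (γ : G → W)
    (h₁ : ∀ f x, φ f * γ x = γ x * φ f)
    (h₂ : ∀ x y, γ x * γ y = sgn (pair (deg x) (deg y)) • (γ y * γ x)) :
    GAlg 𝒞 deg →ₐ[ℝ] W :=
  RingQuot.liftAlgHom ℝ ⟨FreeAlgebra.lift ℝ (Sum.elim φ γ), by
    intro x y h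
    induction h with
    | add f g => simp
    | mul f g => simp
    | const c => simp
    | central f x => simpa using h₁ f x
    | swap x y => simpa using h₂ x y⟩

theorem lift_mk {W : Type*} [Ring W] [Algebra ℝ W] (φ : 𝒞 →ₐ[ℝ] W) (γ : G → W) (h₁) (h₂)
    (x : FreeAlgebra ℝ (𝒞 ⊕ G)) :
    lift (deg := deg) φ γ h₁ h₂ (mk x) = FreeAlgebra.lift ℝ (Sum.elim φ γ) x :=
  RingQuot.liftAlgHom_mkAlgHom_apply ..

@[simp] theorem lift_fn {W : Type*} [Ring W] [Algebra ℝ W] (φ : 𝒞 →ₐ[ℝ] W) (γ : G → W)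
    (h₁) (h₂) (f : 𝒞) : lift (deg := deg) φ γ h₁ h₂ (fn f) = φ f :=
  (lift_mk φ γ h₁ h₂ _).trans (by simp)

@[simp] theorem lift_gen {W : Type*} [Ring W] [Algebra ℝ W] (φ : 𝒞 →ₐ[ℝ] W) (γ : G → W)
    (h₁) (h₂) (x : G) : lift (deg := deg) φ γ h₁ h₂ (gen x) = γ x :=
  (lift_mk φ γ h₁ h₂ _).trans (by simp)

/-- Induction principle for the free bigraded-commutative algebra. -/
theorem gAlg_induction {P : GAlg 𝒞 deg → Prop} (hf : ∀ f, P (fn f)) (hg : ∀ x, P (gen x))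
    (hadd : ∀ z w, P z → P w → P (z + w)) (hmul : ∀ z w, P z → P w → P (z * w))
    (z : GAlg 𝒞 deg) : P z := by
  obtain ⟨x, rfl⟩ := RingQuot.mkAlgHom_surjective ℝ (SignRel 𝒞 deg) z
  change P (mk x)
  induction x using FreeAlgebra.induction with
  | grade0 c =>
    have h := hf (algebraMap ℝ 𝒞 c)
    rw [AlgHom.commutes] at h
    rwa [AlgHom.commutes]
  | grade1 x =>
    cases x with
    | inl f => exact hf f
    | inr x => exact hg x
  | mul x y hx hy => rw [map_mul]; exact hmul _ _ hx hy
  | add x y hx hy => rw [map_add]; exact hadd _ _ hx hy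

theorem sgn_add (k l : ℤ) : sgn (k + l) = sgn k * sgn l :=
  zpow_add₀ (by norm_num) k l

theorem sgn_sq (k : ℤ) : sgn k * sgn k = 1 := by
  rw [sgn, ← mul_zpow]; simp

theorem pair_add_left (p q s : ℤ × ℤ) : pair (p + q) s = pair p s + pair q s := by
  simp only [pair, Prod.fst_add, Prod.snd_add]; ring

theorem pair_add_right (p q s : ℤ × ℤ) : pair s (p + q) = pair s p + pair s q := by
  simp only [pair, Prod.fst_add, Prod.snd_add]; ring

theorem pair_comm (p q : ℤ × ℤ) : pair p q = pair q p := by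
  simp only [pair]; ring

/-- The automorphism multiplying an element of bidegree `D` by `(-1) ^ (pair p D)`. -/
def signAut (p : ℤ × ℤ) : GAlg 𝒞 deg →ₐ[ℝ] GAlg 𝒞 deg :=
  lift fn (fun x => sgn (pair p (deg x)) • gen x)
    (fun f x => by rw [mul_smul_comm, smul_mul_assoc, fn_central])
    (fun x y => by
      rw [smul_mul_smul_comm, smul_mul_smul_comm, gen_swap, smul_smul, smul_smul]
      congr 1; ring)

@[simp] theorem signAut_fn (p : ℤ × ℤ) (f : 𝒞) :
    signAut p (fn f : GAlg 𝒞 deg) = fn f := lift_fn ..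

@[simp] theorem signAut_gen (p : ℤ × ℤ) (x : G) :
    signAut p (gen x : GAlg 𝒞 deg) = sgn (pair p (deg x)) • gen x := lift_gen ..

theorem signAut_comm (p q : ℤ × ℤ) (z : GAlg 𝒞 deg) :
    signAut p (signAut q z) = signAut q (signAut p z) := by
  induction z using gAlg_induction with
  | hf f => simp
  | hg x => simp only [signAut_gen, map_smul]; rw [smul_comm]
  | hadd z w hz hw => simp only [map_add, hz, hw]
  | hmul z w hz hw => simp only [map_mul, hz, hw]

/-- `z` is homogeneous of bidegree `D` and commutes with functions and generators by the sign rule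
of an element of bidegree `D`. -/
def HasSign (z : GAlg 𝒞 deg) (D : ℤ × ℤ) : Prop :=
  (∀ f : 𝒞, z * fn f = fn f * z) ∧
    (∀ x : G, z * gen x = sgn (pair D (deg x)) • (gen x * z)) ∧
    ∀ p, signAut p z = sgn (pair p D) • z

namespace HasSign

theorem gen (x : G) : HasSign (TCSM.gen x : GAlg 𝒞 deg) (deg x) :=
  ⟨fun f => (fn_central f x).symm, fun y => gen_swap x y, fun p => signAut_gen p x⟩

theorem zero (D : ℤ × ℤ) : HasSign (0 : GAlg 𝒞 deg) D := ⟨by simp, by simp, by simp⟩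

theorem fn (f : 𝒞) : HasSign (TCSM.fn f : GAlg 𝒞 deg) (0, 0) :=
  ⟨fun g => by rw [← map_mul, ← map_mul, mul_comm], fun x => by
    simp [pair, sgn, fn_central], fun p => by simp [pair, sgn]⟩

theorem one : HasSign (1 : GAlg 𝒞 deg) (0, 0) := by
  have h := HasSign.fn (deg := deg) (1 : 𝒞)
  rwa [map_one] at h

theorem add {z w : GAlg 𝒞 deg} {D} (hz : HasSign z D) (hw : HasSign w D) : HasSign (z + w) D :=
  ⟨fun f => by rw [add_mul, mul_add, hz.1, hw.1],
   fun x => by rw [add_mul, mul_add, hz.2.1, hw.2.1, smul_add],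
   fun p => by rw [map_add, hz.2.2, hw.2.2, smul_add]⟩

theorem smul (c : ℝ) {z : GAlg 𝒞 deg} {D} (hz : HasSign z D) : HasSign (c • z) D :=
  ⟨fun f => by rw [smul_mul_assoc, hz.1, mul_smul_comm],
   fun x => by rw [smul_mul_assoc, hz.2.1, mul_smul_comm, smul_comm],
   fun p => by rw [map_smul, hz.2.2, smul_comm]⟩

theorem neg {z : GAlg 𝒞 deg} {D} (hz : HasSign z D) : HasSign (-z) D := by
  simpa using hz.smul (-1)

theorem sub {z w : GAlg 𝒞 deg} {D} (hz : HasSign z D) (hw : HasSign w D) : HasSign (z - w) D := by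
  rw [sub_eq_add_neg]; exact hz.add hw.neg

theorem mul {z w : GAlg 𝒞 deg} {D E F} (hz : HasSign z D) (hw : HasSign w E)
    (h : D + E = F) : HasSign (z * w) F := by
  subst h
  refine ⟨fun f => ?_, fun x => ?_, fun p => ?_⟩
  · rw [mul_assoc, hw.1, ← mul_assoc, hz.1, mul_assoc]
  · rw [mul_assoc, hw.2.1, mul_smul_comm, ← mul_assoc, hz.2.1, smul_mul_assoc, smul_smul,
      mul_assoc, pair_add_left, sgn_add, mul_comm (sgn _)]
  · rw [map_mul, hz.2.2, hw.2.2, smul_mul_smul_comm, pair_add_right, sgn_add]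

theorem fsmul (f : 𝒞) {z : GAlg 𝒞 deg} {D} (hz : HasSign z D) : HasSign (f • z) D :=
  (HasSign.fn f).mul hz (by simp [Prod.ext_iff])

theorem sum {ι : Type*} {s : Finset ι} {z : ι → GAlg 𝒞 deg} {D} (h : ∀ i, HasSign (z i) D) :
    HasSign (∑ i ∈ s, z i) D := by
  classical
  induction s using Finset.induction_on with
  | empty => simpa using zero D
  | insert a s ha ih => rw [Finset.sum_insert ha]; exact (h a).add ih

end HasSign

/-- The values of a derivation of bidegree `p`: on functions it is `f ↦ ∑ μ, ∂_μ f • v μ` for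
derivations `∂_μ` of `𝒞`, on generators it is `w`. -/
structure DerData (𝒞 : Type*) [CommRing 𝒞] [Algebra ℝ 𝒞] {G : Type*} (deg : G → ℤ × ℤ)
    (n : ℕ) (p : ℤ × ℤ) where
  pd : Fin n → Derivation ℝ 𝒞 𝒞
  v : Fin n → GAlg 𝒞 deg
  w : G → GAlg 𝒞 deg
  hv : ∀ μ, HasSign (v μ) p
  hw : ∀ x, HasSign (w x) (deg x + p)

/-- Upper triangular matrices. -/
def tri (a b d : GAlg 𝒞 deg) : Matrix (Fin 2) (Fin 2) (GAlg 𝒞 deg) := !![a, b; 0, d]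

theorem tri_mul (a b d a' b' d' : GAlg 𝒞 deg) :
    tri a b d * tri a' b' d' = tri (a * a') (a * b' + b * d') (d * d') := by
  simp [tri]

theorem tri_smul (c : ℝ) (a b d : GAlg 𝒞 deg) :
    c • tri a b d = tri (c • a) (c • b) (c • d) := by
  ext i j; fin_cases i <;> fin_cases j <;> simp [tri]

namespace DerData

variable {n : ℕ} {p : ℤ × ℤ}

/-- The value on a function. -/
def onFn (δ : DerData 𝒞 deg n p) (f : 𝒞) : GAlg 𝒞 deg := ∑ μ, δ.pd μ f • δ.v μ

theorem onFn_sign (δ : DerData 𝒞 deg n p) (f : 𝒞) : HasSign (δ.onFn f) p :=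
  HasSign.sum fun μ => (δ.hv μ).fsmul _

theorem onFn_add (δ : DerData 𝒞 deg n p) (f g : 𝒞) : δ.onFn (f + g) = δ.onFn f + δ.onFn g := by
  simp [onFn, add_smul, Finset.sum_add_distrib]

theorem onFn_mul (δ : DerData 𝒞 deg n p) (f g : 𝒞) :
    δ.onFn (f * g) = fn f * δ.onFn g + δ.onFn f * fn g := by
  rw [(δ.onFn_sign f).1]
  simp only [onFn, Derivation.leibniz, add_smul, Finset.sum_add_distrib, Finset.mul_sum,
    smul_eq_mul, fsmul_def, map_mul, mul_assoc]

theorem onFn_const (δ : DerData 𝒞 deg n p) (c : ℝ) : δ.onFn (algebraMap ℝ 𝒞 c) = 0 := by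
  simp [onFn]

/-- `z ↦ [[±z, δ z], [0, z]]`, multiplicative exactly because `δ` satisfies the graded Leibniz
rule. -/
def rep (δ : DerData 𝒞 deg n p) :
    GAlg 𝒞 deg →ₐ[ℝ] Matrix (Fin 2) (Fin 2) (GAlg 𝒞 deg) :=
  lift
    (AlgHom.ofLinearMap
      { toFun := fun f => tri (fn f) (δ.onFn f) (fn f)
        map_add' := fun f g => by
          ext i j; fin_cases i <;> fin_cases j <;> simp [tri, onFn_add]
        map_smul' := fun c f => by
          have h : δ.onFn (c • f) = c • δ.onFn f := by
            rw [Algebra.smul_def, onFn_mul, onFn_const, zero_mul, add_zero, AlgHom.commutes,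
              Algebra.smul_def]
          rw [RingHom.id_apply, tri_smul, map_smul, h] }
      (by
        have h := δ.onFn_const 1
        rw [map_one] at h
        ext i j; fin_cases i <;> fin_cases j <;> simp [tri, h])
      (fun f g => by
        simp only [LinearMap.coe_mk, AddHom.coe_mk, tri_mul, map_mul, onFn_mul]))
    (fun x => tri (sgn (pair p (deg x)) • gen x) (δ.w x) (gen x))
    (fun f x => by
      simp only [AlgHom.ofLinearMap_apply, LinearMap.coe_mk, AddHom.coe_mk, tri_mul]
      rw [mul_smul_comm, smul_mul_assoc, fn_central, (δ.onFn_sign f).2.1, (δ.hw x).1,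
        smul_mul_assoc, add_comm])
    (fun x y => by
      rw [tri_mul, tri_mul, tri_smul]
      congr 1
      · rw [smul_mul_smul_comm, smul_mul_smul_comm, gen_swap, smul_smul, smul_smul]
        congr 1; ring
      · rw [(δ.hw x).2.1, smul_add, smul_mul_assoc, smul_mul_assoc, (δ.hw y).2.1, smul_smul,
          smul_smul, pair_add_left, pair_add_left, sgn_add, sgn_add, pair_comm (deg y) (deg x),
          ← mul_assoc, sgn_sq, one_mul, add_comm]
      · exact gen_swap x y)

/-- The derivation of bidegree `p` with the prescribed values. -/
def der (δ : DerData 𝒞 deg n p) : GAlg 𝒞 deg →ₗ[ℝ] GAlg 𝒞 deg where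
  toFun z := δ.rep z 0 1
  map_add' z w := by simp
  map_smul' c z := by simp

theorem rep_eq (δ : DerData 𝒞 deg n p) (z : GAlg 𝒞 deg) :
    δ.rep z = tri (signAut p z) (δ.der z) z := by
  have h : δ.rep z 0 0 = signAut p z ∧ δ.rep z 1 0 = 0 ∧ δ.rep z 1 1 = z := by
    induction z using gAlg_induction with
    | hf f => simp [rep, tri, signAut]
    | hg x => simp [rep, tri, signAut]
    | hadd z w hz hw => simp [hz, hw]
    | hmul z w hz hw => simp [Matrix.mul_apply, Fin.sum_univ_two, hz, hw]
  ext i j; fin_cases i <;> fin_cases j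
  · exact h.1
  · rfl
  · exact h.2.1
  · exact h.2.2

@[simp] theorem der_fn (δ : DerData 𝒞 deg n p) (f : 𝒞) : δ.der (fn f) = δ.onFn f := by
  simp [der, rep, tri]

@[simp] theorem der_gen (δ : DerData 𝒞 deg n p) (x : G) : δ.der (gen x) = δ.w x := by
  simp [der, rep, tri]

/-- The graded Leibniz rule. -/
theorem der_mul (δ : DerData 𝒞 deg n p) (z w : GAlg 𝒞 deg) :
    δ.der (z * w) = δ.der z * w + signAut p z * δ.der w := by
  have h := δ.rep_eq (z * w)
  rw [map_mul, rep_eq, rep_eq, tri_mul] at h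
  have h' := congrFun (congrFun h 0) 1
  simp only [tri, Matrix.of_apply, Matrix.cons_val', Matrix.cons_val_zero, Matrix.cons_val_one,
    Matrix.cons_val_fin_one] at h'
  rw [← h', add_comm]

theorem signAut_der (δ : DerData 𝒞 deg n p) (q : ℤ × ℤ) (z : GAlg 𝒞 deg) :
    signAut q (δ.der z) = sgn (pair q p) • δ.der (signAut q z) := by
  induction z using gAlg_induction with
  | hf f => rw [signAut_fn, der_fn, (δ.onFn_sign f).2.2]
  | hg x =>
    rw [signAut_gen, map_smul, der_gen, (δ.hw x).2.2, smul_smul, pair_add_right, sgn_add, mul_comm]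
  | hadd z w hz hw => simp only [map_add, hz, hw, smul_add]
  | hmul z w hz hw =>
    simp only [map_mul, der_mul, map_add, hz, hw, smul_add, smul_mul_assoc, mul_smul_comm,
      signAut_comm q p z]

/-- A derivation with values on which `z` acts by the sign rule maps `z` of bidegree `D` to an
element of bidegree `D + p`. -/
theorem der_sign (δ : DerData 𝒞 deg n p) {z : GAlg 𝒞 deg} {D : ℤ × ℤ} (hz : HasSign z D)
    (h₁ : ∀ μ, z * δ.v μ = sgn (pair D p) • (δ.v μ * z))
    (h₂ : ∀ x, z * δ.w x = sgn (pair D (deg x + p)) • (δ.w x * z)) :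
    HasSign (δ.der z) (D + p) := by
  refine ⟨fun f => ?_, fun x => ?_, fun q => ?_⟩
  · have h := congrArg δ.der (hz.1 f)
    rw [der_mul, der_mul, der_fn, signAut_fn, hz.2.2] at h
    have h' : sgn (pair p D) • z * δ.onFn f = δ.onFn f * z := by
      simp only [onFn, Finset.mul_sum, Finset.sum_mul, fsmul_def]
      refine Finset.sum_congr rfl fun μ _ => ?_
      rw [smul_mul_assoc, ← mul_assoc, hz.1, mul_assoc, h₁, mul_smul_comm, smul_smul, pair_comm,
        sgn_sq, one_smul, mul_assoc]
    rw [h', add_comm] at h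
    exact add_left_cancel h
  · have h := congrArg δ.der (hz.2.1 x)
    rw [map_smul, der_mul, der_mul, der_gen, signAut_gen, hz.2.2] at h
    have h' : sgn (pair p D) • z * δ.w x = sgn (pair D (deg x)) • (δ.w x * z) := by
      rw [smul_mul_assoc, h₂, smul_smul, pair_add_right, sgn_add, pair_comm p D,
        mul_comm (sgn (pair D (deg x))), ← mul_assoc, sgn_sq, one_mul]
    rw [h', smul_add, add_comm] at h
    have h'' := add_left_cancel h
    rw [h'', smul_mul_assoc, smul_smul, pair_add_left, sgn_add]
  · rw [signAut_der, hz.2.2, map_smul, smul_smul, pair_add_right, sgn_add, mul_comm]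

end DerData

end GAlg

/-! ## Twisted Courant algebroids

The base manifold enters through its ring of functions `𝒞 = C^∞(M)`, vector fields are the
derivations of `𝒞`, and `𝓔` is the `𝒞`-module of sections of the vector bundle `E`. -/

/-- Vector fields. -/
abbrev Vec (𝒞 : Type*) [CommRing 𝒞] [Algebra ℝ 𝒞] : Type _ := Derivation ℝ 𝒞 𝒞

section Geometry

variable {𝒞 : Type*} [CommRing 𝒞] [Algebra ℝ 𝒞] {𝓔 : Type*} [AddCommGroup 𝓔] [Module 𝒞 𝓔]

/-- The real number one half as a constant function. -/
def half (𝒞 : Type*) [CommRing 𝒞] [Algebra ℝ 𝒞] : 𝒞 := algebraMap ℝ 𝒞 (1 / 2)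

/-- A 4-form `H` is closed, `dH = 0` (Koszul formula). -/
def IsClosed4 (H : Vec 𝒞 [⋀^Fin 4]→ₗ[𝒞] 𝒞) : Prop :=
  ∀ X : Fin 5 → Vec 𝒞,
    ∑ i : Fin 5, (-1) ^ (i : ℕ) * X i (H fun k => X (i.succAbove k))
      + ∑ j : Fin 5, ∑ i : Fin 4, (if i.castSucc < j then
          (-1) ^ ((i : ℕ) + (j : ℕ)) *
            H (Matrix.vecCons ⁅X i.castSucc, X j⁆ fun k => X (j.succAbove (i.succAbove k)))
        else 0) = 0

/-- A 4-form twisted Courant algebroid, with Dorfman bracket `circ`. -/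
structure TwistedCourantAlgebroid (𝒞 : Type*) [CommRing 𝒞] [Algebra ℝ 𝒞]
    (𝓔 : Type*) [AddCommGroup 𝓔] [Module 𝒞 𝓔] where
  /-- the fibre metric `⟨·,·⟩` -/
  pairing : 𝓔 →ₗ[𝒞] 𝓔 →ₗ[𝒞] 𝒞
  pairing_symm : ∀ e e', pairing e e' = pairing e' e
  nondeg : Function.Bijective pairing
  anchor : 𝓔 →ₗ[𝒞] Vec 𝒞
  /-- `ρ ∘ ρ^* = 0`, where the transpose `ρ^* α` of the anchor is determined by
  `2 ⟨ρ^* α, e⟩ = α (ρ e)` -/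
  anchor_transpose : ∀ (α : Vec 𝒞 →ₗ[𝒞] 𝒞) (v : 𝓔),
    (∀ e, 2 * pairing v e = α (anchor e)) → anchor v = 0
  circ : 𝓔 →+ 𝓔 →+ 𝓔
  anchor_circ : ∀ e e', anchor (circ e e') = ⁅anchor e, anchor e'⁆
  circ_self : ∀ e e', 2 * pairing (circ e e) e' = anchor e' (pairing e e)
  circ_pairing : ∀ e e' e'',
    anchor e (pairing e' e'') = pairing (circ e e') e'' + pairing e' (circ e e'')
  /-- the twisting 4-form -/
  H : Vec 𝒞 [⋀^Fin 4]→ₗ[𝒞] 𝒞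
  H_closed : IsClosed4 H
  /-- the Jacobiator is `ρ^* H(ρ(e), ρ(e'), ρ(e''))` -/
  jacobiator : ∀ e e' e'' v,
    2 * pairing (circ e (circ e' e'') - circ (circ e e') e'' - circ e' (circ e e'')) v
      = H ![anchor v, anchor e, anchor e', anchor e'']

/-- An ordinary connection on a module of sections `𝒱`. -/
structure Connection (𝒞 : Type*) [CommRing 𝒞] [Algebra ℝ 𝒞]
    (𝒱 : Type*) [AddCommGroup 𝒱] [Module 𝒞 𝒱] where
  nabla : Vec 𝒞 → 𝒱 → 𝒱
  add_vec : ∀ X Y v, nabla (X + Y) v = nabla X v + nabla Y v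
  smul_vec : ∀ (f : 𝒞) X v, nabla (f • X) v = f • nabla X v
  add_sec : ∀ X v w, nabla X (v + w) = nabla X v + nabla X w
  leibniz : ∀ X (f : 𝒞) v, nabla X (f • v) = f • nabla X v + X f • v

/-- A twisted Courant algebroid with a connection `∇` on `TM ⊕ E`; on `E` it preserves the fibre
metric. -/
structure Target (𝒞 : Type*) [CommRing 𝒞] [Algebra ℝ 𝒞]
    (𝓔 : Type*) [AddCommGroup 𝓔] [Module 𝒞 𝓔] extends TwistedCourantAlgebroid 𝒞 𝓔 where
  conE : Connection 𝒞 𝓔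
  conT : Connection 𝒞 (Vec 𝒞)
  metric : ∀ X e e',
    X (pairing e e') = pairing (conE.nabla X e) e' + pairing e (conE.nabla X e')

namespace Target

variable (K : Target 𝒞 𝓔)

/-- The skew-symmetric Courant bracket. -/
def courant (e e' : 𝓔) : 𝓔 := half 𝒞 • (K.circ e e' - K.circ e' e)

/-- The induced `E`-connection on `E`, `∇^E_e e' = ∇_{ρ(e)} e'`. -/
def eCon (e e' : 𝓔) : 𝓔 := K.conE.nabla (K.anchor e) e'

/-- The opposite `E`-connection on `TM`. -/
def eConT (e : 𝓔) (X : Vec 𝒞) : Vec 𝒞 := K.anchor (K.conE.nabla X e) + ⁅K.anchor e, X⁆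

/-- The Gualtieri torsion of the induced `E`-connection. -/
def torsion (e₁ e₂ e₃ : 𝓔) : 𝒞 :=
  K.pairing (K.eCon e₁ e₂ - K.eCon e₂ e₁ - K.courant e₁ e₂) e₃
    + half 𝒞 * (K.pairing (K.eCon e₃ e₁) e₂ - K.pairing (K.eCon e₃ e₂) e₁)

/-- The basic curvature. -/
def basicCurv (X : Vec 𝒞) (e₁ e₂ e₃ : 𝓔) : 𝒞 :=
  K.pairing (K.conE.nabla X (K.courant e₁ e₂) - K.courant (K.conE.nabla X e₁) e₂
      - K.courant e₁ (K.conE.nabla X e₂)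
      - K.conE.nabla (K.eConT e₂ X) e₁ + K.conE.nabla (K.eConT e₁ X) e₂) e₃
    + half 𝒞 * (K.pairing (K.conE.nabla (K.eConT e₃ X) e₁) e₂
      - K.pairing (K.conE.nabla (K.eConT e₃ X) e₂) e₁)

/-- The 4-form twisted basic curvature. -/
def twistedBasicCurv (X : Vec 𝒞) (e₁ e₂ e₃ : 𝓔) : 𝒞 :=
  K.basicCurv X e₁ e₂ e₃ + half 𝒞 * K.H ![X, K.anchor e₁, K.anchor e₂, K.anchor e₃]

/-- The covariant derivative of the anchor. -/
def nablaAnchor (X : Vec 𝒞) (e : 𝓔) : Vec 𝒞 :=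
  K.conT.nabla X (K.anchor e) - K.anchor (K.conE.nabla X e)

/-- The curvature of `∇` on `E`. -/
def curv (X Y : Vec 𝒞) (e : 𝓔) : 𝓔 :=
  K.conE.nabla X (K.conE.nabla Y e) - K.conE.nabla Y (K.conE.nabla X e) - K.conE.nabla ⁅X, Y⁆ e

end Target

/-- Coordinates `x^μ` on `M` with coordinate vector fields `∂_μ`, and a frame `e_a` of `E` in which
the fibre metric has (locally) constant components. -/
structure LocalFrame (K : Target 𝒞 𝓔) (n r : ℕ) where
  x : Fin n → 𝒞
  pd : Fin n → Vec 𝒞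
  pd_x : ∀ μ ν, pd μ (x ν) = if μ = ν then 1 else 0
  expand : ∀ (D : Vec 𝒞) (f : 𝒞), D f = ∑ μ, D (x μ) * pd μ f
  e : Module.Basis (Fin r) 𝒞 𝓔
  const : ∀ (D : Vec 𝒞) a b, D (K.pairing (e a) (e b)) = 0

namespace LocalFrame

variable {K : Target 𝒞 𝓔} {n r : ℕ} (L : LocalFrame K n r)

/-- `η_{ab} = 2 ⟨e_a, e_b⟩`. -/
def eta : Matrix (Fin r) (Fin r) 𝒞 := Matrix.of fun a b => 2 * K.pairing (L.e a) (L.e b)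

/-- `η^{ab}`. -/
def etaInv : Matrix (Fin r) (Fin r) 𝒞 := L.eta⁻¹

/-- `ρ_a^μ`. -/
def rho (a : Fin r) (μ : Fin n) : 𝒞 := K.anchor (L.e a) (L.x μ)

/-- The components `η^{ab} ρ_b^μ` of the transpose `ρ^*` of the anchor. -/
def rhoStar (a : Fin r) (μ : Fin n) : 𝒞 := ∑ b, L.etaInv a b * L.rho b μ

/-- The structure functions `C^c_{ab}` (arguments `a b c`). -/
def C (a b c : Fin r) : 𝒞 := L.e.repr (K.courant (L.e a) (L.e b)) c

/-- `C_{abc} = η_{cd} C^d_{ab}`. -/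
def Clow (a b c : Fin r) : 𝒞 := ∑ d, L.eta c d * L.C a b d

/-- `ω_{μ a}^b`: `∇_μ e_a = ω_{μ a}^b e_b`. -/
def omega (μ : Fin n) (a b : Fin r) : 𝒞 := L.e.repr (K.conE.nabla (L.pd μ) (L.e a)) b

/-- `ω_{μ a b} = ω_{μ a}^c η_{cb}`. -/
def omegaLow (μ : Fin n) (a b : Fin r) : 𝒞 := ∑ c, L.omega μ a c * L.eta c b

/-- `Γ^ν_{μ σ}` (arguments `ν μ σ`): `∇_μ ∂_σ = Γ^ν_{μ σ} ∂_ν`. -/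
def Gamma (ν μ σ : Fin n) : 𝒞 := K.conT.nabla (L.pd μ) (L.pd σ) (L.x ν)

/-- `T_{abc}`. -/
def T (a b c : Fin r) : 𝒞 := K.torsion (L.e a) (L.e b) (L.e c)

/-- `T_{ab}^c`. -/
def Tup (a b c : Fin r) : 𝒞 := ∑ d, L.T a b d * L.etaInv d c

/-- `S̃_{μ abc}`. -/
def St (μ : Fin n) (a b c : Fin r) : 𝒞 := K.twistedBasicCurv (L.pd μ) (L.e a) (L.e b) (L.e c)

/-- `∇_μ ρ_a^ν` (arguments `μ a ν`). -/
def nablaRho (μ : Fin n) (a : Fin r) (ν : Fin n) : 𝒞 := K.nablaAnchor (L.pd μ) (L.e a) (L.x ν)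

/-- `R_{ab μν} = η_{ac} R^c_{b μν}`. -/
def R (a b : Fin r) (μ ν : Fin n) : 𝒞 :=
  2 * K.pairing (L.e a) (K.curv (L.pd μ) (L.pd ν) (L.e b))

/-- `H_{μν σ a}`. -/
def H₁ (μ ν σ : Fin n) (a : Fin r) : 𝒞 := K.H ![L.pd μ, L.pd ν, L.pd σ, K.anchor (L.e a)]

/-- `H_{μν ab}`. -/
def H₂ (μ ν : Fin n) (a b : Fin r) : 𝒞 :=
  K.H ![L.pd μ, L.pd ν, K.anchor (L.e a), K.anchor (L.e b)]

/-- `H_{μ abc}`. -/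
def H₃ (μ : Fin n) (a b c : Fin r) : 𝒞 :=
  K.H ![L.pd μ, K.anchor (L.e a), K.anchor (L.e b), K.anchor (L.e c)]

end LocalFrame

end Geometry

/-! ## The graded target manifold `ℳ` and its derivations -/

/-- The coordinates of degree one and two. -/
inductive TGen (n r : ℕ)
  | a (i : Fin r)
  | b (μ : Fin n)

/-- The degree of a coordinate (the ghost degree vanishes on the target). -/
def TGen.deg {n r : ℕ} : TGen n r → ℤ × ℤ
  | .a _ => (1, 0)
  | .b _ => (2, 0)

/-- Functions on `ℳ`. -/
abbrev TAlg (𝒞 : Type*) [CommRing 𝒞] [Algebra ℝ 𝒞] (n r : ℕ) : Type _ :=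
  GAlg 𝒞 (TGen.deg : TGen n r → ℤ × ℤ)

/-- The collective index `α` of the coordinates `(x^μ, a^a, b_μ)`. -/
inductive Idx (n r : ℕ)
  | x (μ : Fin n)
  | a (i : Fin r)
  | b (μ : Fin n)

/-- The degree of the coordinate labelled by `α`. -/
def Idx.deg {n r : ℕ} : Idx n r → ℤ
  | .x _ => 0
  | .a _ => 1
  | .b _ => 2

/-- The sum over the collective index. -/
def sumIdx {n r : ℕ} {W : Type*} [AddCommMonoid W] (f : Idx n r → W) : W :=
  ∑ μ, f (.x μ) + ∑ i, f (.a i) + ∑ μ, f (.b μ)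

namespace LocalFrame

variable {𝒞 : Type*} [CommRing 𝒞] [Algebra ℝ 𝒞] {𝓔 : Type*} [AddCommGroup 𝓔] [Module 𝒞 𝓔]
  {K : Target 𝒞 𝓔} {n r : ℕ} (L : LocalFrame K n r)

/-- The degree-one coordinate `a^a`. -/
def ca (_ : LocalFrame K n r) (i : Fin r) : TAlg 𝒞 n r := gen (.a i)

/-- The degree-two coordinate `b_μ`. -/
def cb (_ : LocalFrame K n r) (μ : Fin n) : TAlg 𝒞 n r := gen (.b μ)

/-- The covariant coordinate `b^∇_μ = b_μ + 1/2 ω_{μ ab} a^a a^b`. -/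
def cbNabla (μ : Fin n) : TAlg 𝒞 n r :=
  L.cb μ + (1 / 2 : ℝ) • ∑ a, ∑ b, L.omegaLow μ a b • (L.ca a * L.ca b)

theorem ca_sign (i : Fin r) : HasSign (L.ca i) (1, 0) := HasSign.gen (TGen.a i)

theorem cb_sign (μ : Fin n) : HasSign (L.cb μ) (2, 0) := HasSign.gen (TGen.b μ)

theorem caca_sign (i j : Fin r) : HasSign (L.ca i * L.ca j) (2, 0) :=
  (L.ca_sign i).mul (L.ca_sign j) rfl

theorem cbNabla_sign (μ : Fin n) : HasSign (L.cbNabla μ) (2, 0) :=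
  (L.cb_sign μ).add (HasSign.smul _ (HasSign.sum fun a => HasSign.sum fun b =>
    (L.caca_sign a b).fsmul _))

/-- The homological vector field `Q^H` in the coordinates `(x^μ, a^a, b_μ)`, a derivation of
degree 1. -/
def QH : TAlg 𝒞 n r →ₗ[ℝ] TAlg 𝒞 n r :=
  DerData.der (p := (1, 0)) {
    pd := L.pd
    v := fun μ => ∑ a, L.rho a μ • L.ca a
    w := fun
      | .a a => -(∑ μ, L.rhoStar a μ • L.cb μ
          + (1 / 2 : ℝ) • ∑ b, ∑ c, L.C b c a • (L.ca b * L.ca c))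
      | .b μ => -(∑ a, ∑ ν, L.pd μ (L.rho a ν) • (L.cb ν * L.ca a)
            + (1 / 6 : ℝ) • ∑ a, ∑ b, ∑ c, L.pd μ (L.Clow a b c) • (L.ca a * L.ca b * L.ca c))
          - (1 / 6 : ℝ) • ∑ a, ∑ b, ∑ c, L.H₃ μ a b c • (L.ca a * L.ca b * L.ca c)
    hv := fun μ => HasSign.sum fun a => (L.ca_sign a).fsmul _
    hw := by
      have h3 : ∀ a b c, HasSign (L.ca a * L.ca b * L.ca c) (3, 0) := fun a b c =>
        (L.caca_sign a b).mul (L.ca_sign c) rfl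
      rintro (a | μ)
      · exact ((HasSign.sum fun μ => (L.cb_sign μ).fsmul _).add (HasSign.smul _
          (HasSign.sum fun b => HasSign.sum fun c => (L.caca_sign b c).fsmul _))).neg
      · exact ((HasSign.sum fun a => HasSign.sum fun ν =>
            ((L.cb_sign ν).mul (L.ca_sign a) rfl).fsmul _).add
          (HasSign.smul _ (HasSign.sum fun a => HasSign.sum fun b => HasSign.sum fun c =>
            (h3 a b c).fsmul _))).neg.sub
          (HasSign.smul _ (HasSign.sum fun a => HasSign.sum fun b => HasSign.sum fun c =>
            (h3 a b c).fsmul _)) }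

/-- The derivation `D_a^{(-1)} = ∂/∂a^a + ω_{μ ba} a^b ∂/∂b_μ` of degree `-1`. -/
def D1 (i : Fin r) : TAlg 𝒞 n r →ₗ[ℝ] TAlg 𝒞 n r :=
  DerData.der (p := (-1, 0)) {
    pd := L.pd
    v := 0
    w := fun
      | .a j => if i = j then 1 else 0
      | .b μ => ∑ b, L.omegaLow μ b i • L.ca b
    hv := fun _ => HasSign.zero _
    hw := by
      rintro (j | μ)
      · change HasSign (if i = j then 1 else 0) (0, 0)
        split_ifs
        · exact HasSign.one
        · exact HasSign.zero _
      · exact HasSign.sum fun b => (L.ca_sign b).fsmul _ }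

/-- The derivation `D^μ_{(-2)} = ∂/∂b^∇_μ` of degree `-2`. -/
def D2 (μ : Fin n) : TAlg 𝒞 n r →ₗ[ℝ] TAlg 𝒞 n r :=
  DerData.der (p := (-2, 0)) {
    pd := L.pd
    v := 0
    w := fun
      | .a _ => 0
      | .b ν => if μ = ν then 1 else 0
    hv := fun _ => HasSign.zero _
    hw := by
      rintro (j | ν)
      · exact HasSign.zero _
      · change HasSign (if μ = ν then 1 else 0) (0, 0)
        split_ifs
        · exact HasSign.one
        · exact HasSign.zero _ }

/-- The derivation
`D_μ^{(0)} = ∂_μ - 1/2 ∂_μ ω_{ν bc} a^b a^c ∂/∂b_ν + Γ^σ_{νμ} b^∇_σ ∂/∂b_ν - ω_{μ b}^c a^b D_c^{(-1)}`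
of degree 0. -/
def D0 (μ : Fin n) : TAlg 𝒞 n r →ₗ[ℝ] TAlg 𝒞 n r :=
  DerData.der (p := (0, 0)) {
    pd := L.pd
    v := fun ν => if μ = ν then 1 else 0
    w := fun
      | .a c => -∑ b, L.omega μ b c • L.ca b
      | .b ν => -((1 / 2 : ℝ) • ∑ b, ∑ c, L.pd μ (L.omegaLow ν b c) • (L.ca b * L.ca c))
          + ∑ σ, L.Gamma σ ν μ • L.cbNabla σ
          - ∑ b, ∑ c, ∑ d, (L.omega μ b c * L.omegaLow ν d c) • (L.ca b * L.ca d)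
    hv := fun ν => by
      split_ifs
      · exact HasSign.one
      · exact HasSign.zero _
    hw := by
      rintro (c | ν)
      · exact (HasSign.sum fun b => (L.ca_sign b).fsmul _).neg
      · exact ((HasSign.smul _ (HasSign.sum fun b => HasSign.sum fun c =>
            (L.caca_sign b c).fsmul _)).neg.add
          (HasSign.sum fun σ => (L.cbNabla_sign σ).fsmul _)).sub
          (HasSign.sum fun b => HasSign.sum fun c => HasSign.sum fun d =>
            (L.caca_sign b d).fsmul _) }

/-- The covariant derivations `D_α`. -/
def D : Idx n r → TAlg 𝒞 n r →ₗ[ℝ] TAlg 𝒞 n r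
  | .x μ => L.D0 μ
  | .a i => L.D1 i
  | .b μ => L.D2 μ

/-- The covariant components `Q_∇^α`. -/
def QNabla : Idx n r → TAlg 𝒞 n r
  | .x μ => ∑ a, L.rho a μ • L.ca a
  | .a a => -∑ μ, L.rhoStar a μ • L.cbNabla μ
      + ∑ b, ∑ c, L.Tup b c a • (L.ca b * L.ca c)
  | .b μ => -∑ a, ∑ ν, L.nablaRho μ a ν • (L.cbNabla ν * L.ca a)
      - (1 / 3 : ℝ) • ∑ a, ∑ b, ∑ c, L.St μ a b c • (L.ca a * L.ca b * L.ca c)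

end LocalFrame

/-! ## Fields and ghosts of the sigma model

The algebra of local forms on `T[1]Σ` built from the pull-backs `X^* f` of functions `f`, the fields
`A^a`, `B_μ`, the ghosts `ε^a`, `ψ_μ`, the ghost for ghost `ψ̃_μ` and their exterior derivatives. -/

inductive FGen (n r : ℕ)
  | dX (μ : Fin n)
  | A (a : Fin r)
  | dA (a : Fin r)
  | B (μ : Fin n)
  | dB (μ : Fin n)
  | eps (a : Fin r)
  | deps (a : Fin r)
  | psi (μ : Fin n)
  | dpsi (μ : Fin n)
  | tpsi (μ : Fin n)
  | dtpsi (μ : Fin n)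

/-- Form degree and ghost degree. -/
def FGen.deg {n r : ℕ} : FGen n r → ℤ × ℤ
  | .dX _ => (1, 0)
  | .A _ => (1, 0)
  | .dA _ => (2, 0)
  | .B _ => (2, 0)
  | .dB _ => (3, 0)
  | .eps _ => (0, 1)
  | .deps _ => (1, 1)
  | .psi _ => (1, 1)
  | .dpsi _ => (2, 1)
  | .tpsi _ => (0, 2)
  | .dtpsi _ => (1, 2)

/-- The algebra of fields and ghosts; `fn f` is the pull-back `X^* f`. -/
abbrev FAlg (𝒞 : Type*) [CommRing 𝒞] [Algebra ℝ 𝒞] (n r : ℕ) : Type _ :=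
  GAlg 𝒞 (FGen.deg : FGen n r → ℤ × ℤ)

namespace LocalFrame

variable {𝒞 : Type*} [CommRing 𝒞] [Algebra ℝ 𝒞] {𝓔 : Type*} [AddCommGroup 𝓔] [Module 𝒞 𝓔]
  {K : Target 𝒞 𝓔} {n r : ℕ} (L : LocalFrame K n r)

def dX (_ : LocalFrame K n r) (μ : Fin n) : FAlg 𝒞 n r := gen (.dX μ)
def A (_ : LocalFrame K n r) (a : Fin r) : FAlg 𝒞 n r := gen (.A a)
def B (_ : LocalFrame K n r) (μ : Fin n) : FAlg 𝒞 n r := gen (.B μ)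
def eps (_ : LocalFrame K n r) (a : Fin r) : FAlg 𝒞 n r := gen (.eps a)
def psi (_ : LocalFrame K n r) (μ : Fin n) : FAlg 𝒞 n r := gen (.psi μ)
def tpsi (_ : LocalFrame K n r) (μ : Fin n) : FAlg 𝒞 n r := gen (.tpsi μ)

theorem dX_sign (μ) : HasSign (L.dX μ) (1, 0) := HasSign.gen (FGen.dX μ)
theorem A_sign (a) : HasSign (L.A a) (1, 0) := HasSign.gen (FGen.A a)
theorem B_sign (μ) : HasSign (L.B μ) (2, 0) := HasSign.gen (FGen.B μ)
theorem eps_sign (a) : HasSign (L.eps a) (0, 1) := HasSign.gen (FGen.eps a)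
theorem psi_sign (μ) : HasSign (L.psi μ) (1, 1) := HasSign.gen (FGen.psi μ)
theorem tpsi_sign (μ) : HasSign (L.tpsi μ) (0, 2) := HasSign.gen (FGen.tpsi μ)

/-- The values of the exterior derivative on the generators. -/
def dGen : FGen n r → FAlg 𝒞 n r
  | .A a => gen (.dA a)
  | .B μ => gen (.dB μ)
  | .eps a => gen (.deps a)
  | .psi μ => gen (.dpsi μ)
  | .tpsi μ => gen (.dtpsi μ)
  | _ => 0

/-- The data of the exterior derivative, `d (X^* f) = X^* (∂_μ f) dX^μ`, of bidegree `(1, 0)`. -/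
def dData : DerData 𝒞 (FGen.deg : FGen n r → ℤ × ℤ) n (1, 0) where
  pd := L.pd
  v := L.dX
  w := dGen
  hv := L.dX_sign
  hw := by
    rintro (_ | _ | _ | _ | _ | _ | _ | _ | _ | _ | _)
    all_goals first
      | exact HasSign.zero _
      | exact HasSign.gen _

/-- The exterior derivative (the homological vector field of the source `T[1]Σ`). -/
def d : FAlg 𝒞 n r →ₗ[ℝ] FAlg 𝒞 n r := L.dData.der

theorem d_sign {z : FAlg 𝒞 n r} {D E : ℤ × ℤ} (hz : HasSign z D) (h : D + (1, 0) = E) :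
    HasSign (L.d z) E := by
  subst h
  refine L.dData.der_sign hz (fun μ => hz.2.1 (FGen.dX μ)) ?_
  rintro (_ | _ | _ | _ | _ | _ | _ | _ | _ | _ | _)
  all_goals first
    | exact hz.2.1 _
    | exact (mul_zero z).trans (by
        change (0 : FAlg 𝒞 n r) = _ • (0 * z)
        rw [zero_mul, smul_zero])

/-- The field equation `F^μ = dX^μ - ρ_a^μ A^a` of the 2-form. -/
def F (μ : Fin n) : FAlg 𝒞 n r := L.dX μ - ∑ a, L.rho a μ • L.A a

/-- The field equation `G^a = dA^a + η^{ab} ρ_b^μ B_μ + 1/2 C^a_{bc} A^b A^c` of the 1-form. -/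
def eqG (a : Fin r) : FAlg 𝒞 n r :=
  L.d (L.A a) + ∑ μ, L.rhoStar a μ • L.B μ
    + (1 / 2 : ℝ) • ∑ b, ∑ c, L.C b c a • (L.A b * L.A c)

theorem F_sign (μ) : HasSign (L.F μ) (1, 0) :=
  (L.dX_sign μ).sub (HasSign.sum fun a => (L.A_sign a).fsmul _)

/-! ### The BRST operator -/

/-- `s₀ X^μ`. -/
def sX (μ : Fin n) : FAlg 𝒞 n r := ∑ a, L.rho a μ • L.eps a

/-- `s₀ A^a`. -/
def sA (a : Fin r) : FAlg 𝒞 n r :=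
  L.d (L.eps a) + ∑ μ, L.rhoStar a μ • L.psi μ + ∑ b, ∑ c, L.C b c a • (L.A b * L.eps c)

/-- `s₀ B_μ`. -/
def sB (μ : Fin n) : FAlg 𝒞 n r :=
  -L.d (L.psi μ)
    - ∑ a, ∑ ν, L.pd μ (L.rho a ν) • (L.B ν * L.eps a - L.psi ν * L.A a)
    - (1 / 2 : ℝ) • ∑ a, ∑ b, ∑ c,
        (L.pd μ (L.Clow a b c) + L.H₃ μ a b c) • (L.A a * L.A b * L.eps c)
    - (1 / 2 : ℝ) • ∑ ν, ∑ a, ∑ b, L.H₂ μ ν a b • (L.eps a * L.A b * L.F ν)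
    - (1 / 6 : ℝ) • ∑ ν, ∑ σ, ∑ a, L.H₁ μ ν σ a • (L.eps a * L.F ν * L.F σ)

/-- `s₀ ε^a`. -/
def sEps (a : Fin r) : FAlg 𝒞 n r :=
  -∑ μ, L.rhoStar a μ • L.tpsi μ
    - (1 / 2 : ℝ) • ∑ b, ∑ c, L.C b c a • (L.eps b * L.eps c)

/-- `s₀ ψ_μ`. -/
def sPsi (μ : Fin n) : FAlg 𝒞 n r :=
  L.d (L.tpsi μ)
    + ∑ a, ∑ ν, L.pd μ (L.rho a ν) • (L.tpsi ν * L.A a + L.psi ν * L.eps a)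
    + (1 / 2 : ℝ) • ∑ a, ∑ b, ∑ c,
        (L.pd μ (L.Clow a b c) + L.H₃ μ a b c) • (L.A a * L.eps b * L.eps c)
    + (1 / 4 : ℝ) • ∑ ν, ∑ a, ∑ b, L.H₂ μ ν a b • (L.eps a * L.eps b * L.F ν)

/-- `s₀ ψ̃_μ`. -/
def sTpsi (μ : Fin n) : FAlg 𝒞 n r :=
  -∑ a, ∑ ν, L.pd μ (L.rho a ν) • (L.tpsi ν * L.eps a)
    - (1 / 6 : ℝ) • ∑ a, ∑ b, ∑ c,
        (L.pd μ (L.Clow a b c) + L.H₃ μ a b c) • (L.eps a * L.eps b * L.eps c)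

theorem sX_sign (μ) : HasSign (L.sX μ) (0, 1) :=
  HasSign.sum fun a => (L.eps_sign a).fsmul _

theorem sA_sign (a) : HasSign (L.sA a) (1, 1) :=
  ((L.d_sign (L.eps_sign a) rfl).add (HasSign.sum fun μ => (L.psi_sign μ).fsmul _)).add
    (HasSign.sum fun b => HasSign.sum fun c => ((L.A_sign b).mul (L.eps_sign c) rfl).fsmul _)

theorem sB_sign (μ) : HasSign (L.sB μ) (2, 1) := by
  refine ((((L.d_sign (L.psi_sign μ) rfl).neg.sub ?_).sub ?_).sub ?_).sub ?_
  · exact HasSign.sum fun a => HasSign.sum fun ν => HasSign.fsmul _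
      (((L.B_sign ν).mul (L.eps_sign a) rfl).sub ((L.psi_sign ν).mul (L.A_sign a) rfl))
  · exact HasSign.smul _ (HasSign.sum fun a => HasSign.sum fun b => HasSign.sum fun c =>
      HasSign.fsmul _ (((L.A_sign a).mul (L.A_sign b) rfl).mul (L.eps_sign c) rfl))
  · exact HasSign.smul _ (HasSign.sum fun ν => HasSign.sum fun a => HasSign.sum fun b =>
      HasSign.fsmul _ (((L.eps_sign a).mul (L.A_sign b) rfl).mul (L.F_sign ν) rfl))
  · exact HasSign.smul _ (HasSign.sum fun ν => HasSign.sum fun σ => HasSign.sum fun a =>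
      HasSign.fsmul _ (((L.eps_sign a).mul (L.F_sign ν) rfl).mul (L.F_sign σ) rfl))

theorem sEps_sign (a) : HasSign (L.sEps a) (0, 2) :=
  (HasSign.sum fun μ => (L.tpsi_sign μ).fsmul _).neg.sub (HasSign.smul _
    (HasSign.sum fun b => HasSign.sum fun c => ((L.eps_sign b).mul (L.eps_sign c) rfl).fsmul _))

theorem sPsi_sign (μ) : HasSign (L.sPsi μ) (1, 2) := by
  refine (((L.d_sign (L.tpsi_sign μ) rfl).add ?_).add ?_).add ?_
  · exact HasSign.sum fun a => HasSign.sum fun ν => HasSign.fsmul _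
      (((L.tpsi_sign ν).mul (L.A_sign a) rfl).add ((L.psi_sign ν).mul (L.eps_sign a) rfl))
  · exact HasSign.smul _ (HasSign.sum fun a => HasSign.sum fun b => HasSign.sum fun c =>
      HasSign.fsmul _ (((L.A_sign a).mul (L.eps_sign b) rfl).mul (L.eps_sign c) rfl))
  · exact HasSign.smul _ (HasSign.sum fun ν => HasSign.sum fun a => HasSign.sum fun b =>
      HasSign.fsmul _ (((L.eps_sign a).mul (L.eps_sign b) rfl).mul (L.F_sign ν) rfl))

theorem sTpsi_sign (μ) : HasSign (L.sTpsi μ) (0, 3) := by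
  refine HasSign.sub (HasSign.neg ?_) ?_
  · exact HasSign.sum fun a => HasSign.sum fun ν => HasSign.fsmul _
      ((L.tpsi_sign ν).mul (L.eps_sign a) rfl)
  · exact HasSign.smul _ (HasSign.sum fun a => HasSign.sum fun b => HasSign.sum fun c =>
      HasSign.fsmul _ (((L.eps_sign a).mul (L.eps_sign b) rfl).mul (L.eps_sign c) rfl))

/-- The values of `s₀` on the generators; `s₀` commutes with `d`. -/
def sGen : FGen n r → FAlg 𝒞 n r
  | .dX μ => L.d (L.sX μ)
  | .A a => L.sA a
  | .dA a => L.d (L.sA a)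
  | .B μ => L.sB μ
  | .dB μ => L.d (L.sB μ)
  | .eps a => L.sEps a
  | .deps a => L.d (L.sEps a)
  | .psi μ => L.sPsi μ
  | .dpsi μ => L.d (L.sPsi μ)
  | .tpsi μ => L.sTpsi μ
  | .dtpsi μ => L.d (L.sTpsi μ)

/-- The data of the BRST operator, `s₀ (X^* f) = X^* (∂_μ f) s₀ X^μ`, of bidegree `(0, 1)`. -/
def sData : DerData 𝒞 (FGen.deg : FGen n r → ℤ × ℤ) n (0, 1) where
  pd := L.pd
  v := L.sX
  w := L.sGen
  hv := L.sX_sign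
  hw := by
    rintro (μ | a | a | μ | μ | a | a | μ | μ | μ | μ)
    · exact L.d_sign (L.sX_sign μ) rfl
    · exact L.sA_sign a
    · exact L.d_sign (L.sA_sign a) rfl
    · exact L.sB_sign μ
    · exact L.d_sign (L.sB_sign μ) rfl
    · exact L.sEps_sign a
    · exact L.d_sign (L.sEps_sign a) rfl
    · exact L.sPsi_sign μ
    · exact L.d_sign (L.sPsi_sign μ) rfl
    · exact L.sTpsi_sign μ
    · exact L.d_sign (L.sTpsi_sign μ) rfl

/-- The BRST operator `s₀` in the local frame. -/
def s₀ : FAlg 𝒞 n r →ₗ[ℝ] FAlg 𝒞 n r := L.sData.der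

/-! ### Covariant fields and transformations -/

/-- `B^∇_μ = B_μ + 1/2 ω_{μ ab} A^a A^b`. -/
def BNabla (μ : Fin n) : FAlg 𝒞 n r :=
  L.B μ + (1 / 2 : ℝ) • ∑ a, ∑ b, L.omegaLow μ a b • (L.A a * L.A b)

/-- `ψ^∇_μ = ψ_μ + ω_{μ ab} A^a ε^b`. -/
def psiNabla (μ : Fin n) : FAlg 𝒞 n r :=
  L.psi μ + ∑ a, ∑ b, L.omegaLow μ a b • (L.A a * L.eps b)

/-- `ψ̃^∇_μ = ψ̃_μ + 1/2 ω_{μ ab} ε^a ε^b`. -/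
def tpsiNabla (μ : Fin n) : FAlg 𝒞 n r :=
  L.tpsi μ + (1 / 2 : ℝ) • ∑ a, ∑ b, L.omegaLow μ a b • (L.eps a * L.eps b)

/-- Components of `s₀ (v^a ⊗ e_a)`: `s₀ v^a + s₀X^μ ω_{μ b}^a v^b`. -/
def barE (v : Fin r → FAlg 𝒞 n r) (a : Fin r) : FAlg 𝒞 n r :=
  L.s₀ (v a) + ∑ μ, ∑ b, L.omega μ b a • (L.s₀ (fn (L.x μ)) * v b)

/-- Components of `s₀ (u_μ ⊗ dx^μ)`: `s₀ u_μ - s₀X^σ Γ^ν_{μσ} u_ν`. -/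
def barT (u : Fin n → FAlg 𝒞 n r) (μ : Fin n) : FAlg 𝒞 n r :=
  L.s₀ (u μ) - ∑ ν, ∑ σ, L.Gamma ν μ σ • (L.s₀ (fn (L.x σ)) * u ν)

/-- The exterior covariant derivative `D v^a = d v^a + ω_{μ b}^a dX^μ v^b`. -/
def covDE (v : Fin r → FAlg 𝒞 n r) (a : Fin r) : FAlg 𝒞 n r :=
  L.d (v a) + ∑ μ, ∑ b, L.omega μ b a • (L.dX μ * v b)

/-- The exterior covariant derivative `D u_μ = d u_μ - Γ^ν_{μσ} dX^σ u_ν`. -/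
def covDT (u : Fin n → FAlg 𝒞 n r) (μ : Fin n) : FAlg 𝒞 n r :=
  L.d (u μ) - ∑ ν, ∑ σ, L.Gamma ν μ σ • (L.dX σ * u ν)

/-- `∂_{(μ} ω_{ν) ab} + ω_{[μ a}^d ω_{ν] bd}`, (anti)symmetrized with weight one half. -/
def kappa (μ ν : Fin n) (a b : Fin r) : 𝒞 :=
  half 𝒞 * (L.pd μ (L.omegaLow ν a b) + L.pd ν (L.omegaLow μ a b))
    + half 𝒞 * ∑ d, (L.omega μ a d * L.omegaLow ν b d - L.omega ν a d * L.omegaLow μ b d)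

/-- `s₀^∇ X^μ`. -/
def nX (μ : Fin n) : FAlg 𝒞 n r := L.s₀ (fn (L.x μ))

/-- `s₀^∇ ε^a`. -/
def nEps (a : Fin r) : FAlg 𝒞 n r := L.barE L.eps a

/-- `s₀^∇ ψ̃^∇_μ`. -/
def nTpsi (μ : Fin n) : FAlg 𝒞 n r := L.barT L.tpsiNabla μ

/-- `s₀^∇ A^a`. -/
def nA (a : Fin r) : FAlg 𝒞 n r :=
  L.barE L.A a + ∑ μ, ∑ b, L.omega μ b a • (L.F μ * L.eps b)

/-- `s₀^∇ ψ^∇_μ`. -/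
def nPsi (μ : Fin n) : FAlg 𝒞 n r :=
  L.barT L.psiNabla μ - ∑ ν, ∑ σ, L.Gamma ν μ σ • (L.tpsiNabla ν * L.F σ)
    + (1 / 2 : ℝ) • ∑ ν, ∑ a, ∑ b, L.kappa μ ν a b • (L.F ν * L.eps a * L.eps b)

/-- `s₀^∇ B^∇_μ`. -/
def nB (μ : Fin n) : FAlg 𝒞 n r :=
  L.barT L.BNabla μ - ∑ ν, ∑ σ, L.Gamma ν μ σ • (L.psiNabla ν * L.F σ)
    - ∑ ν, ∑ a, ∑ b, L.kappa μ ν a b • (L.F ν * L.A a * L.eps b)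
    - ∑ a, ∑ b, L.omegaLow μ a b • (L.eqG a * L.eps b)

/-- The trivial part `1/4 (H(ρ(ε), ρ(ε)) - R(ε, ε))(-, F)` of `s₀^∇ ψ^∇`. -/
def trivPsi (μ : Fin n) : FAlg 𝒞 n r :=
  (1 / 4 : ℝ) • ∑ ν, ∑ a, ∑ b, (L.H₂ μ ν a b - L.R a b μ ν) • (L.eps a * L.eps b * L.F ν)

/-- The trivial part
`- 1/2 (H(ρ(ε), ρ(A)) - R(ε, A))(-, F) - 1/6 H(-, ρ(ε), F, F)` of `s₀^∇ B^∇`. -/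
def trivB (μ : Fin n) : FAlg 𝒞 n r :=
  -((1 / 2 : ℝ) • ∑ ν, ∑ a, ∑ b, (L.H₂ μ ν a b - L.R a b μ ν) • (L.eps a * L.A b * L.F ν))
    - (1 / 6 : ℝ) • ∑ ν, ∑ σ, ∑ a, L.H₁ μ ν σ a • (L.eps a * L.F ν * L.F σ)

/-! ### Collective notation -/

/-- The pull-back of functions on `ℳ` by the field configuration: `a^a ↦ A^a`, `b_μ ↦ B_μ`. -/
def pull : TAlg 𝒞 n r →ₐ[ℝ] FAlg 𝒞 n r :=
  lift fn
    (fun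
      | .a a => L.A a
      | .b μ => L.B μ)
    (by
      rintro f (a | μ)
      · exact fn_central f (FGen.A a)
      · exact fn_central f (FGen.B μ))
    (by
      rintro (a | μ) (b | ν)
      · exact gen_swap (FGen.A a) (FGen.A b)
      · exact gen_swap (FGen.A a) (FGen.B ν)
      · exact gen_swap (FGen.B μ) (FGen.A b)
      · exact gen_swap (FGen.B μ) (FGen.B ν))

/-- The ghosts `ε_∇^α = (0, ε^a, -ψ^∇_μ)`. -/
def ghost : Idx n r → FAlg 𝒞 n r
  | .x _ => 0
  | .a a => L.eps a
  | .b μ => -L.psiNabla μ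

/-- The ghosts for ghosts `ε̃_∇^α = (0, 0, -ψ̃^∇_μ)`. -/
def ghost₂ : Idx n r → FAlg 𝒞 n r
  | .x _ => 0
  | .a _ => 0
  | .b μ => -L.tpsiNabla μ

/-- The exterior covariant derivative of a collective object. -/
def covD (v : Idx n r → FAlg 𝒞 n r) : Idx n r → FAlg 𝒞 n r
  | .x μ => L.d (v (.x μ)) + ∑ ν, ∑ σ, L.Gamma μ ν σ • (L.dX σ * v (.x ν))
  | .a a => L.covDE (fun b => v (.a b)) a
  | .b μ => L.covDT (fun ν => v (.b ν)) μ

/-- `s₀^∇ φ_∇^α` for `φ_∇^α = (X^μ, A^a, B^∇_μ)`. -/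
def nPhi : Idx n r → FAlg 𝒞 n r
  | .x μ => L.nX μ
  | .a a => L.nA a
  | .b μ => L.nB μ

/-- `s₀^∇ ε_∇^α`. -/
def nGhost : Idx n r → FAlg 𝒞 n r
  | .x _ => 0
  | .a a => L.nEps a
  | .b μ => -L.nPsi μ

/-- `s₀^∇ ε̃_∇^α`. -/
def nGhost₂ : Idx n r → FAlg 𝒞 n r
  | .x _ => 0
  | .a _ => 0
  | .b μ => -L.nTpsi μ

/-- The trivial part of `s₀^∇ φ_∇^α`. -/
def trivPhi : Idx n r → FAlg 𝒞 n r
  | .x _ => 0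
  | .a _ => 0
  | .b μ => L.trivB μ

/-- The trivial part of `s₀^∇ ε_∇^α`. -/
def trivGhost : Idx n r → FAlg 𝒞 n r
  | .x _ => 0
  | .a _ => 0
  | .b μ => -L.trivPsi μ

/-- `ε_∇^β D_β Q_∇^α`. -/
def ghostD (α : Idx n r) : FAlg 𝒞 n r :=
  sumIdx fun β => L.ghost β * L.pull (L.D β (L.QNabla α))

/-- `ε̃_∇^β D_β Q_∇^α`. -/
def ghost₂D (α : Idx n r) : FAlg 𝒞 n r :=
  sumIdx fun β => L.ghost₂ β * L.pull (L.D β (L.QNabla α))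

/-- `ε_∇^β ε_∇^γ D_β D_γ Q_∇^α`. This is `ε^β D_β` applied to `ε^γ D_γ Q_∇^α` with constant ghosts:
the form degree of `ε^γ` is `|γ| - 1`, and the sign comes from moving `D_β` past `ε^γ`. -/
def ghostDD (α : Idx n r) : FAlg 𝒞 n r :=
  sumIdx fun β => sumIdx fun γ => sgn (β.deg * (γ.deg - 1)) •
    (L.ghost β * L.ghost γ * L.pull (L.D β (L.D γ (L.QNabla α))))

/-- `ε̃_∇^β ε_∇^γ D_β D_γ Q_∇^α`, with the same sign rule. -/
def ghost₂DD (α : Idx n r) : FAlg 𝒞 n r :=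
  sumIdx fun β => sumIdx fun γ => sgn (β.deg * (γ.deg - 1)) •
    (L.ghost₂ β * L.ghost γ * L.pull (L.D β (L.D γ (L.QNabla α))))

/-- `ε_∇^β ε_∇^γ ε_∇^δ D_β D_γ D_δ Q_∇^α`, with the same sign rule. -/
def ghostDDD (α : Idx n r) : FAlg 𝒞 n r :=
  sumIdx fun β => sumIdx fun γ => sumIdx fun δ =>
    sgn (β.deg * (γ.deg - 1) + (β.deg + γ.deg) * (δ.deg - 1)) •
      (L.ghost β * L.ghost γ * L.ghost δ * L.pull (L.D β (L.D γ (L.D δ (L.QNabla α)))))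

/-! ### Change of frame and coordinates -/

/-- `(Λ⁻¹)_{a'}^a`: `e'_{a'} = (Λ⁻¹)_{a'}^a e_a`. -/
def lamInv (L' : LocalFrame K n r) (a' a : Fin r) : 𝒞 := L.e.repr (L'.e a') a

/-- `Λ_a^{a'}`: `e_a = Λ_a^{a'} e'_{a'}`. -/
def lam (L' : LocalFrame K n r) (a a' : Fin r) : 𝒞 := L'.e.repr (L.e a) a'

/-- `Λ_μ^{μ'} = ∂x'^{μ'} / ∂x^μ`. -/
def jac (L' : LocalFrame K n r) (μ μ' : Fin n) : 𝒞 := L.pd μ (L'.x μ')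

/-- `∂_μ (Λ⁻¹)_a^c Λ_c^d η'_{db}`. -/
def inhom (L' : LocalFrame K n r) (μ : Fin n) (a b : Fin r) : 𝒞 :=
  ∑ c, ∑ d, L.pd μ (L.lamInv L' a c) * L.lam L' c d * L'.eta d b

/-- `Φ` expresses the fields and ghosts of the frame `L` through those of the frame `L'`. -/
structure IsFrameChange (L' : LocalFrame K n r) (Φ : FAlg 𝒞 n r →ₐ[ℝ] FAlg 𝒞 n r) : Prop where
  map_fn : ∀ f : 𝒞, Φ (fn f) = fn f
  map_d : ∀ z, Φ (L.d z) = L'.d (Φ z)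
  map_A : ∀ a, Φ (L.A a) = ∑ a', L.lamInv L' a' a • L'.A a'
  map_eps : ∀ a, Φ (L.eps a) = ∑ a', L.lamInv L' a' a • L'.eps a'
  map_B : ∀ μ, Φ (L.B μ) = ∑ μ', L.jac L' μ μ' • L'.B μ'
    + (1 / 2 : ℝ) • ∑ a, ∑ b, L.inhom L' μ a b • (L'.A a * L'.A b)
  map_psi : ∀ μ, Φ (L.psi μ) = ∑ μ', L.jac L' μ μ' • L'.psi μ'
    + ∑ a, ∑ b, L.inhom L' μ a b • (L'.A a * L'.eps b)
  map_tpsi : ∀ μ, Φ (L.tpsi μ) = ∑ μ', L.jac L' μ μ' • L'.tpsi μ'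
    + (1 / 2 : ℝ) • ∑ a, ∑ b, L.inhom L' μ a b • (L'.eps a * L'.eps b)

/-- The family `u` with an upper bundle index in the frame `L` and the family `u'` in the frame `L'`
are the components of one and the same object `u^a ⊗ e_a`. -/
def TensorialE (L' : LocalFrame K n r) (Φ : FAlg 𝒞 n r →ₐ[ℝ] FAlg 𝒞 n r)
    (u u' : Fin r → FAlg 𝒞 n r) : Prop :=
  ∀ a, Φ (u a) = ∑ a', L.lamInv L' a' a • u' a'

/-- The same for a family with a lower coordinate index, `u_μ ⊗ dx^μ`. -/
def TensorialT (L' : LocalFrame K n r) (Φ : FAlg 𝒞 n r →ₐ[ℝ] FAlg 𝒞 n r)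
    (u u' : Fin n → FAlg 𝒞 n r) : Prop :=
  ∀ μ, Φ (u μ) = ∑ μ', L.jac L' μ μ' • u' μ'

end LocalFrame

end

end TCSM

open scoped Manifold ContDiff

namespace TCSM

noncomputable section

/-! ## Calculus in free bigraded-commutative algebras -/

section GAlg

variable {𝒞 : Type*} [CommRing 𝒞] [Algebra ℝ 𝒞] {G : Type*} {deg : G → ℤ × ℤ}

/-! No BRST transformation of a redefined field is expanded by brute force; the formulas for the six
fields and ghosts are obtained from one another.

(1) Homological vector field. A derivation of a free bigraded algebra is determined by its values on
functions and generators (`der_ext`). In terms of a and b^∇ the D_α are close to partial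
derivatives: D_a kills b^∇, D^μ is the derivative along b^∇, and D_μ only rotates a by ω and b^∇ by
Γ (`D1_cbNabla`, `D2_cbNabla`, `D0_cbNabla`). So Q_∇^α D_α is immediate on b^∇. That Q^H takes the
same value there is where geometry enters: in a frame with constant η, the doubled torsion and the
doubled twisted basic curvature are C-terms plus cyclic sums of ω-terms (`two_mul_T`, `two_mul_St`),
and these are the terms produced by passing from b to b^∇. The result is `QH_eq_QD`.

(2) Ghosts and ghosts for ghosts. The substitution a ↦ ε, b ↦ ψ̃ preserves total parity and
intertwines Q^H with s₀ (`ghostPull_QH`). The transformations of ε and ψ̃^∇ are therefore images of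
the components Q_∇.

(3) Descent. Let K be the derivation of bidegree (1,-1) with ε ↦ A, ψ̃ ↦ ψ, ψ ↦ -2B; formally exp K
sends ε to ε + A and ψ̃ to ψ̃ + ψ - B. The operator s₀K + Ks₀ - d is again a derivation
(`defect_mul`), and on the elements needed it takes values in the field equations F and G. Applying
K to the formula for ε gives the one for A; applying it to the formula for ψ̃^∇ gives ψ^∇, and once
more B^∇. The correction terms in the definition of s₀^∇ cancel the non-covariant part of the
defect. What is left is the curvature R and the twist H contracted with F, that is, the trivial
terms (`nPsi_eq`, `nB_eq`).

(4) Collective form. The Q_∇ are polynomials in a and b^∇, and the ghosts have no component along x,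
so only ordinary derivatives along a and b^∇ occur. Comparing the polynomial derivatives with (2)
and (3) gives the formulas with D_α.

(5) Frame independence. The change of frame exists by the universal property and is unique because
it commutes with d. The inhomogeneous term λ in the rule for B, ψ, ψ̃ compensates that of ω
(`sum_omegaLow_change`). Covariance of the transformations is then read off the explicit formulas:
each term is a covariant derivative or a contraction of a tensor that is linear over functions in
every slot with families that transform homogeneously (`SameTensor`). -/

theorem fn_mul_comm (f : 𝒞) (z : GAlg 𝒞 deg) : fn f * z = z * fn f := by
  induction z using gAlg_induction with
  | hf g => rw [← map_mul, ← map_mul, mul_comm]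
  | hg x => exact fn_central f x
  | hadd z w hz hw => rw [mul_add, add_mul, hz, hw]
  | hmul z w hz hw => rw [← mul_assoc, hz, mul_assoc, hw, mul_assoc]

instance : IsScalarTower 𝒞 (GAlg 𝒞 deg) (GAlg 𝒞 deg) :=
  ⟨fun f z w => mul_assoc (fn f) z w⟩

/-- Centrality of functions in the form in which coefficients can be pulled out of the right factor
of a product. -/
instance : SMulCommClass 𝒞 (GAlg 𝒞 deg) (GAlg 𝒞 deg) :=
  ⟨fun f z w => by
    change fn f * (z * w) = z * (fn f * w)
    rw [← mul_assoc, fn_mul_comm, mul_assoc]⟩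

instance : SMulCommClass (GAlg 𝒞 deg) 𝒞 (GAlg 𝒞 deg) :=
  ⟨fun z f w => (smul_comm f z w).symm⟩

instance : IsScalarTower ℝ 𝒞 (GAlg 𝒞 deg) :=
  ⟨fun c f z => by rw [fsmul_def, fsmul_def, map_smul, smul_mul_assoc]⟩

instance : SMulCommClass ℝ 𝒞 (GAlg 𝒞 deg) :=
  ⟨fun c f z => by rw [fsmul_def, fsmul_def, mul_smul_comm]⟩

theorem two_mul_fsmul (f : 𝒞) (z : GAlg 𝒞 deg) : (2 * f) • z = (2 : ℝ) • (f • z) := by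
  rw [two_mul, add_smul, two_smul]

theorem fn_eq_smul (f : 𝒞) : (fn f : GAlg 𝒞 deg) = f • (1 : GAlg 𝒞 deg) := by
  rw [fsmul_def, mul_one]

/-- `HasSign` only controls commutation with functions and generators. Since `signAut` is
multiplicative, the rule propagates to arbitrary elements, homogeneous or not. -/
theorem HasSign.mul_eq_signAut_mul {z : GAlg 𝒞 deg} {D : ℤ × ℤ} (hz : HasSign z D)
    (w : GAlg 𝒞 deg) : z * w = signAut D w * z := by
  induction w using gAlg_induction with
  | hf f => rw [signAut_fn, hz.1]
  | hg x => rw [signAut_gen, hz.2.1, smul_mul_assoc]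
  | hadd v w hv hw => rw [map_add, mul_add, add_mul, hv, hw]
  | hmul v w hv hw => rw [map_mul, ← mul_assoc, hv, mul_assoc, hw, mul_assoc]

/-- Elements satisfying the sign rule commute with each other up to the sign. -/
theorem HasSign.swap {z w : GAlg 𝒞 deg} {D E : ℤ × ℤ} (hz : HasSign z D) (hw : HasSign w E) :
    z * w = sgn (pair D E) • (w * z) := by
  rw [hz.mul_eq_signAut_mul, hw.2.2, smul_mul_assoc]

theorem HasSign.anticomm {z w : GAlg 𝒞 deg} {D E : ℤ × ℤ} (hz : HasSign z D) (hw : HasSign w E)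
    (h : Odd (pair D E)) : z * w = -(w * z) := by
  rw [hz.swap hw, sgn, h.neg_one_zpow, neg_one_smul]

theorem HasSign.comm {z w : GAlg 𝒞 deg} {D E : ℤ × ℤ} (hz : HasSign z D) (hw : HasSign w E)
    (h : Even (pair D E)) : z * w = w * z := by
  rw [hz.swap hw, sgn, h.neg_one_zpow, one_smul]

theorem HasSign.signAut_odd {z : GAlg 𝒞 deg} {p D : ℤ × ℤ} (hz : HasSign z D)
    (h : Odd (pair p D)) : signAut p z = -z := by
  rw [hz.2.2, sgn, h.neg_one_zpow, neg_one_smul]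

theorem HasSign.signAut_even {z : GAlg 𝒞 deg} {p D : ℤ × ℤ} (hz : HasSign z D)
    (h : Even (pair p D)) : signAut p z = z := by
  rw [hz.2.2, sgn, h.neg_one_zpow, one_smul]

theorem signAut_signAut (p q : ℤ × ℤ) (z : GAlg 𝒞 deg) :
    signAut p (signAut q z) = signAut (p + q) z := by
  induction z using gAlg_induction with
  | hf f => simp
  | hg x => rw [signAut_gen, signAut_gen, map_smul, signAut_gen, smul_smul, pair_add_left,
      sgn_add, mul_comm]
  | hadd z w hz hw => simp only [map_add, hz, hw]
  | hmul z w hz hw => simp only [map_mul, hz, hw]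

/-- Two derivations of the same bidegree that agree on functions and generators are equal. -/
theorem der_ext {p q : ℤ × ℤ} {δ δ' : GAlg 𝒞 deg → GAlg 𝒞 deg}
    (hp : ∀ z : GAlg 𝒞 deg, signAut p z = signAut q z)
    (add : ∀ z w, δ (z + w) = δ z + δ w) (add' : ∀ z w, δ' (z + w) = δ' z + δ' w)
    (leib : ∀ z w, δ (z * w) = δ z * w + signAut p z * δ w)
    (leib' : ∀ z w, δ' (z * w) = δ' z * w + signAut q z * δ' w)
    (hfn : ∀ f, δ (fn f) = δ' (fn f)) (hgen : ∀ x, δ (gen x) = δ' (gen x)) (z : GAlg 𝒞 deg) :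
    δ z = δ' z := by
  induction z using gAlg_induction with
  | hf f => exact hfn f
  | hg x => exact hgen x
  | hadd z w hz hw => rw [add, add', hz, hw]
  | hmul z w hz hw => rw [leib, leib', hz, hw, hp]

/-- Algebra homomorphisms that agree on functions and generators are equal. -/
theorem algHom_ext {W : Type*} [Ring W] [Algebra ℝ W] {Φ Ψ : GAlg 𝒞 deg →ₐ[ℝ] W}
    (hfn : ∀ f, Φ (fn f) = Ψ (fn f)) (hgen : ∀ x, Φ (gen x) = Ψ (gen x)) : Φ = Ψ := by
  ext z
  induction z using gAlg_induction with
  | hf f => exact hfn f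
  | hg x => exact hgen x
  | hadd z w hz hw => rw [map_add, map_add, hz, hw]
  | hmul z w hz hw => rw [map_mul, map_mul, hz, hw]

theorem map_fsmul {G' : Type*} {deg' : G' → ℤ × ℤ} {Φ : GAlg 𝒞 deg →ₐ[ℝ] GAlg 𝒞 deg'}
    (hfn : ∀ f, Φ (fn f) = fn f) (f : 𝒞) (z : GAlg 𝒞 deg) : Φ (f • z) = f • Φ z := by
  rw [fsmul_def, map_mul, hfn, fsmul_def]

/-! ### Sums over several indices -/

theorem sum_cycle {ι κ τ W : Type*} [Fintype ι] [Fintype κ] [Fintype τ] [AddCommMonoid W]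
    (f : ι → κ → τ → W) : ∑ a, ∑ b, ∑ c, f b c a = ∑ a, ∑ b, ∑ c, f a b c := by
  rw [Finset.sum_comm]
  exact Finset.sum_congr rfl fun b _ => Finset.sum_comm

theorem sum_reverse {ι κ τ W : Type*} [Fintype ι] [Fintype κ] [Fintype τ] [AddCommMonoid W]
    (f : ι → κ → τ → W) : ∑ c, ∑ b, ∑ a, f a b c = ∑ a, ∑ b, ∑ c, f a b c := by
  rw [Finset.sum_comm, Finset.sum_congr rfl fun b _ => Finset.sum_comm, Finset.sum_comm]

theorem sum_antisymm {ι : Type*} [Fintype ι] {f : ι → ι → 𝒞} (hf : ∀ a b, f a b = -f b a)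
    (m : ι → ι → GAlg 𝒞 deg) : ∑ a, ∑ b, f a b • m b a = -∑ a, ∑ b, f a b • m a b := by
  rw [Finset.sum_comm, ← Finset.sum_neg_distrib]
  refine Finset.sum_congr rfl fun a _ => ?_
  rw [← Finset.sum_neg_distrib]
  exact Finset.sum_congr rfl fun b _ => by rw [hf, neg_smul]

end GAlg

/-! ## Component identities of twisted Courant algebroids -/

section Geometry

variable {𝒞 : Type*} [CommRing 𝒞] [Algebra ℝ 𝒞] {𝓔 : Type*} [AddCommGroup 𝓔] [Module 𝒞 𝓔]

theorem two_mul_half : (2 : 𝒞) * half 𝒞 = 1 := by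
  have h : (2 : 𝒞) = algebraMap ℝ 𝒞 2 := (map_ofNat _ 2).symm
  rw [h, half, ← map_mul]
  norm_num

/-- Two is invertible in an ℝ-algebra. Doubled identities are preferred throughout because η is
twice the pairing. -/
theorem eq_of_two_mul_eq {a b : 𝒞} (h : 2 * a = 2 * b) : a = b := by
  linear_combination half 𝒞 * h - (a - b) * two_mul_half (𝒞 := 𝒞)

theorem vec_half (D : Vec 𝒞) : D (half 𝒞) = 0 := D.map_algebraMap _

theorem vec_ofNat (D : Vec 𝒞) (k : ℕ) [k.AtLeastTwo] : D (OfNat.ofNat k : 𝒞) = 0 :=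
  D.map_natCast k

theorem vec_two_mul (D : Vec 𝒞) (f : 𝒞) : D (2 * f) = 2 * D f := by
  rw [D.leibniz, vec_ofNat, smul_zero, add_zero, smul_eq_mul]

theorem vec_mul (D : Vec 𝒞) (f g : 𝒞) : D (f * g) = D f * g + f * D g := by
  rw [D.leibniz, smul_eq_mul, smul_eq_mul]; ring

theorem vec_sum_apply {ι : Type*} (s : Finset ι) (D : ι → Vec 𝒞) (f : 𝒞) :
    (∑ i ∈ s, D i) f = ∑ i ∈ s, D i f := by
  classical
  induction s using Finset.induction_on with
  | empty => simp
  | insert a s ha ih => rw [Finset.sum_insert ha, Finset.sum_insert ha, Derivation.add_apply, ih]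

namespace Connection

variable {𝒱 : Type*} [AddCommGroup 𝒱] [Module 𝒞 𝒱] (N : Connection 𝒞 𝒱)

/-- The covariant derivative of a fixed section as a linear map. -/
def inVec (v : 𝒱) : Vec 𝒞 →ₗ[𝒞] 𝒱 where
  toFun X := N.nabla X v
  map_add' X Y := N.add_vec X Y v
  map_smul' f X := N.smul_vec f X v

/-- The covariant derivative in a fixed direction as an additive map. -/
def inSec (X : Vec 𝒞) : 𝒱 →+ 𝒱 := AddMonoidHom.mk' (N.nabla X) (N.add_sec X)

theorem sum_vec {ι : Type*} (s : Finset ι) (X : ι → Vec 𝒞) (v : 𝒱) :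
    N.nabla (∑ i ∈ s, X i) v = ∑ i ∈ s, N.nabla (X i) v :=
  map_sum (N.inVec v) X s

theorem sum_sec {ι : Type*} (s : Finset ι) (X : Vec 𝒞) (v : ι → 𝒱) :
    N.nabla X (∑ i ∈ s, v i) = ∑ i ∈ s, N.nabla X (v i) :=
  map_sum (N.inSec X) v s

theorem sub_vec (X Y : Vec 𝒞) (v : 𝒱) : N.nabla (X - Y) v = N.nabla X v - N.nabla Y v :=
  map_sub (N.inVec v) X Y

end Connection

/-! ### Leibniz rules of the Dorfman and Courant brackets. -/

namespace Target

variable (K : Target 𝒞 𝓔)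

/-- Polarization of the axiom for `circ e e`. -/
theorem circ_add_circ (e e' e'' : 𝓔) :
    K.pairing (K.circ e e') e'' + K.pairing (K.circ e' e) e'' = K.anchor e'' (K.pairing e e') := by
  have h := K.circ_self (e + e') e''
  simp only [map_add, AddMonoidHom.add_apply, LinearMap.add_apply, mul_add, K.circ_self] at h
  rw [K.pairing_symm e' e] at h
  refine eq_of_two_mul_eq ?_
  linear_combination h

/-- The Leibniz rule is not an axiom: it follows by comparing invariance of the metric for `f • e'`
and for `e'`. It is stated after pairing with a third section, which is all that is ever needed. -/
theorem pairing_circ_smul_right (f : 𝒞) (e e' e'' : 𝓔) :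
    K.pairing (K.circ e (f • e')) e''
      = K.anchor e f * K.pairing e' e'' + f * K.pairing (K.circ e e') e'' := by
  have h := K.circ_pairing e (f • e') e''
  have h' := K.circ_pairing e e' e''
  rw [map_smul, LinearMap.smul_apply, smul_eq_mul, vec_mul, LinearMap.smul_apply,
    smul_eq_mul] at h
  linear_combination f * h' - h

/-- Exchanging the arguments costs the symmetric part of the bracket, whose dependence on f is known
from `circ_add_circ`; this reduces the left slot to the right one. -/
theorem pairing_circ_smul_left (f : 𝒞) (e e' e'' : 𝓔) :
    K.pairing (K.circ (f • e) e') e''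
      = f * K.pairing (K.circ e e') e'' + K.anchor e'' f * K.pairing e e'
        - K.anchor e' f * K.pairing e e'' := by
  have h := K.circ_add_circ (f • e) e' e''
  have h' := K.circ_add_circ e e' e''
  rw [pairing_circ_smul_right, map_smul K.pairing, LinearMap.smul_apply, smul_eq_mul, vec_mul] at h
  linear_combination h - f * h'

/-- Skew-symmetrizing removes half of the symmetric part, an exact term that drops out when the
pairing of the two arguments is constant. -/
theorem pairing_courant (e e' e'' : 𝓔) : K.pairing (K.courant e e') e''
    = K.pairing (K.circ e e') e'' - half 𝒞 * K.anchor e'' (K.pairing e e') := by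
  rw [courant, map_smul, LinearMap.smul_apply, map_sub, LinearMap.sub_apply, smul_eq_mul,
    ← circ_add_circ]
  linear_combination K.pairing (K.circ e e') e'' * two_mul_half (𝒞 := 𝒞)

theorem courant_swap (e e' : 𝓔) : K.courant e e' = -K.courant e' e := by
  rw [courant, courant, ← smul_neg, neg_sub]

theorem courant_add_left (e₁ e₂ e' : 𝓔) :
    K.courant (e₁ + e₂) e' = K.courant e₁ e' + K.courant e₂ e' := by
  simp only [courant, map_add, AddMonoidHom.add_apply, ← smul_add]
  congr 1; abel

theorem courant_add_right (e e₁ e₂ : 𝓔) :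
    K.courant e (e₁ + e₂) = K.courant e e₁ + K.courant e e₂ := by
  rw [K.courant_swap, courant_add_left, K.courant_swap e e₁, K.courant_swap e e₂, neg_add]

/-- The two anomalous terms found here are exactly what the additional terms in the Gualtieri
torsion and the basic curvature are designed to cancel. -/
theorem pairing_courant_smul_left (f : 𝒞) (e e' e'' : 𝓔) :
    K.pairing (K.courant (f • e) e') e'' = f * K.pairing (K.courant e e') e''
      - K.anchor e' f * K.pairing e e'' + half 𝒞 * (K.anchor e'' f * K.pairing e e') := by
  rw [pairing_courant, pairing_courant, pairing_circ_smul_left, map_smul, LinearMap.smul_apply,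
    smul_eq_mul, vec_mul]
  linear_combination K.anchor e'' f * K.pairing e e' * -two_mul_half (𝒞 := 𝒞)

theorem courant_sum_left {ι : Type*} (s : Finset ι) (v : ι → 𝓔) (e : 𝓔) :
    K.courant (∑ i ∈ s, v i) e = ∑ i ∈ s, K.courant (v i) e :=
  map_sum (AddMonoidHom.mk' (fun v => K.courant v e) fun v w => K.courant_add_left v w e) v s

theorem torsion_swap (e₁ e₂ e₃ : 𝓔) : K.torsion e₁ e₂ e₃ = -K.torsion e₂ e₁ e₃ := by
  simp only [torsion, K.courant_swap e₁ e₂, map_sub, map_neg, LinearMap.sub_apply,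
    LinearMap.neg_apply]
  ring

end Target

/-! ### Coordinate vector fields and the constant frame metric. -/

namespace LocalFrame

variable {K : Target 𝒞 𝓔} {n r : ℕ} (L : LocalFrame K n r)

theorem vec_expand (D : Vec 𝒞) : D = ∑ μ, D (L.x μ) • L.pd μ := by
  ext f
  rw [L.expand D f, vec_sum_apply]
  rfl

theorem vec_pd_x (D : Vec 𝒞) (μ ν : Fin n) : D (L.pd μ (L.x ν)) = 0 := by
  rw [L.pd_x]; split_ifs
  · exact D.map_one_eq_zero
  · exact map_zero D

/-- The commutator of two coordinate fields is a derivation that kills all coordinates, and a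
derivation is determined by its values on coordinates. -/
theorem pd_comm (μ ν : Fin n) (f : 𝒞) : L.pd μ (L.pd ν f) = L.pd ν (L.pd μ f) := by
  have h := L.expand ⁅L.pd μ, L.pd ν⁆ f
  simp only [Derivation.commutator_apply, vec_pd_x, sub_self, zero_mul,
    Finset.sum_const_zero] at h
  exact sub_eq_zero.mp h

theorem lie_pd (μ ν : Fin n) : ⁅L.pd μ, L.pd ν⁆ = 0 := by
  ext f
  rw [Derivation.commutator_apply, pd_comm, sub_self, Derivation.zero_apply]

theorem eta_symm (a b : Fin r) : L.eta a b = L.eta b a := by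
  simp only [eta, Matrix.of_apply, K.pairing_symm (L.e a)]

theorem eta_apply (a b : Fin r) : L.eta a b = 2 * K.pairing (L.e a) (L.e b) := rfl

theorem vec_eta (D : Vec 𝒞) (a b : Fin r) : D (L.eta a b) = 0 := by
  rw [eta_apply, vec_two_mul, L.const, mul_zero]

theorem sum_repr_eta (v : 𝓔) (c : Fin r) :
    ∑ d, L.e.repr v d * L.eta d c = 2 * K.pairing v (L.e c) := by
  conv_rhs => rw [← L.e.sum_repr v]
  simp only [map_sum, LinearMap.sum_apply, map_smul, LinearMap.smul_apply, smul_eq_mul,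
    Finset.mul_sum, eta_apply]
  exact Finset.sum_congr rfl fun d _ => by ring

/-- The section with prescribed pairings with the frame. -/
theorem exists_pairing (f : Fin r → 𝒞) : ∃ v : 𝓔, ∀ a, 2 * K.pairing v (L.e a) = f a := by
  -- The half compensates the factor 2 between η and the pairing.
  obtain ⟨v, hv⟩ := K.nondeg.2 (half 𝒞 • L.e.constr 𝒞 f)
  refine ⟨v, fun a => ?_⟩
  rw [hv, LinearMap.smul_apply, Module.Basis.constr_basis, smul_eq_mul, ← mul_assoc, two_mul_half,
    one_mul]

/-- Nondegeneracy supplies the dual frame; the components of its members are the rows of an inverse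
of η. -/
theorem exists_left_inverse : ∃ X : Matrix (Fin r) (Fin r) 𝒞, X * L.eta = 1 := by
  choose v hv using fun a => L.exists_pairing fun b => if a = b then 1 else 0
  refine ⟨Matrix.of fun a b => L.e.repr (v a) b, ?_⟩
  ext a b
  rw [Matrix.mul_apply, Matrix.one_apply]
  simpa only [Matrix.of_apply, sum_repr_eta] using hv a b

theorem isUnit_det_eta : IsUnit L.eta.det := by
  obtain ⟨X, hX⟩ := L.exists_left_inverse
  exact Matrix.isUnit_det_of_left_inverse hX

theorem eta_mul_etaInv : L.eta * L.etaInv = 1 := Matrix.mul_nonsing_inv _ L.isUnit_det_eta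

theorem etaInv_mul_eta : L.etaInv * L.eta = 1 := Matrix.nonsing_inv_mul _ L.isUnit_det_eta

theorem etaInv_symm (a b : Fin r) : L.etaInv a b = L.etaInv b a := by
  have h : L.eta.transpose = L.eta := by ext a b; exact L.eta_symm b a
  have h' : L.etaInv.transpose = L.etaInv := by
    rw [etaInv, Matrix.transpose_nonsing_inv, h]
  exact (congrFun (congrFun h' a) b).symm

/-- Raising an index gives the components of the section with the given pairings. -/
theorem repr_eq_sum_etaInv (v : 𝓔) (a : Fin r) :
    L.e.repr v a = ∑ b, L.etaInv a b * (2 * K.pairing v (L.e b)) := by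
  simp only [← sum_repr_eta, Finset.mul_sum]
  rw [Finset.sum_comm]
  have h : ∀ d, ∑ b, L.etaInv a b * (L.e.repr v d * L.eta d b)
      = L.e.repr v d * (L.etaInv * L.eta) a d := fun d => by
    rw [Matrix.mul_apply, Finset.mul_sum]
    exact Finset.sum_congr rfl fun b _ => by rw [L.eta_symm d b]; ring
  simp only [h, etaInv_mul_eta, Matrix.one_apply, mul_ite, mul_one, mul_zero,
    Finset.sum_ite_eq, Finset.mem_univ, if_true]

/-! ### Structure functions and connection coefficients -/

theorem omegaLow_eq (μ : Fin n) (a b : Fin r) :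
    L.omegaLow μ a b = 2 * K.pairing (K.conE.nabla (L.pd μ) (L.e a)) (L.e b) :=
  L.sum_repr_eta _ b

/-- Metricity of the connection, applied to a frame whose pairings are constant. -/
theorem omegaLow_swap (μ : Fin n) (a b : Fin r) : L.omegaLow μ a b = -L.omegaLow μ b a := by
  have h := K.metric (L.pd μ) (L.e a) (L.e b)
  rw [L.const, K.pairing_symm (L.e a)] at h
  rw [omegaLow_eq, omegaLow_eq]
  linear_combination -2 * h

theorem nabla_e (μ : Fin n) (a : Fin r) :
    K.conE.nabla (L.pd μ) (L.e a) = ∑ b, L.omega μ a b • L.e b :=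
  (L.e.sum_repr _).symm

theorem Clow_eq (a b c : Fin r) :
    L.Clow a b c = 2 * K.pairing (K.courant (L.e a) (L.e b)) (L.e c) := by
  rw [← sum_repr_eta]
  exact Finset.sum_congr rfl fun d _ => by rw [L.eta_symm c d, mul_comm, C]

theorem Clow_swap (a b c : Fin r) : L.Clow a b c = -L.Clow b a c := by
  rw [Clow_eq, Clow_eq, K.courant_swap, map_neg, LinearMap.neg_apply, mul_neg]

/-- In a frame with constant pairings the Courant and Dorfman brackets of frame sections agree, so
invariance of the metric under the Dorfman bracket applies. With `Clow_swap` this makes C totally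
antisymmetric. -/
theorem Clow_swap' (a b c : Fin r) : L.Clow a b c = -L.Clow a c b := by
  rw [Clow_eq, Clow_eq, K.pairing_courant, K.pairing_courant, L.const, L.const]
  have h := K.circ_pairing (L.e a) (L.e b) (L.e c)
  rw [L.const, K.pairing_symm (L.e b)] at h
  linear_combination -2 * h

theorem Clow_cycle (a b c : Fin r) : L.Clow a b c = L.Clow b c a := by
  rw [L.Clow_swap, L.Clow_swap', neg_neg]

/-- A vector field applied to a connection coefficient with one index lowered. -/
theorem vec_omegaLow (D : Vec 𝒞) (μ : Fin n) (a b : Fin r) :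
    ∑ c, D (L.omega μ a c) * L.eta c b = D (L.omegaLow μ a b) := by
  rw [omegaLow, map_sum]
  exact Finset.sum_congr rfl fun c _ => by rw [vec_mul, vec_eta, mul_zero, add_zero]

/-- Covariant derivatives of the frame along an arbitrary vector field. -/
theorem pairing_nabla_e (X : Vec 𝒞) (a b : Fin r) :
    2 * K.pairing (K.conE.nabla X (L.e a)) (L.e b) = ∑ ν, X (L.x ν) * L.omegaLow ν a b := by
  conv_lhs => rw [L.vec_expand X]
  simp only [K.conE.sum_vec, K.conE.smul_vec, map_sum, LinearMap.sum_apply, map_smul,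
    LinearMap.smul_apply, smul_eq_mul, Finset.mul_sum, omegaLow_eq]
  exact Finset.sum_congr rfl fun d _ => by ring

/-- `ρ_a^ν ω_{ν bc}`. -/
def rhoOmega (a b c : Fin r) : 𝒞 := ∑ ν, L.rho a ν * L.omegaLow ν b c

theorem rhoOmega_swap (a b c : Fin r) : L.rhoOmega a b c = -L.rhoOmega a c b := by
  simp only [rhoOmega, ← Finset.sum_neg_distrib]
  exact Finset.sum_congr rfl fun ν _ => by rw [L.omegaLow_swap]; ring

/-- Antisymmetry of ω in its bundle indices doubles the weighted difference in the definition of the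
torsion, so that it becomes the missing third term of a cyclic sum. -/
theorem two_mul_T (a b c : Fin r) : 2 * L.T a b c
    = L.rhoOmega a b c + L.rhoOmega b c a + L.rhoOmega c a b - L.Clow a b c := by
  simp only [T, Target.torsion, Target.eCon, map_sub, LinearMap.sub_apply, Clow_eq]
  have h := fun a b c => L.pairing_nabla_e (K.anchor (L.e a)) b c
  have h₁ := h a b c
  have h₂ := h b a c
  have h₃ := h c a b
  have h₄ := h c b a
  change _ = L.rhoOmega a b c at h₁
  change _ = L.rhoOmega b a c at h₂
  change _ = L.rhoOmega c a b at h₃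
  change _ = L.rhoOmega c b a at h₄
  rw [L.rhoOmega_swap] at h₂ h₄
  linear_combination h₁ - h₂ + half 𝒞 * (h₃ - h₄)
    + L.rhoOmega c a b * two_mul_half (𝒞 := 𝒞)

theorem T_swap (a b c : Fin r) : L.T a b c = -L.T b a c := K.torsion_swap _ _ _

/-- The components of `∇̄^E_{e_a} ∂_μ`. -/
def barCon (μ : Fin n) (a : Fin r) (ν : Fin n) : 𝒞 :=
  ∑ d, L.omega μ a d * L.rho d ν - L.pd μ (L.rho a ν)

theorem eConT_apply (μ : Fin n) (a : Fin r) (ν : Fin n) :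
    K.eConT (L.e a) (L.pd μ) (L.x ν) = L.barCon μ a ν := by
  rw [Target.eConT, nabla_e, Derivation.add_apply, Derivation.commutator_apply, vec_pd_x, zero_sub,
    map_sum, vec_sum_apply, barCon, sub_eq_add_neg]
  simp only [map_smul]
  rfl

/-- The part of the twisted basic curvature depending on the connection, before cyclic
symmetrization. -/
def basicPart (μ : Fin n) (a b c : Fin r) : 𝒞 :=
  ∑ ν, L.barCon μ a ν * L.omegaLow ν b c - K.anchor (L.e a) (L.omegaLow μ b c)
    - ∑ d, L.omega μ a d * L.Clow b c d

theorem basicPart_swap (μ : Fin n) (a b c : Fin r) :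
    L.basicPart μ a b c = -L.basicPart μ a c b := by
  have h₁ : ∑ ν, L.barCon μ a ν * L.omegaLow ν b c
      = -∑ ν, L.barCon μ a ν * L.omegaLow ν c b := by
    rw [← Finset.sum_neg_distrib]
    exact Finset.sum_congr rfl fun ν _ => by rw [L.omegaLow_swap]; ring
  have h₂ : ∑ d, L.omega μ a d * L.Clow b c d = -∑ d, L.omega μ a d * L.Clow c b d := by
    rw [← Finset.sum_neg_distrib]
    exact Finset.sum_congr rfl fun d _ => by rw [L.Clow_swap]; ring
  rw [basicPart, basicPart, h₁, h₂, L.omegaLow_swap μ b c, map_neg]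
  ring

/-- Here ∇e_a is a combination of frame sections with non-constant coefficients; the anchor terms
are the Leibniz anomalies of the bracket. -/
theorem courant_nabla_e (μ : Fin n) (a b c : Fin r) :
    2 * K.pairing (K.courant (K.conE.nabla (L.pd μ) (L.e a)) (L.e b)) (L.e c)
      = ∑ d, L.omega μ a d * L.Clow b c d - K.anchor (L.e b) (L.omegaLow μ a c)
        + half 𝒞 * K.anchor (L.e c) (L.omegaLow μ a b) := by
  simp only [nabla_e, K.courant_sum_left, map_sum, LinearMap.sum_apply,
    K.pairing_courant_smul_left, ← vec_omegaLow, Finset.mul_sum, ← Finset.sum_sub_distrib,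
    ← Finset.sum_add_distrib]
  refine Finset.sum_congr rfl fun d _ => ?_
  rw [← L.Clow_cycle, Clow_eq, eta_apply, eta_apply]
  ring

/-- Metricity moves ∇ off the bracket, which leaves a derivative of C and one term ωC. The two
brackets of covariant derivatives contribute the other ωC terms and the anchor derivatives of ω, and
the terms with ∇̄ contribute the rest. As for the torsion, the half-weighted difference supplies the
third cyclic term, so everything involving ω collects into cyclic permutations of `basicPart`. -/
theorem two_mul_St (μ : Fin n) (a b c : Fin r) : 2 * L.St μ a b c
    = L.pd μ (L.Clow a b c) + L.H₃ μ a b c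
      + L.basicPart μ a b c + L.basicPart μ b c a + L.basicPart μ c a b := by
  have hB : ∀ a b c, 2 * K.pairing (K.conE.nabla (K.eConT (L.e a) (L.pd μ)) (L.e b)) (L.e c)
      = ∑ ν, L.barCon μ a ν * L.omegaLow ν b c := fun a b c => by
    simp only [pairing_nabla_e, eConT_apply]
  have hBs : ∀ a b c, ∑ ν, L.barCon μ a ν * L.omegaLow ν b c
      = -∑ ν, L.barCon μ a ν * L.omegaLow ν c b := fun a b c => by
    rw [← Finset.sum_neg_distrib]
    exact Finset.sum_congr rfl fun ν _ => by rw [L.omegaLow_swap]; ring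
  have hM := K.metric (L.pd μ) (K.courant (L.e a) (L.e b)) (L.e c)
  have hC : 2 * K.pairing (K.courant (L.e a) (L.e b)) (K.conE.nabla (L.pd μ) (L.e c))
      = ∑ d, L.omega μ c d * L.Clow a b d := by
    simp only [nabla_e, map_sum, map_smul, smul_eq_mul, Finset.mul_sum, Clow_eq]
    exact Finset.sum_congr rfl fun d _ => by ring
  have hD : L.pd μ (L.Clow a b c)
      = 2 * L.pd μ (K.pairing (K.courant (L.e a) (L.e b)) (L.e c)) := by
    rw [Clow_eq, vec_two_mul]
  have h₁ := L.courant_nabla_e μ a b c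
  have h₂ := L.courant_nabla_e μ b a c
  have hs : ∑ d, L.omega μ b d * L.Clow a c d = -∑ d, L.omega μ b d * L.Clow c a d := by
    rw [← Finset.sum_neg_distrib]
    exact Finset.sum_congr rfl fun d _ => by rw [L.Clow_swap]; ring
  have ha := congrArg (K.anchor (L.e c)) (L.omegaLow_swap μ b a)
  have hc := congrArg (K.anchor (L.e b)) (L.omegaLow_swap μ a c)
  rw [map_neg] at ha hc
  rw [ha, hs] at h₂
  rw [hc] at h₁
  simp only [St, Target.twistedBasicCurv, Target.basicCurv, map_sub, map_add, LinearMap.sub_apply,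
    LinearMap.add_apply, basicPart]
  rw [K.courant_swap (L.e a) (K.conE.nabla (L.pd μ) (L.e b)), map_neg, LinearMap.neg_apply]
  have e₁ := hB b a c
  have e₂ := hB a b c
  have e₃ := hB c a b
  have e₄ := hB c b a
  rw [hBs] at e₁ e₄
  change 2 * (_ + half 𝒞 * L.H₃ μ a b c) = _
  linear_combination -hD - 2 * hM - hC - h₁ + h₂ - e₁ + e₂ + half 𝒞 * (e₃ - e₄)
    + (L.H₃ μ a b c + (∑ ν, L.barCon μ c ν * L.omegaLow ν a b)
      - K.anchor (L.e c) (L.omegaLow μ a b)) * two_mul_half (𝒞 := 𝒞)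

/-! ### Antisymmetry of the twist and of the twisted basic curvature. -/

theorem H₃_swap (μ : Fin n) (a b c : Fin r) : L.H₃ μ a b c = -L.H₃ μ b a c := by
  have h := K.H.map_swap ![L.pd μ, K.anchor (L.e b), K.anchor (L.e a), K.anchor (L.e c)]
    (i := 1) (j := 2) (by decide)
  rw [H₃, H₃, ← h]
  congr 1
  ext i; fin_cases i <;> rfl

theorem H₃_swap' (μ : Fin n) (a b c : Fin r) : L.H₃ μ a b c = -L.H₃ μ a c b := by
  have h := K.H.map_swap ![L.pd μ, K.anchor (L.e a), K.anchor (L.e c), K.anchor (L.e b)]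
    (i := 2) (j := 3) (by decide)
  rw [H₃, H₃, ← h]
  congr 1
  ext i; fin_cases i <;> rfl

theorem H₃_cycle (μ : Fin n) (a b c : Fin r) : L.H₃ μ a b c = L.H₃ μ b c a := by
  rw [L.H₃_swap, L.H₃_swap', neg_neg]

theorem H₂_swap (μ ν : Fin n) (a b : Fin r) : L.H₂ μ ν a b = -L.H₂ μ ν b a := by
  have h := K.H.map_swap ![L.pd μ, L.pd ν, K.anchor (L.e b), K.anchor (L.e a)]
    (i := 2) (j := 3) (by decide)
  rw [H₂, H₂, ← h]
  congr 1
  ext i; fin_cases i <;> rfl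

/-- The definition of the basic curvature treats its third section separately; the symmetry shows
only in the cyclic formula `two_mul_St`. Together with `St_swap` it gives total antisymmetry. -/
theorem St_cycle (μ : Fin n) (a b c : Fin r) : L.St μ a b c = L.St μ b c a := by
  refine eq_of_two_mul_eq ?_
  rw [two_mul_St, two_mul_St, L.Clow_cycle, L.H₃_cycle]; ring

theorem St_swap (μ : Fin n) (a b c : Fin r) : L.St μ a b c = -L.St μ b a c := by
  refine eq_of_two_mul_eq ?_
  rw [mul_neg, two_mul_St, two_mul_St, L.Clow_swap, L.H₃_swap, map_neg,
    L.basicPart_swap μ a b c, L.basicPart_swap μ b c a, L.basicPart_swap μ c a b]; ring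

theorem nablaRho_eq (μ : Fin n) (a : Fin r) (ν : Fin n) : L.nablaRho μ a ν
    = L.pd μ (L.rho a ν) + ∑ σ, L.Gamma ν μ σ * L.rho a σ - ∑ d, L.omega μ a d * L.rho d ν := by
  rw [nablaRho, Target.nablaAnchor, Derivation.sub_apply, nabla_e, map_sum, vec_sum_apply]
  conv_lhs => rw [L.vec_expand (K.anchor (L.e a))]
  simp only [K.conT.sum_sec, K.conT.leibniz, vec_sum_apply, map_smul, Derivation.add_apply,
    Derivation.smul_apply, smul_eq_mul, Finset.sum_add_distrib, L.pd_x, mul_ite, mul_one, mul_zero,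
    Finset.sum_ite_eq', Finset.mem_univ, if_true]
  simp only [Gamma, rho, mul_comm]
  ring

theorem sum_rhoStar_eta (b : Fin r) (μ : Fin n) :
    ∑ a, L.eta b a * L.rhoStar a μ = L.rho b μ := by
  simp only [rhoStar, Finset.mul_sum]
  rw [Finset.sum_comm]
  have h : ∀ c, ∑ a, L.eta b a * (L.etaInv a c * L.rho c μ)
      = (L.eta * L.etaInv) b c * L.rho c μ := fun c => by
    rw [Matrix.mul_apply, Finset.sum_mul]
    exact Finset.sum_congr rfl fun a _ => by ring
  simp only [h, eta_mul_etaInv, Matrix.one_apply, ite_mul, one_mul, zero_mul,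
    Finset.sum_ite_eq, Finset.mem_univ, if_true]

/-- `ω_{μ ba} ρ^{*aν} = ω_{μ b}^d ρ_d^ν`. -/
theorem sum_omegaLow_rhoStar (μ : Fin n) (b : Fin r) (ν : Fin n) :
    ∑ a, L.omegaLow μ b a * L.rhoStar a ν = ∑ d, L.omega μ b d * L.rho d ν := by
  simp only [omegaLow, Finset.sum_mul, ← sum_rhoStar_eta, Finset.mul_sum]
  rw [Finset.sum_comm]
  exact Finset.sum_congr rfl fun a _ => Finset.sum_congr rfl fun c _ => by ring

/-- `ω_{μ ba} C^a_{cd} = ω_{μ b}^e C_{cde}`. -/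
theorem sum_omegaLow_C (μ : Fin n) (b c d : Fin r) :
    ∑ a, L.omegaLow μ b a * L.C c d a = ∑ e, L.omega μ b e * L.Clow c d e := by
  simp only [omegaLow, Clow, Finset.sum_mul, Finset.mul_sum]
  rw [Finset.sum_comm]
  exact Finset.sum_congr rfl fun a _ => Finset.sum_congr rfl fun c _ => by ring

theorem Tup_swap (a b c : Fin r) : L.Tup a b c = -L.Tup b a c := by
  simp only [Tup, ← Finset.sum_neg_distrib]
  exact Finset.sum_congr rfl fun d _ => by rw [L.T_swap]; ring

/-- Metricity trades the second covariant derivative for a derivative of ω with lowered index and a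
product of two ω's. The term with ∇ along the commutator vanishes because coordinate fields commute.
-/
theorem pairing_curv (a b : Fin r) (μ ν : Fin n) : L.R a b μ ν
    = L.pd μ (L.omegaLow ν b a) - L.pd ν (L.omegaLow μ b a)
      + ∑ d, (L.omega ν a d * L.omegaLow μ b d - L.omega μ a d * L.omegaLow ν b d) := by
  have h : ∀ μ ν : Fin n, 2 * K.pairing (K.conE.nabla (L.pd μ) (K.conE.nabla (L.pd ν) (L.e b)))
      (L.e a) = L.pd μ (L.omegaLow ν b a) - ∑ d, L.omega μ a d * L.omegaLow ν b d := by
    intro μ ν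
    have hm := K.metric (L.pd μ) (K.conE.nabla (L.pd ν) (L.e b)) (L.e a)
    have hs : 2 * K.pairing (K.conE.nabla (L.pd ν) (L.e b)) (K.conE.nabla (L.pd μ) (L.e a))
        = ∑ d, L.omega μ a d * L.omegaLow ν b d := by
      rw [L.nabla_e μ a]
      simp only [map_sum, map_smul, smul_eq_mul, Finset.mul_sum, omegaLow_eq]
      exact Finset.sum_congr rfl fun d _ => by ring
    rw [omegaLow_eq, vec_two_mul]
    linear_combination -2 * hm - hs
  rw [R, K.pairing_symm, Target.curv, lie_pd]
  have h0 : K.conE.nabla 0 (L.e b) = 0 := map_zero (K.conE.inVec (L.e b))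
  rw [h0, sub_zero, map_sub, LinearMap.sub_apply, mul_sub, h, h, Finset.sum_sub_distrib]
  ring

end LocalFrame

end Geometry

/-! ## The homological vector field in covariant form -/

namespace LocalFrame

variable {𝒞 : Type*} [CommRing 𝒞] [Algebra ℝ 𝒞] {𝓔 : Type*} [AddCommGroup 𝓔] [Module 𝒞 𝓔]
  {K : Target 𝒞 𝓔} {n r : ℕ} (L : LocalFrame K n r)

/-! ### Raised indices and contractions with monomials. -/

theorem sum_omegaLow_etaInv (μ : Fin n) (a c : Fin r) :
    ∑ d, L.omegaLow μ a d * L.etaInv d c = L.omega μ a c := by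
  simp only [omegaLow, Finset.sum_mul]
  rw [Finset.sum_comm]
  have h : ∀ b, ∑ d, L.omega μ a b * L.eta b d * L.etaInv d c
      = L.omega μ a b * (L.eta * L.etaInv) b c := fun b => by
    rw [Matrix.mul_apply, Finset.mul_sum]
    exact Finset.sum_congr rfl fun d _ => by ring
  simp only [h, eta_mul_etaInv, Matrix.one_apply, mul_ite, mul_one, mul_zero,
    Finset.sum_ite_eq', Finset.mem_univ, if_true]

theorem sum_Clow_etaInv (a b c : Fin r) : ∑ d, L.Clow a b d * L.etaInv d c = L.C a b c := by
  rw [C, repr_eq_sum_etaInv]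
  exact Finset.sum_congr rfl fun d _ => by rw [Clow_eq, L.etaInv_symm d c, mul_comm]

theorem two_mul_Tup (a b c : Fin r) : 2 * L.Tup a b c
    = ∑ μ, L.rho a μ * L.omega μ b c - ∑ μ, L.rho b μ * L.omega μ a c
      + ∑ μ, L.rhoStar c μ * L.omegaLow μ a b - L.C a b c := by
  have h : ∀ a b, ∑ d, L.rhoOmega a b d * L.etaInv d c = ∑ μ, L.rho a μ * L.omega μ b c := by
    intro a b
    simp only [rhoOmega, Finset.sum_mul, ← L.sum_omegaLow_etaInv, Finset.mul_sum]
    rw [Finset.sum_comm]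
    exact Finset.sum_congr rfl fun d _ => Finset.sum_congr rfl fun μ _ => by ring
  have h' : ∑ d, L.rhoOmega d a b * L.etaInv d c = ∑ μ, L.rhoStar c μ * L.omegaLow μ a b := by
    simp only [rhoOmega, rhoStar, Finset.sum_mul]
    rw [Finset.sum_comm]
    exact Finset.sum_congr rfl fun d _ => Finset.sum_congr rfl fun μ _ => by
      rw [L.etaInv_symm]; ring
  rw [← h, ← h, ← h', ← L.sum_Clow_etaInv, Tup, Finset.mul_sum, ← Finset.sum_sub_distrib,
    ← Finset.sum_add_distrib, ← Finset.sum_sub_distrib]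
  refine Finset.sum_congr rfl fun d _ => ?_
  rw [← mul_assoc, two_mul_T, L.rhoOmega_swap b d a]
  ring

/-- Contraction of the twisted basic curvature with cyclic monomials. -/
theorem two_smul_sum_St {G : Type*} {deg : G → ℤ × ℤ} (μ : Fin n)
    (m : Fin r → Fin r → Fin r → GAlg 𝒞 deg) (hm : ∀ a b c, m a b c = m b c a) :
    (2 : ℝ) • ∑ a, ∑ b, ∑ c, L.St μ a b c • m a b c
      = ∑ a, ∑ b, ∑ c, (L.pd μ (L.Clow a b c) + L.H₃ μ a b c) • m a b c
        + (3 : ℝ) • ∑ a, ∑ b, ∑ c, L.basicPart μ a b c • m a b c := by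
  have h₁ : ∑ a, ∑ b, ∑ c, L.basicPart μ b c a • m a b c
      = ∑ a, ∑ b, ∑ c, L.basicPart μ a b c • m a b c := by
    rw [← sum_cycle (fun a b c => L.basicPart μ a b c • m a b c)]
    simp only [← hm]
  have h₂ : ∑ a, ∑ b, ∑ c, L.basicPart μ c a b • m a b c
      = ∑ a, ∑ b, ∑ c, L.basicPart μ a b c • m a b c := by
    rw [← sum_cycle (fun a b c => L.basicPart μ c a b • m a b c)]
    simp only [← hm]
  have h : (2 : ℝ) • ∑ a, ∑ b, ∑ c, L.St μ a b c • m a b c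
      = ∑ a, ∑ b, ∑ c, (L.pd μ (L.Clow a b c) + L.H₃ μ a b c) • m a b c
        + ∑ a, ∑ b, ∑ c, L.basicPart μ a b c • m a b c
        + ∑ a, ∑ b, ∑ c, L.basicPart μ b c a • m a b c
        + ∑ a, ∑ b, ∑ c, L.basicPart μ c a b • m a b c := by
    simp only [Finset.smul_sum, ← two_mul_fsmul, two_mul_St, add_smul, Finset.sum_add_distrib]
  rw [h, h₁, h₂]
  module

/-! ### Values of the derivations -/

theorem QH_fn (f : 𝒞) : L.QH (fn f) = ∑ μ, L.pd μ f • ∑ a, L.rho a μ • L.ca a :=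
  DerData.der_fn _ f

theorem QH_ca (a : Fin r) : L.QH (L.ca a) = -(∑ μ, L.rhoStar a μ • L.cb μ
    + (1 / 2 : ℝ) • ∑ b, ∑ c, L.C b c a • (L.ca b * L.ca c)) := DerData.der_gen _ _

theorem QH_cb (μ : Fin n) : L.QH (L.cb μ) = -(∑ a, ∑ ν, L.pd μ (L.rho a ν) • (L.cb ν * L.ca a)
      + (1 / 6 : ℝ) • ∑ a, ∑ b, ∑ c, L.pd μ (L.Clow a b c) • (L.ca a * L.ca b * L.ca c))
    - (1 / 6 : ℝ) • ∑ a, ∑ b, ∑ c, L.H₃ μ a b c • (L.ca a * L.ca b * L.ca c) :=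
  DerData.der_gen _ _

theorem QH_mul (z w) : L.QH (z * w) = L.QH z * w + signAut (1, 0) z * L.QH w :=
  DerData.der_mul _ z w

theorem QH_fsmul (f : 𝒞) (z) : L.QH (f • z) = L.QH (fn f) * z + f • L.QH z := by
  rw [fsmul_def, QH_mul, signAut_fn, ← fsmul_def]

theorem D1_fn (i : Fin r) (f : 𝒞) : L.D1 i (fn f) = 0 :=
  (DerData.der_fn _ f).trans (Finset.sum_eq_zero fun _ _ => smul_zero _)

theorem D1_ca (i j : Fin r) : L.D1 i (L.ca j) = if i = j then 1 else 0 := DerData.der_gen _ _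

theorem D1_cb (i : Fin r) (μ : Fin n) : L.D1 i (L.cb μ) = ∑ b, L.omegaLow μ b i • L.ca b :=
  DerData.der_gen _ _

theorem D1_mul (i : Fin r) (z w) :
    L.D1 i (z * w) = L.D1 i z * w + signAut (-1, 0) z * L.D1 i w := DerData.der_mul _ z w

theorem D1_fsmul (i : Fin r) (f : 𝒞) (z) : L.D1 i (f • z) = f • L.D1 i z := by
  rw [fsmul_def, D1_mul, D1_fn, zero_mul, zero_add, signAut_fn, fsmul_def]

theorem D2_fn (μ : Fin n) (f : 𝒞) : L.D2 μ (fn f) = 0 :=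
  (DerData.der_fn _ f).trans (Finset.sum_eq_zero fun _ _ => smul_zero _)

theorem D2_ca (μ : Fin n) (j : Fin r) : L.D2 μ (L.ca j) = 0 := DerData.der_gen _ _

theorem D2_cb (μ ν : Fin n) : L.D2 μ (L.cb ν) = if μ = ν then 1 else 0 := DerData.der_gen _ _

theorem D2_mul (μ : Fin n) (z w) :
    L.D2 μ (z * w) = L.D2 μ z * w + signAut (-2, 0) z * L.D2 μ w := DerData.der_mul _ z w

theorem D2_fsmul (μ : Fin n) (f : 𝒞) (z) : L.D2 μ (f • z) = f • L.D2 μ z := by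
  rw [fsmul_def, D2_mul, D2_fn, zero_mul, zero_add, signAut_fn, fsmul_def]

theorem D0_fn (μ : Fin n) (f : 𝒞) : L.D0 μ (fn f) = fn (L.pd μ f) := by
  refine (DerData.der_fn _ f).trans ?_
  simp only [DerData.onFn, smul_ite, smul_zero, Finset.sum_ite_eq, Finset.mem_univ, if_true,
    fn_eq_smul]

theorem D0_ca (μ : Fin n) (c : Fin r) : L.D0 μ (L.ca c) = -∑ b, L.omega μ b c • L.ca b :=
  DerData.der_gen _ _

theorem D0_cb (μ ν : Fin n) : L.D0 μ (L.cb ν)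
    = -((1 / 2 : ℝ) • ∑ b, ∑ c, L.pd μ (L.omegaLow ν b c) • (L.ca b * L.ca c))
      + ∑ σ, L.Gamma σ ν μ • L.cbNabla σ
      - ∑ b, ∑ c, ∑ d, (L.omega μ b c * L.omegaLow ν d c) • (L.ca b * L.ca d) :=
  DerData.der_gen _ _

theorem D0_mul (μ : Fin n) (z w) :
    L.D0 μ (z * w) = L.D0 μ z * w + signAut (0, 0) z * L.D0 μ w := DerData.der_mul _ z w

theorem signAut_zero {G : Type*} {deg : G → ℤ × ℤ} (z : GAlg 𝒞 deg) :
    signAut (0, 0) z = z := by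
  induction z using gAlg_induction with
  | hf f => simp
  | hg x => simp [pair, sgn]
  | hadd z w hz hw => rw [map_add, hz, hw]
  | hmul z w hz hw => rw [map_mul, hz, hw]

theorem D0_fsmul (μ : Fin n) (f : 𝒞) (z) : L.D0 μ (f • z) = L.pd μ f • z + f • L.D0 μ z := by
  rw [fsmul_def, D0_mul, D0_fn, signAut_fn, ← fsmul_def, ← fsmul_def]

theorem ca_swap (a b : Fin r) : L.ca a * L.ca b = -(L.ca b * L.ca a) :=
  (L.ca_sign a).anticomm (L.ca_sign b) (by decide)

theorem ca_even {z : TAlg 𝒞 n r} (hz : HasSign z (2, 0)) (a : Fin r) :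
    L.ca a * z = z * L.ca a := (L.ca_sign a).comm hz (by decide)

/-- The ω-term in D_a is the one that cancels the derivative of the quadratic part of b^∇: the two
halves of that derivative add up by antisymmetry of ω. -/
theorem D1_cbNabla (i : Fin r) (μ : Fin n) : L.D1 i (L.cbNabla μ) = 0 := by
  have h : ∀ j, signAut (-1, 0) (L.ca j) = -L.ca j := fun j =>
    (L.ca_sign j).signAut_odd (by decide)
  have h₁ : ∀ a, ∑ b, L.omegaLow μ a b • (L.D1 i (L.ca a) * L.ca b)
      = if i = a then ∑ b, L.omegaLow μ a b • L.ca b else 0 := fun a => by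
    rw [D1_ca]; split_ifs <;> simp
  have h₂ : ∀ a, ∑ b, L.omegaLow μ a b • (L.ca a * L.D1 i (L.ca b))
      = L.omegaLow μ a i • L.ca a := fun a => by
    simp only [D1_ca, mul_ite, mul_one, mul_zero, smul_ite, smul_zero, Finset.sum_ite_eq,
      Finset.mem_univ, if_true]
  rw [cbNabla, map_add, D1_cb, map_smul]
  simp only [map_sum, D1_fsmul, D1_mul, h, smul_add, Finset.sum_add_distrib, neg_mul, smul_neg,
    Finset.sum_neg_distrib, h₁, h₂, Finset.sum_ite_eq, Finset.mem_univ, if_true]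
  have h₃ : ∑ b, L.omegaLow μ i b • L.ca b = -∑ b, L.omegaLow μ b i • L.ca b := by
    rw [← Finset.sum_neg_distrib]
    exact Finset.sum_congr rfl fun b _ => by rw [L.omegaLow_swap μ i b, neg_smul]
  rw [h₃]
  module

theorem D2_cbNabla (μ ν : Fin n) : L.D2 μ (L.cbNabla ν) = if μ = ν then 1 else 0 := by
  rw [cbNabla, map_add, D2_cb, map_smul]
  simp only [map_sum, D2_fsmul, D2_mul, D2_ca, zero_mul, mul_zero, add_zero, smul_zero,
    Finset.sum_const_zero]

/-- The derivative of ω in D_μ b_ν cancels against the derivative of the coefficient in ½ωaa, and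
the term quadratic in ω cancels against the rotation of the two factors a. Only the Christoffel term
survives. -/
theorem D0_cbNabla (μ ν : Fin n) :
    L.D0 μ (L.cbNabla ν) = ∑ σ, L.Gamma σ ν μ • L.cbNabla σ := by
  -- Rotating either factor of aa gives the same sum (`h₂` below), so the prefactor ½ disappears and
  -- the ωω-term of `D0_cb` is cancelled exactly.
  have h₁ : ∑ a, ∑ b, L.omegaLow ν a b • (L.ca a * L.D0 μ (L.ca b))
      = ∑ b, ∑ c, ∑ d, (L.omega μ b c * L.omegaLow ν d c) • (L.ca b * L.ca d) := by
    simp only [D0_ca, mul_neg, Finset.mul_sum, Finset.smul_sum, mul_smul_comm,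
      ← Finset.sum_neg_distrib]
    rw [← sum_reverse]
    refine Finset.sum_congr rfl fun a _ => Finset.sum_congr rfl fun b _ =>
      Finset.sum_congr rfl fun c _ => ?_
    rw [L.ca_swap a c]
    simp only [smul_neg]
    rw [smul_smul, mul_comm]
  have h₂ : ∑ a, ∑ b, L.omegaLow ν a b • (L.D0 μ (L.ca a) * L.ca b)
      = ∑ a, ∑ b, L.omegaLow ν a b • (L.ca a * L.D0 μ (L.ca b)) := by
    have h : ∀ a b, L.D0 μ (L.ca a) * L.ca b = -(L.ca b * L.D0 μ (L.ca a)) := fun a b => by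
      rw [D0_ca, neg_mul, mul_neg, neg_neg, Finset.sum_mul, Finset.mul_sum,
        ← Finset.sum_neg_distrib]
      exact Finset.sum_congr rfl fun c _ => by rw [smul_mul_assoc, mul_smul_comm, ca_swap, smul_neg,
        neg_neg]
    simp only [h, smul_neg, Finset.sum_neg_distrib]
    rw [sum_antisymm (L.omegaLow_swap ν) fun a b => L.ca a * L.D0 μ (L.ca b), neg_neg]
  rw [cbNabla, map_add, D0_cb, map_smul]
  simp only [map_sum, D0_fsmul, D0_mul, signAut_zero, smul_add, Finset.sum_add_distrib, h₁, h₂]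
  module


/-! ### The decomposition of the homological vector field -/

theorem QNabla_sign : ∀ α : Idx n r, HasSign (L.QNabla α) (α.deg + 1, 0)
  | .x _ => HasSign.sum fun a => (L.ca_sign a).fsmul _
  | .a _ => ((HasSign.sum fun μ => (L.cbNabla_sign μ).fsmul _).neg).add
      (HasSign.sum fun b => HasSign.sum fun c => (L.caca_sign b c).fsmul _)
  | .b _ => (HasSign.neg (HasSign.sum fun a => HasSign.sum fun ν =>
      ((L.cbNabla_sign ν).mul (L.ca_sign a) rfl).fsmul _)).sub
      (HasSign.smul _ (HasSign.sum fun a => HasSign.sum fun b => HasSign.sum fun c =>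
        ((L.caca_sign a b).mul (L.ca_sign c) rfl).fsmul _))

theorem D_mul (α : Idx n r) (z w) :
    L.D α (z * w) = L.D α z * w + signAut (-α.deg, 0) z * L.D α w := by
  cases α with
  | x μ => exact L.D0_mul μ z w
  | a i => exact L.D1_mul i z w
  | b μ => exact L.D2_mul μ z w

theorem sumIdx_add {W : Type*} [AddCommMonoid W] (f g : Idx n r → W) :
    sumIdx (fun α => f α + g α) = sumIdx f + sumIdx g := by
  simp only [sumIdx, Finset.sum_add_distrib]
  abel

theorem sumIdx_mul {W : Type*} [Ring W] (f : Idx n r → W) (w : W) :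
    sumIdx f * w = sumIdx fun α => f α * w := by
  simp only [sumIdx, add_mul, Finset.sum_mul]

theorem mul_sumIdx {W : Type*} [Ring W] (f : Idx n r → W) (w : W) :
    w * sumIdx f = sumIdx fun α => w * f α := by
  simp only [sumIdx, mul_add, Finset.mul_sum]

/-- The vector field `Q_∇^α D_α`. -/
def QD (z : TAlg 𝒞 n r) : TAlg 𝒞 n r := sumIdx fun α => L.QNabla α * L.D α z

theorem QD_add (z w) : L.QD (z + w) = L.QD z + L.QD w := by
  simp only [QD, map_add, mul_add, sumIdx_add]

theorem QD_smul (c : ℝ) (z) : L.QD (c • z) = c • L.QD z := by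
  simp only [QD, map_smul, mul_smul_comm, sumIdx, Finset.smul_sum, smul_add]

theorem QD_sum {ι : Type*} (s : Finset ι) (z : ι → TAlg 𝒞 n r) :
    L.QD (∑ i ∈ s, z i) = ∑ i ∈ s, L.QD (z i) :=
  map_sum (AddMonoidHom.mk' L.QD L.QD_add) z s

/-- Moving Q_∇^α, of degree |α|+1, past an element already twisted by D_α, of degree -|α|, leaves
the sign of a derivation of degree 1, the same for every α. -/
theorem QD_mul (z w) : L.QD (z * w) = L.QD z * w + signAut (1, 0) z * L.QD w := by
  rw [QD, QD, QD, sumIdx_mul, mul_sumIdx, ← sumIdx_add]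
  congr 1
  funext α
  rw [D_mul, mul_add, ← mul_assoc, ← mul_assoc, (L.QNabla_sign α).mul_eq_signAut_mul
    (signAut _ z), signAut_signAut, mul_assoc (signAut _ z)]
  congr 3
  simp

theorem QD_fn (f : 𝒞) : L.QD (fn f) = L.QH (fn f) := by
  simp only [QD, sumIdx, D, D0_fn, D1_fn, D2_fn, mul_zero, Finset.sum_const_zero, add_zero, QH_fn,
    QNabla]
  exact Finset.sum_congr rfl fun μ _ => by rw [← fn_mul_comm, fsmul_def]

/-- Contraction with an antisymmetric monomial identifies the two ρω-terms of the torsion. -/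
theorem two_smul_sum_Tup {G : Type*} {deg : G → ℤ × ℤ} (c : Fin r)
    (m : Fin r → Fin r → GAlg 𝒞 deg) (hm : ∀ a b, m a b = -m b a) :
    (2 : ℝ) • ∑ a, ∑ b, L.Tup a b c • m a b
      = (2 : ℝ) • ∑ a, ∑ b, (∑ μ, L.rho a μ * L.omega μ b c) • m a b
        + ∑ a, ∑ b, (∑ μ, L.rhoStar c μ * L.omegaLow μ a b) • m a b
        - ∑ a, ∑ b, L.C a b c • m a b := by
  have h : ∑ a, ∑ b, (∑ μ, L.rho b μ * L.omega μ a c) • m a b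
      = -∑ a, ∑ b, (∑ μ, L.rho a μ * L.omega μ b c) • m a b := by
    rw [Finset.sum_comm, ← Finset.sum_neg_distrib]
    refine Finset.sum_congr rfl fun a _ => ?_
    rw [← Finset.sum_neg_distrib]
    exact Finset.sum_congr rfl fun b _ => by rw [hm b a, smul_neg]
  simp only [Finset.smul_sum, ← two_mul_fsmul, two_mul_Tup, sub_smul, add_smul,
    Finset.sum_add_distrib, Finset.sum_sub_distrib, h]
  simp only [two_mul_fsmul, ← Finset.smul_sum]
  module

theorem sum_rhoStar_cbNabla (c : Fin r) : ∑ μ, L.rhoStar c μ • L.cbNabla μ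
    = ∑ μ, L.rhoStar c μ • L.cb μ + (1 / 2 : ℝ) •
      ∑ a, ∑ b, (∑ μ, L.rhoStar c μ * L.omegaLow μ a b) • (L.ca a * L.ca b) := by
  simp only [cbNabla, smul_add, Finset.sum_add_distrib, add_right_inj]
  simp only [smul_comm _ (1 / 2 : ℝ), ← Finset.smul_sum, Finset.sum_smul]
  congr 1
  simp only [Finset.smul_sum, smul_smul]
  rw [Finset.sum_comm]
  exact Finset.sum_congr rfl fun a _ => Finset.sum_comm

/-- The rotation of a by ω in D_μ cancels the ρω-terms of the torsion, the quadratic part of b^∇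
cancels its ρ*ω-term, and only the structure functions remain. -/
theorem QD_ca (c : Fin r) : L.QD (L.ca c) = L.QH (L.ca c) := by
  have h₀ : ∑ μ, L.QNabla (.x μ) * L.D0 μ (L.ca c)
      = -∑ a, ∑ b, (∑ μ, L.rho a μ * L.omega μ b c) • (L.ca a * L.ca b) := by
    simp only [D0_ca, QNabla, mul_neg, Finset.sum_neg_distrib, Finset.sum_mul, Finset.mul_sum,
      Finset.sum_smul, smul_mul_smul_comm]
    exact congrArg Neg.neg
      (sum_reverse fun a b μ => (L.rho a μ * L.omega μ b c) • (L.ca a * L.ca b))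
  have h₁ : ∑ i, L.QNabla (.a i) * L.D1 i (L.ca c) = L.QNabla (.a c) := by
    simp only [D1_ca, mul_ite, mul_one, mul_zero, Finset.sum_ite_eq', Finset.mem_univ, if_true]
  have h₂ := L.two_smul_sum_Tup c (fun a b => L.ca a * L.ca b) L.ca_swap
  have h₃ := L.sum_rhoStar_cbNabla c
  rw [QD, sumIdx]
  simp only [D, D2_ca, mul_zero, Finset.sum_const_zero, add_zero, h₀, h₁]
  rw [QNabla, QH_ca]
  linear_combination (norm := module) (1 / 2 : ℝ) • h₂ - h₃

end LocalFrame

namespace LocalFrame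

variable {𝒞 : Type*} [CommRing 𝒞] [Algebra ℝ 𝒞] {𝓔 : Type*} [AddCommGroup 𝓔] [Module 𝒞 𝓔]
  {K : Target 𝒞 𝓔} {n r : ℕ} (L : LocalFrame K n r)

theorem QD_cbNabla (μ : Fin n) : L.QD (L.cbNabla μ)
    = ∑ a, ∑ ν, (∑ σ, L.Gamma ν μ σ * L.rho a σ) • (L.cbNabla ν * L.ca a)
      + L.QNabla (.b μ) := by
  rw [QD, sumIdx]
  simp only [D, D0_cbNabla, D1_cbNabla, D2_cbNabla, mul_zero, Finset.sum_const_zero, add_zero,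
    mul_ite, mul_one, Finset.sum_ite_eq', Finset.mem_univ, if_true, add_left_inj, QNabla]
  simp only [Finset.sum_mul, Finset.mul_sum, Finset.sum_smul, smul_mul_smul_comm,
    L.ca_even (L.cbNabla_sign _)]
  rw [sum_reverse fun a ν σ => (L.rho a σ * L.Gamma ν μ σ) • (L.cbNabla ν * L.ca a)]
  simp only [mul_comm]

/-- `Q^H b^∇_μ` before splitting off the covariant coordinates. -/
theorem QH_cbNabla_eq (μ : Fin n) : L.QH (L.cbNabla μ) = L.QH (L.cb μ)
    + (1 / 2 : ℝ) • ∑ a, ∑ b, ∑ c,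
        K.anchor (L.e a) (L.omegaLow μ b c) • (L.ca a * L.ca b * L.ca c)
    + ∑ a, ∑ b, L.omegaLow μ a b • (L.QH (L.ca a) * L.ca b) := by
  have hsign : ∀ a, HasSign (L.QH (L.ca a)) (2, 0) := fun a => by
    rw [QH_ca]
    exact ((HasSign.sum fun μ => (L.cb_sign μ).fsmul _).add (HasSign.smul _
      (HasSign.sum fun b => HasSign.sum fun c => (L.caca_sign b c).fsmul _))).neg
  have hs : ∀ a b, signAut (1, 0) (L.ca a) * L.QH (L.ca b) = -(L.QH (L.ca b) * L.ca a) :=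
    fun a b => by
      rw [(L.ca_sign a).signAut_odd (by decide), neg_mul, L.ca_even (hsign b)]
  have h₁ : ∑ a, ∑ b, L.QH (fn (L.omegaLow μ a b)) * (L.ca a * L.ca b)
      = ∑ a, ∑ b, ∑ c,
        K.anchor (L.e a) (L.omegaLow μ b c) • (L.ca a * L.ca b * L.ca c) := by
    -- Two cyclic shifts make the index on the anchor the innermost summation index.
    rw [← sum_cycle, ← sum_cycle]
    refine Finset.sum_congr rfl fun a _ => Finset.sum_congr rfl fun b _ => ?_
    rw [QH_fn, Finset.sum_mul]
    simp only [L.expand (K.anchor _) (L.omegaLow μ a b), Finset.sum_smul]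
    rw [Finset.sum_comm]
    refine Finset.sum_congr rfl fun ν _ => ?_
    rw [smul_mul_assoc, Finset.sum_mul, Finset.smul_sum]
    exact Finset.sum_congr rfl fun c _ => by
      rw [smul_mul_assoc, smul_smul, mul_comm (L.pd ν _), mul_assoc]; rfl
  have h₂ := sum_antisymm (L.omegaLow_swap μ) (fun a b => L.QH (L.ca a) * L.ca b)
  conv_lhs => rw [cbNabla]
  rw [map_add, map_smul]
  simp only [map_sum, QH_fsmul, QH_mul, hs, smul_add, smul_neg, Finset.sum_add_distrib,
    Finset.sum_neg_distrib, h₁, h₂]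
  module

theorem caca_cycle (a b c : Fin r) :
    L.ca a * L.ca b * L.ca c = L.ca b * L.ca c * L.ca a := by
  rw [mul_assoc, L.ca_even (L.caca_sign b c)]

/-- Lowering the index of ω and raising that of ρ* or C cancel, which puts both pieces of Q^H a into
the form occurring in `barCon` and `basicPart`. -/
theorem sum_omegaLow_QH_ca (μ : Fin n) :
    ∑ a, ∑ b, L.omegaLow μ a b • (L.QH (L.ca a) * L.ca b)
      = ∑ a, ∑ ν, (∑ d, L.omega μ a d * L.rho d ν) • (L.cb ν * L.ca a)
        + (1 / 2 : ℝ) • ∑ a, ∑ b, ∑ c,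
          (∑ d, L.omega μ a d * L.Clow b c d) • (L.ca a * L.ca b * L.ca c) := by
  have h : ∀ a b, L.omegaLow μ b a • (L.QH (L.ca b) * L.ca a)
      = ∑ ν, (L.omegaLow μ a b * L.rhoStar b ν) • (L.cb ν * L.ca a)
        + (1 / 2 : ℝ) • ∑ c, ∑ d,
          (L.omegaLow μ a b * L.C c d b) • (L.ca a * L.ca c * L.ca d) := by
    intro a b
    rw [L.omegaLow_swap, QH_ca, neg_mul, smul_neg, neg_smul, neg_neg, add_mul, smul_add,
      smul_mul_assoc, smul_comm _ (1 / 2 : ℝ)]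
    simp only [Finset.sum_mul, Finset.smul_sum, smul_mul_assoc, smul_smul]
    simp only [← L.caca_cycle a]
  rw [Finset.sum_comm]
  simp only [h, Finset.sum_add_distrib, ← Finset.smul_sum, ← sum_omegaLow_rhoStar,
    ← sum_omegaLow_C, Finset.sum_smul]
  congr 1
  · exact Finset.sum_congr rfl fun a _ => Finset.sum_comm
  · congr 1
    refine Finset.sum_congr rfl fun a _ => ?_
    rw [Finset.sum_comm]
    exact Finset.sum_congr rfl fun b _ => Finset.sum_comm

/-- Rewriting b through b^∇ produces the cubic term that completes `basicPart`. -/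
theorem sum_barCon_cb (μ : Fin n) : ∑ a, ∑ ν, L.barCon μ a ν • (L.cb ν * L.ca a)
    = ∑ a, ∑ ν, L.barCon μ a ν • (L.cbNabla ν * L.ca a) - (1 / 2 : ℝ) • ∑ a, ∑ b, ∑ c,
      (∑ ν, L.barCon μ a ν * L.omegaLow ν b c) • (L.ca a * L.ca b * L.ca c) := by
  rw [eq_sub_iff_add_eq]
  simp only [cbNabla, add_mul, smul_add, Finset.sum_add_distrib, add_right_inj]
  simp only [smul_mul_assoc, smul_comm _ (1 / 2 : ℝ), ← Finset.smul_sum, Finset.sum_smul]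
  congr 1
  refine Finset.sum_congr rfl fun a _ => ?_
  simp only [Finset.sum_mul, Finset.smul_sum, smul_mul_assoc, smul_smul,
    ← L.caca_cycle a]
  exact (sum_cycle fun b c ν =>
    (L.barCon μ a ν * L.omegaLow ν b c) • (L.ca a * L.ca b * L.ca c)).symm

/-- The terms linear in b have coefficient ωρ - ∂ρ, which is `barCon`; it equals Γρ minus the
covariant derivative of the anchor. Once b is replaced by b^∇, the cubic terms are those of the
twisted basic curvature. -/
theorem QH_cbNabla (μ : Fin n) : L.QH (L.cbNabla μ)
    = ∑ a, ∑ ν, (∑ σ, L.Gamma ν μ σ * L.rho a σ) • (L.cbNabla ν * L.ca a)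
      + L.QNabla (.b μ) := by
  have h₁ := L.sum_omegaLow_QH_ca μ
  have h₂ := L.sum_barCon_cb μ
  have h₃ := L.two_smul_sum_St μ (fun a b c => L.ca a * L.ca b * L.ca c) L.caca_cycle
  rw [QH_cbNabla_eq, QH_cb, QNabla, h₁]
  simp only [nablaRho_eq, barCon, basicPart, sub_smul, add_smul, Finset.sum_add_distrib,
    Finset.sum_sub_distrib] at h₂ h₃ ⊢
  linear_combination (norm := module) h₂ + (1 / 6 : ℝ) • h₃

/-- Agreement on b^∇ passes to b, since the two differ by an expression in functions and a, on which
the derivations already agree. -/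
theorem QD_cb (μ : Fin n) : L.QD (L.cb μ) = L.QH (L.cb μ) := by
  have h : L.QD (L.cbNabla μ) = L.QH (L.cbNabla μ) := by rw [QD_cbNabla, QH_cbNabla]
  rw [cbNabla, QD_add, map_add, QD_smul, map_smul, QD_sum, map_sum] at h
  refine add_right_cancel (h.trans ?_)
  congr 2
  refine Finset.sum_congr rfl fun a _ => ?_
  rw [QD_sum, map_sum]
  refine Finset.sum_congr rfl fun b _ => ?_
  rw [fsmul_def, QD_mul, QD_mul, QH_mul, QH_mul, QD_fn, QD_ca, QD_ca]

/-- The covariant form of the homological vector field. -/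
theorem QH_eq_QD (z : TAlg 𝒞 n r) : L.QH z = L.QD z := by
  refine der_ext (fun _ => rfl) (map_add L.QH) L.QD_add L.QH_mul L.QD_mul
    (fun f => (L.QD_fn f).symm) ?_ z
  rintro (a | μ)
  · exact (L.QD_ca a).symm
  · exact (L.QD_cb μ).symm

end LocalFrame

/-! ## Covariant BRST transformations -/

namespace LocalFrame

variable {𝒞 : Type*} [CommRing 𝒞] [Algebra ℝ 𝒞] {𝓔 : Type*} [AddCommGroup 𝓔] [Module 𝒞 𝓔]
  {K : Target 𝒞 𝓔} {n r : ℕ} (L : LocalFrame K n r)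

theorem C_swap (a b c : Fin r) : L.C a b c = -L.C b a c := by
  rw [C, C, K.courant_swap, map_neg, Finsupp.neg_apply]

/-- The symmetrized derivative together with the antisymmetrized square in κ is the plain derivative
∂_ν ω_μ minus half the curvature. This is how κ can absorb the non-covariant part of the defect and
leave R. -/
theorem kappa_eq (μ ν : Fin n) (a b : Fin r) :
    L.kappa μ ν a b = L.pd ν (L.omegaLow μ a b) - half 𝒞 * L.R a b μ ν := by
  have h₁ := congrArg (L.pd μ) (L.omegaLow_swap ν b a)
  have h₂ := congrArg (L.pd ν) (L.omegaLow_swap μ b a)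
  rw [map_neg] at h₁ h₂
  rw [kappa, pairing_curv, h₁, h₂, Finset.sum_sub_distrib, Finset.sum_sub_distrib]
  linear_combination L.pd ν (L.omegaLow μ a b) * two_mul_half (𝒞 := 𝒞)

theorem R_swap (a b : Fin r) (μ ν : Fin n) : L.R a b μ ν = -L.R b a μ ν := by
  have h : ∀ μ ν : Fin n, ∑ d, L.omega μ a d * L.omegaLow ν b d
      = ∑ d, L.omega ν b d * L.omegaLow μ a d := fun μ ν => by
    simp only [omegaLow, Finset.mul_sum]
    rw [Finset.sum_comm]
    exact Finset.sum_congr rfl fun c _ => Finset.sum_congr rfl fun d _ => by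
      rw [L.eta_symm]; ring
  rw [pairing_curv, pairing_curv, Finset.sum_sub_distrib, Finset.sum_sub_distrib, h, h,
    L.omegaLow_swap ν b a, L.omegaLow_swap μ b a, map_neg, map_neg]
  ring

/-! ### Values of the differential and of the BRST operator -/

theorem d_fn (f : 𝒞) : L.d (fn f) = ∑ μ, L.pd μ f • L.dX μ := DerData.der_fn _ f

theorem d_gen (x : FGen n r) : L.d (gen x) = dGen x := DerData.der_gen _ x

theorem d_mul (z w) : L.d (z * w) = L.d z * w + signAut (1, 0) z * L.d w :=
  DerData.der_mul _ z w

theorem s₀_fn (f : 𝒞) : L.s₀ (fn f) = ∑ μ, L.pd μ f • L.sX μ := DerData.der_fn _ f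

theorem s₀_gen (x : FGen n r) : L.s₀ (gen x) = L.sGen x := DerData.der_gen _ x

theorem s₀_mul (z w) : L.s₀ (z * w) = L.s₀ z * w + signAut (0, 1) z * L.s₀ w :=
  DerData.der_mul _ z w

theorem s₀_x (μ : Fin n) : L.s₀ (fn (L.x μ)) = L.sX μ := by
  rw [s₀_fn]
  simp only [pd_x, ite_smul, one_smul, zero_smul, Finset.sum_ite_eq', Finset.mem_univ, if_true]

theorem s₀_A (a : Fin r) : L.s₀ (L.A a) = L.sA a := L.s₀_gen _
theorem s₀_B (μ : Fin n) : L.s₀ (L.B μ) = L.sB μ := L.s₀_gen _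
theorem s₀_eps (a : Fin r) : L.s₀ (L.eps a) = L.sEps a := L.s₀_gen _
theorem s₀_psi (μ : Fin n) : L.s₀ (L.psi μ) = L.sPsi μ := L.s₀_gen _
theorem s₀_tpsi (μ : Fin n) : L.s₀ (L.tpsi μ) = L.sTpsi μ := L.s₀_gen _

/-! ### Ghosts for ghosts: substitution into the homological vector field -/

/-- The substitution `a^a ↦ ε^a`, `b_μ ↦ ψ̃_μ`. -/
def ghostPull (_ : LocalFrame K n r) : TAlg 𝒞 n r →ₐ[ℝ] FAlg 𝒞 n r :=
  lift fn
    (fun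
      | .a a => gen (.eps a)
      | .b μ => gen (.tpsi μ))
    (by
      rintro f (a | μ)
      · exact fn_central f (FGen.eps a)
      · exact fn_central f (FGen.tpsi μ))
    (by
      rintro (a | μ) (b | ν)
      · exact gen_swap (FGen.eps a) (FGen.eps b)
      · exact gen_swap (FGen.eps a) (FGen.tpsi ν)
      · exact gen_swap (FGen.tpsi μ) (FGen.eps b)
      · exact gen_swap (FGen.tpsi μ) (FGen.tpsi ν))

theorem ghostPull_fn (f : 𝒞) : L.ghostPull (fn f) = fn f := lift_fn ..
theorem ghostPull_ca (a : Fin r) : L.ghostPull (L.ca a) = L.eps a := lift_gen ..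
theorem ghostPull_cb (μ : Fin n) : L.ghostPull (L.cb μ) = L.tpsi μ := lift_gen ..

theorem ghostPull_fsmul (f : 𝒞) (z) : L.ghostPull (f • z) = f • L.ghostPull z :=
  map_fsmul L.ghostPull_fn f z

theorem ghostPull_cbNabla (μ : Fin n) : L.ghostPull (L.cbNabla μ) = L.tpsiNabla μ := by
  simp only [cbNabla, tpsiNabla, map_add, map_smul, map_sum, ghostPull_fsmul, map_mul,
    ghostPull_ca, ghostPull_cb]

/-- Form degree on the target becomes ghost degree, and parities agree: a and ε are odd, b and ψ̃
even. -/
theorem ghostPull_signAut (z : TAlg 𝒞 n r) :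
    L.ghostPull (signAut (1, 0) z) = signAut (0, 1) (L.ghostPull z) := by
  induction z using gAlg_induction with
  | hf f => simp only [signAut_fn, ghostPull_fn]
  | hg x =>
    cases x with
    | a a =>
      change L.ghostPull (signAut (1, 0) (L.ca a)) = signAut (0, 1) (L.ghostPull (L.ca a))
      rw [(L.ca_sign a).signAut_odd (by decide), map_neg, ghostPull_ca,
        (L.eps_sign a).signAut_odd (by decide)]
    | b μ =>
      change L.ghostPull (signAut (1, 0) (L.cb μ)) = signAut (0, 1) (L.ghostPull (L.cb μ))
      rw [(L.cb_sign μ).signAut_even (by decide), ghostPull_cb,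
        (L.tpsi_sign μ).signAut_even (by decide)]
  | hadd z w hz hw => simp only [map_add, hz, hw]
  | hmul z w hz hw => simp only [map_mul, hz, hw]

/-- On functions, ε and ψ̃ the operator s₀ is given by the same formulas as Q^H on functions, a and
b. Both sides obey the same Leibniz rule because the sign automorphisms correspond. -/
theorem ghostPull_QH (z : TAlg 𝒞 n r) : L.ghostPull (L.QH z) = L.s₀ (L.ghostPull z) := by
  induction z using gAlg_induction with
  | hf f => simp only [QH_fn, ghostPull_fn, s₀_fn, map_sum, ghostPull_fsmul, ghostPull_ca, sX]
  | hg x =>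
    cases x with
    | a a =>
      change L.ghostPull (L.QH (L.ca a)) = L.s₀ (L.ghostPull (L.ca a))
      rw [ghostPull_ca, s₀_eps, QH_ca, sEps]
      simp only [map_neg, map_add, map_smul, map_sum, ghostPull_fsmul, map_mul, ghostPull_ca,
        ghostPull_cb]
      abel
    | b μ =>
      change L.ghostPull (L.QH (L.cb μ)) = L.s₀ (L.ghostPull (L.cb μ))
      rw [ghostPull_cb, s₀_tpsi, QH_cb, sTpsi]
      simp only [map_neg, map_add, map_sub, map_smul, map_sum, ghostPull_fsmul, map_mul,
        ghostPull_ca, ghostPull_cb, add_smul, Finset.sum_add_distrib, smul_add]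
      abel
  | hadd z w hz hw => simp only [map_add, hz, hw]
  | hmul z w hz hw => rw [QH_mul, map_add, map_mul, map_mul, map_mul, s₀_mul, hz, hw,
      ghostPull_signAut]

/-- The connection term that turns s₀ into its covariant version removes exactly the contribution of
D_μ to Q_∇^α D_α. The same mechanism works for b^∇ in `QH_cbNabla_sub`. -/
theorem QH_ca_add (c : Fin r) : L.QH (L.ca c)
    + ∑ μ, ∑ b, L.omega μ b c • (L.QNabla (.x μ) * L.ca b) = L.QNabla (.a c) := by
  rw [QH_eq_QD, QD, sumIdx]
  simp only [D, D0_ca, D1_ca, D2_ca, mul_neg, mul_ite, mul_one, mul_zero, Finset.sum_ite_eq',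
    Finset.mem_univ, if_true, Finset.sum_const_zero, add_zero, Finset.mul_sum, mul_smul_comm,
    Finset.sum_neg_distrib]
  abel

theorem QH_cbNabla_sub (μ : Fin n) : L.QH (L.cbNabla μ)
    - ∑ ν, ∑ σ, L.Gamma ν μ σ • (L.QNabla (.x σ) * L.cbNabla ν) = L.QNabla (.b μ) := by
  rw [QH_eq_QD, QD, sumIdx, Finset.sum_comm]
  simp only [D, D0_cbNabla, D1_cbNabla, D2_cbNabla, mul_ite, mul_one, mul_zero,
    Finset.sum_ite_eq', Finset.mem_univ, if_true, Finset.sum_const_zero, add_zero, Finset.mul_sum,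
    mul_smul_comm]
  abel

theorem ghostPull_QNabla_x (μ : Fin n) : L.ghostPull (L.QNabla (.x μ)) = L.sX μ := by
  simp only [QNabla, map_sum, ghostPull_fsmul, ghostPull_ca, sX]

theorem nX_eq (μ : Fin n) : L.nX μ = ∑ a, L.rho a μ • L.eps a := L.s₀_x μ

theorem nEps_eq (a : Fin r) : L.nEps a = -∑ μ, L.rhoStar a μ • L.tpsiNabla μ
    + ∑ b, ∑ c, L.Tup b c a • (L.eps b * L.eps c) := by
  have h := congrArg L.ghostPull (L.QH_ca_add a)
  simp only [map_add, map_sum, ghostPull_fsmul, map_mul, ghostPull_QH, ghostPull_ca,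
    ghostPull_QNabla_x] at h
  simp only [nEps, barE, s₀_x, h]
  simp only [QNabla, map_neg, map_add, map_sum, ghostPull_fsmul, map_mul, ghostPull_ca,
    ghostPull_cbNabla]

theorem nTpsi_eq (μ : Fin n) : L.nTpsi μ
    = -∑ a, ∑ ν, L.nablaRho μ a ν • (L.tpsiNabla ν * L.eps a)
      - (1 / 3 : ℝ) • ∑ a, ∑ b, ∑ c, L.St μ a b c • (L.eps a * L.eps b * L.eps c) := by
  have h := congrArg L.ghostPull (L.QH_cbNabla_sub μ)
  simp only [map_sub, map_sum, ghostPull_fsmul, map_mul, ghostPull_QH, ghostPull_cbNabla,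
    ghostPull_QNabla_x] at h
  simp only [nTpsi, barT, s₀_x, h]
  simp only [QNabla, map_neg, map_sub, map_smul, map_sum, ghostPull_fsmul, map_mul, ghostPull_ca,
    ghostPull_cbNabla]

/-! ### Descent from ghosts to fields -/

/-- The derivation of bidegree `(1, -1)` mapping `ε ↦ A`, `ψ̃ ↦ ψ`, `ψ ↦ -2 B` and anticommuting
with the exterior derivative. -/
def descentData : DerData 𝒞 (FGen.deg : FGen n r → ℤ × ℤ) n (1, -1) where
  pd := L.pd
  v := 0
  w := fun
    | .eps a => L.A a
    | .deps a => -L.d (L.A a)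
    | .psi μ => (-2 : ℝ) • L.B μ
    | .dpsi μ => (2 : ℝ) • L.d (L.B μ)
    | .tpsi μ => L.psi μ
    | .dtpsi μ => -L.d (L.psi μ)
    | _ => 0
  hv := fun _ => HasSign.zero _
  hw := by
    rintro (_ | _ | _ | _ | _ | a | a | μ | μ | μ | μ)
    iterate 5 exact HasSign.zero _
    · exact L.A_sign a
    · exact (L.d_sign (L.A_sign a) rfl).neg
    · exact (L.B_sign μ).smul _
    · exact (L.d_sign (L.B_sign μ) rfl).smul _
    · exact L.psi_sign μ
    · exact (L.d_sign (L.psi_sign μ) rfl).neg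

/-- The derivation `ε ↦ A`, `ψ̃ ↦ ψ`, `ψ ↦ -2 B`. -/
def descent : FAlg 𝒞 n r →ₗ[ℝ] FAlg 𝒞 n r := L.descentData.der

theorem descent_fn (f : 𝒞) : L.descent (fn f) = 0 :=
  (DerData.der_fn _ f).trans (Finset.sum_eq_zero fun _ _ => smul_zero _)

theorem descent_gen (x : FGen n r) : L.descent (gen x) = L.descentData.w x := DerData.der_gen _ x

theorem descent_mul (z w) :
    L.descent (z * w) = L.descent z * w + signAut (1, -1) z * L.descent w :=
  DerData.der_mul _ z w

theorem descent_fsmul (f : 𝒞) (z) : L.descent (f • z) = f • L.descent z := by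
  rw [fsmul_def, descent_mul, descent_fn, zero_mul, zero_add, signAut_fn, fsmul_def]

theorem descent_dX (μ : Fin n) : L.descent (L.dX μ) = 0 := L.descent_gen _
theorem descent_A (a : Fin r) : L.descent (L.A a) = 0 := L.descent_gen _
theorem descent_eps (a : Fin r) : L.descent (L.eps a) = L.A a := L.descent_gen _
theorem descent_psi (μ : Fin n) : L.descent (L.psi μ) = (-2 : ℝ) • L.B μ := L.descent_gen _
theorem descent_tpsi (μ : Fin n) : L.descent (L.tpsi μ) = L.psi μ := L.descent_gen _

theorem d_d_gen (x : FGen n r) : L.d (dGen x) = 0 := by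
  cases x <;> first
    | exact map_zero L.d
    | exact L.d_gen _

/-- Bidegrees (1,-1) and (1,0) pair to 1, so the graded commutator is the anticommutator; it is a
derivation and vanishes on functions and generators. -/
theorem descent_d (z : FAlg 𝒞 n r) : L.descent (L.d z) = -L.d (L.descent z) := by
  induction z using gAlg_induction with
  | hf f => simp only [d_fn, descent_fn, map_sum, descent_fsmul, descent_dX, smul_zero,
      Finset.sum_const_zero, map_zero, neg_zero]
  | hg x =>
    rw [d_gen, descent_gen]
    cases x with
    | eps a => exact L.descent_gen _
    | deps a =>
      change L.descent 0 = -L.d (-L.d (L.A a))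
      rw [map_zero, map_neg, neg_neg]
      exact (L.d_d_gen (.A a) ▸ congrArg L.d (L.d_gen (.A a))).symm
    | psi μ =>
      change L.descent (gen (.dpsi μ)) = -L.d ((-2 : ℝ) • L.B μ)
      rw [descent_gen, map_smul, neg_smul, neg_neg]; rfl
    | dpsi μ =>
      change L.descent 0 = -L.d ((2 : ℝ) • L.d (L.B μ))
      rw [map_zero, map_smul, show L.d (L.d (L.B μ)) = 0 from
        (congrArg L.d (L.d_gen (.B μ))).trans (L.d_d_gen (.B μ)), smul_zero, neg_zero]
    | tpsi μ => exact L.descent_gen _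
    | dtpsi μ =>
      change L.descent 0 = -L.d (-L.d (L.psi μ))
      rw [map_zero, map_neg, neg_neg]
      exact ((congrArg L.d (L.d_gen (.psi μ))).trans (L.d_d_gen (.psi μ))).symm
    | A a => exact (L.descent_gen _).trans (by
        change 0 = -L.d 0; rw [map_zero, neg_zero])
    | B a => exact (L.descent_gen _).trans (by
        change 0 = -L.d 0; rw [map_zero, neg_zero])
    | _ =>
      change L.descent 0 = -L.d 0
      rw [map_zero, map_zero, neg_zero]
  | hadd z w hz hw => simp only [map_add, hz, hw, neg_add]
  | hmul z w hz hw =>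
    rw [d_mul, map_add, descent_mul, descent_mul, descent_mul, map_add, d_mul, d_mul, hz, hw]
    have h₁ : signAut (1, -1) (L.d z) = -L.d (signAut (1, -1) z) := by
      rw [d, DerData.signAut_der, sgn, Odd.neg_one_zpow (by decide), neg_one_smul]
    have h₂ : signAut (1, 0) (L.descent z) = -L.descent (signAut (1, 0) z) := by
      rw [descent, DerData.signAut_der, sgn, Odd.neg_one_zpow (by decide), neg_one_smul]
    rw [h₁, h₂, signAut_comm (1, -1) (1, 0)]
    simp only [neg_mul, mul_neg]
    abel

/-- The failure of the descent derivation to intertwine the BRST operator and the exterior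
derivative. It is generated by the field equations. -/
def defect : FAlg 𝒞 n r →ₗ[ℝ] FAlg 𝒞 n r :=
  L.s₀ ∘ₗ L.descent + L.descent ∘ₗ L.s₀ - L.d

theorem defect_apply (z) :
    L.defect z = L.s₀ (L.descent z) + L.descent (L.s₀ z) - L.d z := rfl

/-- The bidegrees of s₀ and of the descent pair to -1, so their anticommutator is a derivation. Its
bidegree (0,1) + (1,-1) = (1,0) is that of d, which may therefore be subtracted. -/
theorem defect_mul (z w) :
    L.defect (z * w) = L.defect z * w + signAut (1, 0) z * L.defect w := by
  have h₁ : signAut (0, 1) (L.descent z) = -L.descent (signAut (0, 1) z) := by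
    rw [descent, DerData.signAut_der, sgn, Odd.neg_one_zpow (by decide), neg_one_smul]
  have h₂ : signAut (1, -1) (L.s₀ z) = -L.s₀ (signAut (1, -1) z) := by
    rw [s₀, DerData.signAut_der, sgn, Odd.neg_one_zpow (by decide), neg_one_smul]
  have h₃ : signAut (0, 1) (signAut (1, -1) z) = signAut (1, 0) z := by
    rw [signAut_signAut]; rfl
  have h₄ : signAut (1, -1) (signAut (0, 1) z) = signAut (1, 0) z := by
    rw [signAut_signAut]; rfl
  simp only [defect_apply, descent_mul, s₀_mul, d_mul, map_add, h₁, h₂, h₃, h₄]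
  simp only [neg_mul, add_mul, mul_add, sub_mul, mul_sub]
  abel

theorem descent_sX (μ : Fin n) : L.descent (L.sX μ) = ∑ a, L.rho a μ • L.A a := by
  simp only [sX, map_sum, descent_fsmul, descent_eps]

/-- Descent turns s₀X^μ into ρA, which differs from dX^μ by the field equation F^μ. -/
theorem defect_fn (f : 𝒞) : L.defect (fn f) = -∑ μ, L.pd μ f • L.F μ := by
  simp only [defect_apply, descent_fn, map_zero, s₀_fn, map_sum, descent_fsmul, descent_sX, d_fn,
    F, smul_sub, Finset.sum_sub_distrib]
  abel

theorem defect_fsmul (f : 𝒞) (z) :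
    L.defect (f • z) = -∑ μ, L.pd μ f • (L.F μ * z) + f • L.defect z := by
  rw [fsmul_def, defect_mul, defect_fn, signAut_fn, neg_mul, Finset.sum_mul, ← fsmul_def]
  simp only [smul_mul_assoc]

theorem descent_F (μ : Fin n) : L.descent (L.F μ) = 0 := by
  simp only [F, map_sub, descent_dX, map_sum, descent_fsmul, descent_A, smul_zero,
    Finset.sum_const_zero, sub_zero]

theorem eps_A (a b : Fin r) : L.eps a * L.A b = L.A b * L.eps a :=
  (L.eps_sign a).comm (L.A_sign b) (by decide)

theorem descent_eps_mul (a : Fin r) (z) :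
    L.descent (L.eps a * z) = L.A a * z - L.eps a * L.descent z := by
  rw [descent_mul, descent_eps, (L.eps_sign a).signAut_odd (by decide), neg_mul, sub_eq_add_neg]

theorem descent_A_mul (a : Fin r) (z) : L.descent (L.A a * z) = -(L.A a * L.descent z) := by
  rw [descent_mul, descent_A, (L.A_sign a).signAut_odd (by decide), neg_mul, zero_mul, zero_add]

/-- Descent of an expression quadratic in the ghosts. -/
theorem descent_sum_eps_eps {f : Fin r → Fin r → 𝒞} (hf : ∀ a b, f a b = -f b a) (z)
    (hz : L.descent z = 0) : L.descent (∑ a, ∑ b, f a b • (L.eps a * L.eps b * z))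
      = (2 : ℝ) • ∑ a, ∑ b, f a b • (L.A a * L.eps b * z) := by
  have h : ∀ a b, L.descent (L.eps a * L.eps b * z)
      = L.A a * L.eps b * z - L.A b * L.eps a * z := fun a b => by
    rw [mul_assoc, descent_eps_mul, descent_eps_mul, hz, mul_zero, sub_zero, ← mul_assoc,
      ← mul_assoc, eps_A]
  simp only [map_sum, descent_fsmul, h, smul_sub, Finset.sum_sub_distrib]
  rw [sum_antisymm hf fun a b => L.A a * L.eps b * z]
  module

theorem descent_sum_eps_eps' {f : Fin r → Fin r → 𝒞} (hf : ∀ a b, f a b = -f b a) :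
    L.descent (∑ a, ∑ b, f a b • (L.eps a * L.eps b))
      = (2 : ℝ) • ∑ a, ∑ b, f a b • (L.A a * L.eps b) := by
  have h1 : L.descent 1 = 0 := by rw [← map_one (fn : 𝒞 →ₐ[ℝ] FAlg 𝒞 n r), descent_fn]
  simpa only [mul_one] using L.descent_sum_eps_eps hf 1 h1

theorem eps_anticomm (a b : Fin r) : L.eps a * L.eps b = -(L.eps b * L.eps a) :=
  (L.eps_sign a).anticomm (L.eps_sign b) (by decide)

/-- Descent of an expression cubic in the ghosts. -/
theorem descent_sum_eps_eps_eps {f : Fin r → Fin r → Fin r → 𝒞}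
    (hc : ∀ a b c, f a b c = f b c a) :
    L.descent (∑ a, ∑ b, ∑ c, f a b c • (L.eps a * L.eps b * L.eps c))
      = (3 : ℝ) • ∑ a, ∑ b, ∑ c, f a b c • (L.A a * L.eps b * L.eps c) := by
  have h : ∀ a b c, L.descent (L.eps a * L.eps b * L.eps c)
      = L.A a * L.eps b * L.eps c + L.A b * L.eps c * L.eps a + L.A c * L.eps a * L.eps b := by
    intro a b c
    rw [mul_assoc, descent_eps_mul, descent_eps_mul, descent_eps, mul_sub, ← mul_assoc,
      ← mul_assoc, eps_A, mul_assoc (L.A b), L.eps_anticomm a c, ← mul_assoc (L.eps a),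
      (((L.eps_sign a).mul (L.eps_sign b) rfl).comm (L.A_sign c) (by decide))]
    simp only [mul_neg, mul_assoc]
    abel
  have h₁ : ∑ a, ∑ b, ∑ c, f a b c • (L.A b * L.eps c * L.eps a)
      = ∑ a, ∑ b, ∑ c, f a b c • (L.A a * L.eps b * L.eps c) := by
    rw [← sum_cycle fun a b c => f a b c • (L.A a * L.eps b * L.eps c)]
    exact Finset.sum_congr rfl fun a _ => Finset.sum_congr rfl fun b _ =>
      Finset.sum_congr rfl fun c _ => by rw [hc]
  have h₂ : ∑ a, ∑ b, ∑ c, f a b c • (L.A c * L.eps a * L.eps b)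
      = ∑ a, ∑ b, ∑ c, f a b c • (L.A a * L.eps b * L.eps c) := by
    rw [← sum_cycle fun a b c => f a b c • (L.A c * L.eps a * L.eps b)]
    exact Finset.sum_congr rfl fun a _ => Finset.sum_congr rfl fun b _ =>
      Finset.sum_congr rfl fun c _ => by rw [hc a]
  simp only [map_sum, descent_fsmul, h, smul_add, Finset.sum_add_distrib, h₁, h₂]
  module

theorem descent_sum_A_eps_eps {f : Fin r → Fin r → Fin r → 𝒞}
    (hf : ∀ a b c, f a b c = -f a c b) :
    L.descent (∑ a, ∑ b, ∑ c, f a b c • (L.A a * L.eps b * L.eps c))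
      = (-2 : ℝ) • ∑ a, ∑ b, ∑ c, f a b c • (L.A a * L.A b * L.eps c) := by
  have h : ∀ a, ∑ b, ∑ c, f a b c • (L.A a * L.eps b * L.eps c)
      = L.A a * ∑ b, ∑ c, f a b c • (L.eps b * L.eps c) := fun a => by
    simp only [Finset.mul_sum, mul_smul_comm, mul_assoc]
  rw [Finset.sum_congr rfl fun a _ => h a, map_sum, Finset.smul_sum]
  refine Finset.sum_congr rfl fun a _ => ?_
  rw [descent_A_mul, L.descent_sum_eps_eps' (hf a), mul_smul_comm, ← neg_smul]
  simp only [Finset.mul_sum, mul_smul_comm, mul_assoc]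

end LocalFrame

theorem half_mul_fsmul {𝒞 : Type*} [CommRing 𝒞] [Algebra ℝ 𝒞] {G : Type*} {deg : G → ℤ × ℤ}
    (f : 𝒞) (z : GAlg 𝒞 deg) : (half 𝒞 * f) • z = (1 / 2 : ℝ) • (f • z) := by
  rw [half, ← Algebra.smul_def, smul_assoc]

namespace LocalFrame

variable {𝒞 : Type*} [CommRing 𝒞] [Algebra ℝ 𝒞] {𝓔 : Type*} [AddCommGroup 𝓔] [Module 𝒞 𝓔]
  {K : Target 𝒞 𝓔} {n r : ℕ} (L : LocalFrame K n r)

/-! ### Descent of the covariant ghosts. -/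

theorem tpsiNabla_sign (μ : Fin n) : HasSign (L.tpsiNabla μ) (0, 2) :=
  (L.tpsi_sign μ).add (HasSign.smul _ (HasSign.sum fun a => HasSign.sum fun b =>
    ((L.eps_sign a).mul (L.eps_sign b) rfl).fsmul _))

theorem psiNabla_sign (μ : Fin n) : HasSign (L.psiNabla μ) (1, 1) :=
  (L.psi_sign μ).add (HasSign.sum fun a => HasSign.sum fun b =>
    ((L.A_sign a).mul (L.eps_sign b) rfl).fsmul _)

theorem BNabla_sign (μ : Fin n) : HasSign (L.BNabla μ) (2, 0) :=
  (L.B_sign μ).add (HasSign.smul _ (HasSign.sum fun a => HasSign.sum fun b =>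
    ((L.A_sign a).mul (L.A_sign b) rfl).fsmul _))

/-- Applying the descent twice to ½ωεε gives ωAε and then -ωAA. The factor -2 in ψ ↦ -2B is what
keeps the covariant redefinitions compatible with this, here and in `descent_psiNabla`. -/
theorem descent_tpsiNabla (μ : Fin n) : L.descent (L.tpsiNabla μ) = L.psiNabla μ := by
  rw [tpsiNabla, map_add, map_smul, descent_tpsi, L.descent_sum_eps_eps' (L.omegaLow_swap μ),
    psiNabla]
  module

theorem descent_psiNabla (μ : Fin n) :
    L.descent (L.psiNabla μ) = (-2 : ℝ) • L.BNabla μ := by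
  rw [psiNabla, map_add, descent_psi, BNabla]
  simp only [map_sum, descent_fsmul, descent_A_mul, descent_eps, smul_neg, Finset.sum_neg_distrib]
  module

theorem descent_tpsiNabla_mul (μ : Fin n) (z) :
    L.descent (L.tpsiNabla μ * z) = L.psiNabla μ * z + L.tpsiNabla μ * L.descent z := by
  rw [descent_mul, descent_tpsiNabla, (L.tpsiNabla_sign μ).signAut_even (by decide)]

theorem descent_psiNabla_mul (μ : Fin n) (z) : L.descent (L.psiNabla μ * z)
    = (-2 : ℝ) • (L.BNabla μ * z) + L.psiNabla μ * L.descent z := by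
  rw [descent_mul, descent_psiNabla, (L.psiNabla_sign μ).signAut_even (by decide), smul_mul_assoc]

/-- The source of the F-corrections in s₀^∇: connection terms along s₀X descend to connection terms
along dX - F, whereas the exterior covariant derivative needs dX. -/
theorem descent_sX_mul (μ : Fin n) (z) : L.descent (L.sX μ * z)
    = L.dX μ * z - L.F μ * z - L.sX μ * L.descent z := by
  rw [descent_mul, descent_sX, (L.sX_sign μ).signAut_odd (by decide), neg_mul, ← sub_mul, F,
    sub_sub_cancel, sub_eq_add_neg]

theorem descent_dX_mul (μ : Fin n) (z) : L.descent (L.dX μ * z) = -(L.dX μ * L.descent z) := by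
  rw [descent_mul, descent_dX, (L.dX_sign μ).signAut_odd (by decide), neg_mul, zero_mul, zero_add]

theorem descent_F_mul (μ : Fin n) (z) : L.descent (L.F μ * z) = -(L.F μ * L.descent z) := by
  rw [descent_mul, descent_F, (L.F_sign μ).signAut_odd (by decide), neg_mul, zero_mul, zero_add]

/-! ### The 1-form gauge field -/

theorem defect_eps (a : Fin r) : L.defect (L.eps a) = 0 := by
  rw [defect_apply, descent_eps, s₀_A, s₀_eps, sA, sEps, map_sub, map_neg, map_smul,
    L.descent_sum_eps_eps' fun b c => L.C_swap b c a]
  simp only [map_sum, descent_fsmul, descent_tpsi]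
  module

/-- Descent of the formula for ε. As ε has no defect, s₀A is dε minus the descent of s₀ε; the
leftover ωFε is the correction in the definition of `nA`. -/
theorem nA_eq (a : Fin r) : L.nA a = L.covDE L.eps a + ∑ μ, L.rhoStar a μ • L.psiNabla μ
    - (2 : ℝ) • ∑ b, ∑ c, L.Tup b c a • (L.A b * L.eps c) := by
  have h₁ := L.defect_eps a
  have h₂ := congrArg L.descent (L.nEps_eq a)
  rw [nEps, barE, map_add, map_add, L.descent_sum_eps_eps' fun b c => L.Tup_swap b c a] at h₂
  rw [defect_apply, descent_eps] at h₁
  simp only [s₀_x, map_neg, map_sum, descent_fsmul, descent_tpsiNabla, descent_sX_mul, descent_eps,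
    smul_sub, Finset.sum_sub_distrib] at h₂
  rw [nA, barE, covDE]
  simp only [s₀_x]
  linear_combination (norm := module) h₁ - h₂

/-! ### The defect of the descent -/

theorem eps_eps_F (a b : Fin r) (ν : Fin n) :
    L.F ν * (L.eps a * L.eps b) = L.eps a * L.eps b * L.F ν :=
  (L.F_sign ν).comm ((L.eps_sign a).mul (L.eps_sign b) rfl) (by decide)

theorem A_eps_F (a b : Fin r) (ν : Fin n) :
    L.F ν * (L.A a * L.eps b) = -(L.A a * L.eps b * L.F ν) :=
  (L.F_sign ν).anticomm ((L.A_sign a).mul (L.eps_sign b) rfl) (by decide)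

theorem sum_eps_A_F {f : Fin r → Fin r → 𝒞} (hf : ∀ a b, f a b = -f b a) (ν : Fin n) :
    ∑ a, ∑ b, f a b • (L.eps a * L.A b * L.F ν)
      = -∑ a, ∑ b, f a b • (L.A a * L.eps b * L.F ν) := by
  rw [← sum_antisymm hf]
  simp only [eps_A]

/-- Each term of s₀A descends to minus the corresponding term of G, with weights that combine with
-dA to twice G. -/
theorem defect_A (a : Fin r) : L.defect (L.A a) = (-2 : ℝ) • L.eqG a := by
  rw [defect_apply, descent_A, map_zero, s₀_A, sA, map_add, map_add, descent_d, descent_eps, eqG]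
  simp only [map_sum, descent_fsmul, descent_psi, descent_A_mul, descent_eps, smul_neg,
    Finset.sum_neg_distrib, smul_comm _ (-2 : ℝ), ← Finset.smul_sum]
  module

/-- All terms of s₀ψ except the one with F arise from s₀ψ̃ by descent. -/
theorem defect_tpsi (μ : Fin n) : L.defect (L.tpsi μ)
    = (1 / 4 : ℝ) • ∑ ν, ∑ a, ∑ b, L.H₂ μ ν a b • (L.eps a * L.eps b * L.F ν) := by
  have hc : ∀ a b c, L.pd μ (L.Clow a b c) + L.H₃ μ a b c
      = L.pd μ (L.Clow b c a) + L.H₃ μ b c a := fun a b c => by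
    rw [L.Clow_cycle, L.H₃_cycle]
  have ht : ∀ ν a, L.descent (L.tpsi ν * L.eps a) = L.psi ν * L.eps a + L.tpsi ν * L.A a :=
    fun ν a => by
      rw [descent_mul, descent_tpsi, descent_eps, (L.tpsi_sign ν).signAut_even (by decide)]
  rw [defect_apply, descent_tpsi, s₀_psi, s₀_tpsi, sPsi, sTpsi, map_sub, map_neg, map_smul,
    L.descent_sum_eps_eps_eps hc]
  simp only [map_sum, descent_fsmul, ht, smul_add, Finset.sum_add_distrib]
  module

/-- The H-terms with F do not descend into each other: -2 s₀B contributes weight 1 and the descent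
of s₀ψ weight -½ to the terms with two bundle indices, while the term with FF comes from s₀B alone.
-/
theorem defect_psi (μ : Fin n) : L.defect (L.psi μ)
    = (1 / 2 : ℝ) • ∑ ν, ∑ a, ∑ b, L.H₂ μ ν a b • (L.eps a * L.A b * L.F ν)
      + (1 / 3 : ℝ) • ∑ ν, ∑ σ, ∑ a, L.H₁ μ ν σ a • (L.eps a * L.F ν * L.F σ) := by
  have hc : ∀ a b c, L.pd μ (L.Clow a b c) + L.H₃ μ a b c
      = -(L.pd μ (L.Clow a c b) + L.H₃ μ a c b) := fun a b c => by
    rw [L.Clow_swap', L.H₃_swap', map_neg, neg_add]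
  have h₁ : ∀ ν a, L.descent (L.tpsi ν * L.A a) = L.psi ν * L.A a := fun ν a => by
    rw [descent_mul, descent_tpsi, descent_A, mul_zero, add_zero]
  have h₂ : ∀ ν a, L.descent (L.psi ν * L.eps a)
      = (-2 : ℝ) • (L.B ν * L.eps a) + L.psi ν * L.A a := fun ν a => by
    rw [descent_mul, descent_psi, descent_eps, (L.psi_sign ν).signAut_even (by decide),
      smul_mul_assoc]
  have h₃ : L.descent (∑ ν, ∑ a, ∑ b, L.H₂ μ ν a b • (L.eps a * L.eps b * L.F ν))
      = (-2 : ℝ) • ∑ ν, ∑ a, ∑ b, L.H₂ μ ν a b • (L.eps a * L.A b * L.F ν) := by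
    rw [map_sum, Finset.smul_sum]
    refine Finset.sum_congr rfl fun ν _ => ?_
    rw [L.descent_sum_eps_eps (L.H₂_swap μ ν) _ (L.descent_F ν),
      L.sum_eps_A_F (L.H₂_swap μ ν), neg_smul, smul_neg, neg_neg]
  have h₄ : L.descent (∑ a, ∑ ν, L.pd μ (L.rho a ν)
        • (L.tpsi ν * L.A a + L.psi ν * L.eps a))
      = (-2 : ℝ) • ∑ a, ∑ ν, L.pd μ (L.rho a ν) • (L.B ν * L.eps a - L.psi ν * L.A a) := by
    simp only [map_sum, descent_fsmul, map_add, h₁, h₂, Finset.smul_sum]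
    refine Finset.sum_congr rfl fun a _ => Finset.sum_congr rfl fun ν _ => ?_
    rw [smul_comm (-2 : ℝ)]
    congr 1
    module
  rw [defect_apply, descent_psi, map_smul, s₀_B, s₀_psi, sB, sPsi, map_add, map_add, map_add,
    descent_d, descent_tpsi, map_smul, map_smul, L.descent_sum_A_eps_eps hc, h₃, h₄]
  module

/-- Since εε has no defect, the redefinition contributes only through `defect_fn` acting on the
coefficient ω. -/
theorem defect_tpsiNabla (μ : Fin n) : L.defect (L.tpsiNabla μ)
    = (1 / 4 : ℝ) • ∑ ν, ∑ a, ∑ b, L.H₂ μ ν a b • (L.eps a * L.eps b * L.F ν)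
      - (1 / 2 : ℝ) • ∑ ν, ∑ a, ∑ b,
        L.pd ν (L.omegaLow μ a b) • (L.eps a * L.eps b * L.F ν) := by
  have h : ∀ a b, L.defect (L.eps a * L.eps b) = 0 := fun a b => by
    rw [defect_mul, defect_eps, defect_eps, zero_mul, mul_zero, add_zero]
  rw [tpsiNabla, map_add, map_smul, defect_tpsi]
  simp only [map_sum, defect_fsmul, h, smul_zero, add_zero, Finset.sum_neg_distrib, eps_eps_F]
  rw [sum_cycle fun a b ν => L.pd ν (L.omegaLow μ a b) • (L.eps a * L.eps b * L.F ν)]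
  module

/-- The redefinition now contributes twice: the coefficient ω gives F, and the factor A gives G. The
latter is the reason for the G-term in the definition of `nB`. -/
theorem defect_psiNabla (μ : Fin n) : L.defect (L.psiNabla μ)
    = (1 / 2 : ℝ) • ∑ ν, ∑ a, ∑ b, L.H₂ μ ν a b • (L.eps a * L.A b * L.F ν)
      + (1 / 3 : ℝ) • ∑ ν, ∑ σ, ∑ a, L.H₁ μ ν σ a • (L.eps a * L.F ν * L.F σ)
      + ∑ ν, ∑ a, ∑ b, L.pd ν (L.omegaLow μ a b) • (L.A a * L.eps b * L.F ν)
      - (2 : ℝ) • ∑ a, ∑ b, L.omegaLow μ a b • (L.eqG a * L.eps b) := by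
  have h : ∀ a b, L.defect (L.A a * L.eps b) = (-2 : ℝ) • (L.eqG a * L.eps b) := fun a b => by
    rw [defect_mul, defect_eps, defect_A, mul_zero, add_zero, smul_mul_assoc]
  rw [psiNabla, map_add, defect_psi]
  simp only [map_sum, defect_fsmul, h, Finset.sum_neg_distrib, A_eps_F, smul_neg,
    Finset.sum_add_distrib, smul_comm _ (-2 : ℝ), ← Finset.smul_sum, neg_neg]
  rw [sum_cycle fun a b ν => L.pd ν (L.omegaLow μ a b) • (L.A a * L.eps b * L.F ν)]
  module

/-! ### The 1-form ghost and the 2-form gauge field -/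

theorem s₀_tpsiNabla (μ : Fin n) : L.s₀ (L.tpsiNabla μ)
    = ∑ ν, ∑ σ, L.Gamma ν μ σ • (L.sX σ * L.tpsiNabla ν)
      - ∑ a, ∑ ν, L.nablaRho μ a ν • (L.tpsiNabla ν * L.eps a)
      - (1 / 3 : ℝ) • ∑ a, ∑ b, ∑ c, L.St μ a b c • (L.eps a * L.eps b * L.eps c) := by
  have h := L.nTpsi_eq μ
  rw [nTpsi, barT] at h
  simp only [s₀_x] at h
  linear_combination (norm := module) h

/-- Since ψ^∇ is the descent of ψ̃^∇, the operator s₀ on it is the defect plus d minus the descent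
of s₀ψ̃^∇. The defect is kept unevaluated for reuse in the next descent. -/
theorem s₀_psiNabla (μ : Fin n) : L.s₀ (L.psiNabla μ)
    = L.defect (L.tpsiNabla μ) + L.d (L.tpsiNabla μ)
      - ∑ ν, ∑ σ, L.Gamma ν μ σ • (L.dX σ * L.tpsiNabla ν)
      + ∑ ν, ∑ σ, L.Gamma ν μ σ • (L.F σ * L.tpsiNabla ν)
      + ∑ ν, ∑ σ, L.Gamma ν μ σ • (L.sX σ * L.psiNabla ν)
      + ∑ a, ∑ ν, L.nablaRho μ a ν • (L.tpsiNabla ν * L.A a)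
      + ∑ a, ∑ ν, L.nablaRho μ a ν • (L.psiNabla ν * L.eps a)
      + ∑ a, ∑ b, ∑ c, L.St μ a b c • (L.A a * L.eps b * L.eps c) := by
  rw [defect_apply, descent_tpsiNabla, s₀_tpsiNabla, map_sub, map_sub, map_smul,
    L.descent_sum_eps_eps_eps (L.St_cycle μ)]
  simp only [map_sum, descent_fsmul, descent_sX_mul, descent_tpsiNabla_mul, descent_tpsiNabla,
    descent_eps, smul_sub, smul_add, Finset.sum_sub_distrib, Finset.sum_add_distrib]
  module

/-- The Γ-terms combine to the covariant derivative. In the defect, -½∂ω is cancelled by ½κ up to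
-¼R, which joins ¼H to form the trivial term. -/
theorem nPsi_eq (μ : Fin n) : L.nPsi μ = L.covDT L.tpsiNabla μ
    + ∑ a, ∑ ν, L.nablaRho μ a ν • (L.tpsiNabla ν * L.A a)
    + ∑ a, ∑ ν, L.nablaRho μ a ν • (L.psiNabla ν * L.eps a)
    + ∑ a, ∑ b, ∑ c, L.St μ a b c • (L.A a * L.eps b * L.eps c)
    + L.trivPsi μ := by
  have h : ∀ ν σ, L.tpsiNabla ν * L.F σ = L.F σ * L.tpsiNabla ν := fun ν σ =>
    (L.tpsiNabla_sign ν).comm (L.F_sign σ) (by decide)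
  rw [nPsi, barT, s₀_psiNabla, defect_tpsiNabla, covDT, trivPsi]
  simp only [s₀_x, h, kappa_eq, mul_assoc (L.F _), eps_eps_F, sub_smul, half_mul_fsmul,
    Finset.sum_sub_distrib, ← Finset.smul_sum]
  module

/-- A second descent, from ψ^∇ to -2B^∇. Terms in F, G and the derivative of ω come both from the
new defect and from the descent of the old one; the κ- and G-corrections remove all that is not
covariant. -/
theorem nB_eq (μ : Fin n) : L.nB μ = -L.covDT L.psiNabla μ
    + ∑ a, ∑ ν, L.nablaRho μ a ν • (L.psiNabla ν * L.A a)
    - ∑ a, ∑ ν, L.nablaRho μ a ν • (L.BNabla ν * L.eps a)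
    - ∑ a, ∑ b, ∑ c, L.St μ a b c • (L.A a * L.A b * L.eps c)
    + L.trivB μ := by
  have hF : ∀ ν σ, L.psiNabla ν * L.F σ = -(L.F σ * L.psiNabla ν) := fun ν σ =>
    (L.psiNabla_sign ν).anticomm (L.F_sign σ) (by decide)
  have hS : ∀ a b c, L.St μ a b c = -L.St μ a c b := fun a b c => by
    rw [L.St_cycle, L.St_swap, L.St_cycle μ a]
  have h₁ := L.defect_apply (L.psiNabla μ)
  rw [descent_psiNabla, map_smul, s₀_psiNabla, defect_psiNabla, defect_tpsiNabla] at h₁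
  simp only [map_add, map_sub, map_smul] at h₁
  rw [L.descent_sum_A_eps_eps hS, descent_d, descent_tpsiNabla] at h₁
  have hH : ∀ f : Fin n → Fin r → Fin r → 𝒞, (∀ ν a b, f ν a b = -f ν b a) →
      L.descent (∑ ν, ∑ a, ∑ b, f ν a b • (L.eps a * L.eps b * L.F ν))
        = (2 : ℝ) • ∑ ν, ∑ a, ∑ b, f ν a b • (L.A a * L.eps b * L.F ν) := fun f hf => by
    rw [map_sum, Finset.smul_sum]
    exact Finset.sum_congr rfl fun ν _ => L.descent_sum_eps_eps (hf ν) _ (L.descent_F ν)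
  have hA : ∀ f : Fin n → Fin r → Fin r → 𝒞, (∀ ν a b, f ν a b = -f ν b a) →
      ∑ ν, ∑ a, ∑ b, f ν a b • (L.eps a * L.A b * L.F ν)
        = -∑ ν, ∑ a, ∑ b, f ν a b • (L.A a * L.eps b * L.F ν) := fun f hf => by
    rw [← Finset.sum_neg_distrib]
    exact Finset.sum_congr rfl fun ν _ => L.sum_eps_A_F (hf ν) ν
  have hω : ∀ ν a b, L.pd ν (L.omegaLow μ a b) = -L.pd ν (L.omegaLow μ b a) := fun ν a b => by
    rw [L.omegaLow_swap, map_neg]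
  rw [hH _ (L.H₂_swap μ), hH _ hω, hA _ (L.H₂_swap μ)] at h₁
  simp only [map_sum, descent_fsmul, descent_dX_mul, descent_F_mul, descent_sX_mul,
    descent_tpsiNabla_mul, descent_tpsiNabla, descent_psiNabla_mul, descent_psiNabla, descent_eps,
    descent_A, mul_zero, add_zero, smul_neg, mul_smul_comm,
    smul_comm _ (-2 : ℝ), smul_sub, smul_add, Finset.sum_sub_distrib, Finset.sum_add_distrib,
    Finset.sum_neg_distrib, ← Finset.smul_sum] at h₁
  rw [nB, barT, covDT, trivB]
  have hR := hA (fun ν a b => L.R a b μ ν) fun ν a b => L.R_swap a b μ ν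
  simp only [s₀_x, hF, kappa_eq, mul_assoc (L.F _), A_eps_F, sub_smul, half_mul_fsmul, smul_neg,
    Finset.sum_sub_distrib, Finset.sum_neg_distrib, ← Finset.smul_sum, hR,
    hA _ (L.H₂_swap μ)]
  -- The weight ½ undoes, up to sign, the factor -2 in the descent of ψ^∇.
  linear_combination (norm := module) (1 / 2 : ℝ) • h₁

end LocalFrame

/-! ## The transformations in terms of the covariant derivations -/

namespace LocalFrame

variable {𝒞 : Type*} [CommRing 𝒞] [Algebra ℝ 𝒞] {𝓔 : Type*} [AddCommGroup 𝓔] [Module 𝒞 𝓔]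
  {K : Target 𝒞 𝓔} {n r : ℕ} (L : LocalFrame K n r)

theorem pull_fn (f : 𝒞) : L.pull (fn f) = fn f := lift_fn ..
theorem pull_ca (a : Fin r) : L.pull (L.ca a) = L.A a := lift_gen ..
theorem pull_cb (μ : Fin n) : L.pull (L.cb μ) = L.B μ := lift_gen ..

theorem pull_fsmul (f : 𝒞) (z) : L.pull (f • z) = f • L.pull z := map_fsmul L.pull_fn f z

theorem pull_cbNabla (μ : Fin n) : L.pull (L.cbNabla μ) = L.BNabla μ := by
  simp only [cbNabla, BNabla, map_add, map_smul, map_sum, pull_fsmul, map_mul, pull_ca, pull_cb]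

/-! ### The derivations as partial derivatives along a and b^∇. -/

theorem D1_one (i : Fin r) : L.D1 i 1 = 0 := by
  rw [← map_one (fn : 𝒞 →ₐ[ℝ] TAlg 𝒞 n r), D1_fn]

theorem D2_one (μ : Fin n) : L.D2 μ 1 = 0 := by
  rw [← map_one (fn : 𝒞 →ₐ[ℝ] TAlg 𝒞 n r), D2_fn]

theorem D1_ca_mul (i j : Fin r) (z) :
    L.D1 i (L.ca j * z) = (if i = j then z else 0) - L.ca j * L.D1 i z := by
  rw [D1_mul, D1_ca, (L.ca_sign j).signAut_odd (by decide), ite_mul, one_mul, zero_mul, neg_mul,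
    sub_eq_add_neg]

theorem D1_cbNabla_mul (i : Fin r) (μ : Fin n) (z) :
    L.D1 i (L.cbNabla μ * z) = L.cbNabla μ * L.D1 i z := by
  rw [D1_mul, D1_cbNabla, (L.cbNabla_sign μ).signAut_even (by decide), zero_mul, zero_add]

theorem D2_ca_mul (μ : Fin n) (j : Fin r) (z) : L.D2 μ (L.ca j * z) = L.ca j * L.D2 μ z := by
  rw [D2_mul, D2_ca, (L.ca_sign j).signAut_even (by decide), zero_mul, zero_add]

theorem D2_cbNabla_mul (μ ν : Fin n) (z) :
    L.D2 μ (L.cbNabla ν * z) = (if μ = ν then z else 0) + L.cbNabla ν * L.D2 μ z := by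
  rw [D2_mul, D2_cbNabla, (L.cbNabla_sign ν).signAut_even (by decide), ite_mul, one_mul, zero_mul]

theorem D1_sum_ca (i : Fin r) (f : Fin r → 𝒞) : L.D1 i (∑ a, f a • L.ca a) = f i • 1 := by
  simp only [map_sum, D1_fsmul, D1_ca, smul_ite, smul_zero, Finset.sum_ite_eq, Finset.mem_univ,
    if_true]

theorem D2_sum_ca (μ : Fin n) (f : Fin r → 𝒞) : L.D2 μ (∑ a, f a • L.ca a) = 0 := by
  simp only [map_sum, D2_fsmul, D2_ca, smul_zero, Finset.sum_const_zero]

/-- For antisymmetric coefficients the odd derivative hits both factors equally, the Koszul sign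
being compensated by the antisymmetry. The cubic case reduces to this one and gives weight 3. -/
theorem D1_sum_ca_ca (i : Fin r) {f : Fin r → Fin r → 𝒞} (hf : ∀ a b, f a b = -f b a) :
    L.D1 i (∑ a, ∑ b, f a b • (L.ca a * L.ca b)) = (2 : ℝ) • ∑ b, f i b • L.ca b := by
  have h₁ : ∀ a, ∑ b, f a b • (if i = a then L.ca b else 0)
      = if i = a then ∑ b, f a b • L.ca b else 0 := fun a => by
    split_ifs <;> simp
  have h₂ : ∑ a, f a i • L.ca a = -∑ a, f i a • L.ca a := by
    rw [← Finset.sum_neg_distrib]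
    exact Finset.sum_congr rfl fun a _ => by rw [hf, neg_smul]
  simp only [map_sum, D1_fsmul, D1_ca_mul, D1_ca, mul_ite, mul_one, mul_zero, smul_sub,
    Finset.sum_sub_distrib, smul_ite, smul_zero, Finset.sum_ite_eq, Finset.mem_univ,
    if_true, h₂]
  rw [Finset.sum_comm]
  simp only [Finset.sum_ite_eq, Finset.mem_univ, if_true]
  module

theorem D2_sum_ca_ca (μ : Fin n) (f : Fin r → Fin r → 𝒞) :
    L.D2 μ (∑ a, ∑ b, f a b • (L.ca a * L.ca b)) = 0 := by
  simp only [map_sum, D2_fsmul, D2_ca_mul, D2_ca, mul_zero, smul_zero, Finset.sum_const_zero]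

theorem D1_sum_ca_ca_ca (i : Fin r) {f : Fin r → Fin r → Fin r → 𝒞}
    (hf : ∀ a b c, f a b c = -f b a c) (hc : ∀ a b c, f a b c = f b c a) :
    L.D1 i (∑ a, ∑ b, ∑ c, f a b c • (L.ca a * L.ca b * L.ca c))
      = (3 : ℝ) • ∑ b, ∑ c, f i b c • (L.ca b * L.ca c) := by
  have hf' : ∀ a b c, f a b c = -f a c b := fun a b c => by rw [hc, hf, hc a]
  have h₁ : ∀ a, L.D1 i (L.ca a * ∑ b, ∑ c, f a b c • (L.ca b * L.ca c))
      = (if i = a then ∑ b, ∑ c, f a b c • (L.ca b * L.ca c) else 0)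
        - (2 : ℝ) • ∑ c, f a i c • (L.ca a * L.ca c) := fun a => by
    rw [D1_ca_mul, L.D1_sum_ca_ca i (hf' a), mul_smul_comm, Finset.mul_sum]
    simp only [mul_smul_comm]
  have h₂ : ∀ a, ∑ b, ∑ c, f a b c • (L.ca a * L.ca b * L.ca c)
      = L.ca a * ∑ b, ∑ c, f a b c • (L.ca b * L.ca c) := fun a => by
    simp only [Finset.mul_sum, mul_smul_comm, mul_assoc]
  have h₃ : ∑ a, ∑ c, f a i c • (L.ca a * L.ca c) = -∑ b, ∑ c, f i b c • (L.ca b * L.ca c) := by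
    simp only [← Finset.sum_neg_distrib]
    exact Finset.sum_congr rfl fun a _ => Finset.sum_congr rfl fun b _ => by rw [hf, neg_smul]
  rw [Finset.sum_congr rfl fun a _ => h₂ a, map_sum, Finset.sum_congr rfl fun a _ => h₁ a,
    Finset.sum_sub_distrib, ← Finset.smul_sum, h₃]
  simp only [Finset.sum_ite_eq, Finset.mem_univ, if_true]
  module

theorem D2_sum_ca_ca_ca (μ : Fin n) (f : Fin r → Fin r → Fin r → 𝒞) :
    L.D2 μ (∑ a, ∑ b, ∑ c, f a b c • (L.ca a * L.ca b * L.ca c)) = 0 := by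
  simp only [map_sum, D2_fsmul, mul_assoc, D2_ca_mul, D2_ca, mul_zero, smul_zero,
    Finset.sum_const_zero]

theorem D1_sum_cbNabla (i : Fin r) (f : Fin n → 𝒞) :
    L.D1 i (∑ μ, f μ • L.cbNabla μ) = 0 := by
  simp only [map_sum, D1_fsmul, D1_cbNabla, smul_zero, Finset.sum_const_zero]

theorem D2_sum_cbNabla (μ : Fin n) (f : Fin n → 𝒞) :
    L.D2 μ (∑ ν, f ν • L.cbNabla ν) = f μ • 1 := by
  simp only [map_sum, D2_fsmul, D2_cbNabla, smul_ite, smul_zero, Finset.sum_ite_eq,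
    Finset.mem_univ, if_true]

/-! ### Derivatives of the covariant components -/

theorem D1_QNabla_x (i : Fin r) (μ : Fin n) : L.D1 i (L.QNabla (.x μ)) = L.rho i μ • 1 :=
  L.D1_sum_ca i _

theorem D2_QNabla_x (ν : Fin n) (μ : Fin n) : L.D2 ν (L.QNabla (.x μ)) = 0 :=
  L.D2_sum_ca ν _

theorem D1_QNabla_a (i : Fin r) (c : Fin r) :
    L.D1 i (L.QNabla (.a c)) = (2 : ℝ) • ∑ b, L.Tup i b c • L.ca b := by
  rw [QNabla, map_add, map_neg, D1_sum_cbNabla, L.D1_sum_ca_ca i fun a b => L.Tup_swap a b c,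
    neg_zero, zero_add]

theorem D2_QNabla_a (μ : Fin n) (c : Fin r) :
    L.D2 μ (L.QNabla (.a c)) = -(L.rhoStar c μ • (1 : TAlg 𝒞 n r)) := by
  rw [QNabla, map_add, map_neg, D2_sum_cbNabla, D2_sum_ca_ca, add_zero]

theorem D1_QNabla_b (i : Fin r) (μ : Fin n) : L.D1 i (L.QNabla (.b μ))
    = -∑ ν, L.nablaRho μ i ν • L.cbNabla ν
      - ∑ b, ∑ c, L.St μ i b c • (L.ca b * L.ca c) := by
  have h : L.D1 i (∑ a, ∑ ν, L.nablaRho μ a ν • (L.cbNabla ν * L.ca a))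
      = ∑ ν, L.nablaRho μ i ν • L.cbNabla ν := by
    rw [Finset.sum_comm]
    simp only [map_sum, D1_fsmul, D1_cbNabla_mul, D1_ca, mul_ite, mul_one, mul_zero, smul_ite,
      smul_zero, Finset.sum_ite_eq, Finset.mem_univ, if_true]
  rw [QNabla, map_sub, map_neg, map_smul, L.D1_sum_ca_ca_ca i (L.St_swap μ) (L.St_cycle μ), h]
  module

theorem D2_QNabla_b (ν μ : Fin n) :
    L.D2 ν (L.QNabla (.b μ)) = -∑ a, L.nablaRho μ a ν • L.ca a := by
  rw [QNabla, map_sub, map_neg, map_smul, D2_sum_ca_ca_ca, smul_zero, sub_zero]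
  simp only [map_sum, D2_fsmul, D2_cbNabla_mul, D2_ca, mul_zero, add_zero, smul_ite, smul_zero,
    Finset.sum_ite_eq, Finset.mem_univ, if_true]

/-- The inner derivation acts first and takes the first slot, hence the order j, i. Contraction with
εε, where ε anticommutes, later turns this order into a sign. -/
theorem D1_D1_QNabla_b (i j : Fin r) (μ : Fin n) : L.D1 i (L.D1 j (L.QNabla (.b μ)))
    = (-2 : ℝ) • ∑ c, L.St μ j i c • L.ca c := by
  have hS : ∀ a b, L.St μ j a b = -L.St μ j b a := fun a b => by
    rw [L.St_cycle, L.St_swap, L.St_cycle μ j]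
  rw [D1_QNabla_b, map_sub, map_neg, D1_sum_cbNabla, L.D1_sum_ca_ca i hS]
  module

theorem D2_D1_QNabla_b (ν : Fin n) (j : Fin r) (μ : Fin n) : L.D2 ν (L.D1 j (L.QNabla (.b μ)))
    = -(L.nablaRho μ j ν • (1 : TAlg 𝒞 n r)) := by
  rw [D1_QNabla_b, map_sub, map_neg, D2_sum_cbNabla, D2_sum_ca_ca, sub_zero]

theorem D1_D2_QNabla_b (j : Fin r) (ν : Fin n) (μ : Fin n) : L.D1 j (L.D2 ν (L.QNabla (.b μ)))
    = -(L.nablaRho μ j ν • (1 : TAlg 𝒞 n r)) := by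
  rw [D2_QNabla_b, map_neg, D1_sum_ca]

theorem D2_D2_QNabla_b (σ ν μ : Fin n) : L.D2 σ (L.D2 ν (L.QNabla (.b μ))) = 0 := by
  rw [D2_QNabla_b, map_neg, D2_sum_ca, neg_zero]

theorem pull_smul_one (f : 𝒞) : L.pull (f • 1) = f • 1 := by rw [pull_fsmul, map_one]

/-- The ghosts have no component along x, so the sum reduces to first derivatives along a and b^∇;
sorting ghosts and fields gives the explicit formulas. -/
theorem nPhi_eq (α : Idx n r) : L.nPhi α = L.covD L.ghost α + L.ghostD α + L.trivPhi α := by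
  cases α with
  | x μ =>
    simp only [nPhi, nX_eq, covD, ghost, map_zero, mul_zero, smul_zero, Finset.sum_const_zero,
      ghostD, sumIdx, zero_mul, D, D1_QNabla_x, D2_QNabla_x, pull_smul_one, mul_smul_comm, mul_one,
      trivPhi, zero_add, add_zero]
  | a c =>
    have h : ∑ i, L.eps i * L.pull (L.D1 i (L.QNabla (.a c)))
        = (-2 : ℝ) • ∑ b, ∑ d, L.Tup b d c • (L.A b * L.eps d) := by
      simp only [D1_QNabla_a, map_smul, map_sum, pull_fsmul, pull_ca, mul_smul_comm,
        Finset.mul_sum, eps_A, ← Finset.smul_sum]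
      rw [sum_antisymm fun b d => L.Tup_swap b d c]
      module
    simp only [nPhi, nA_eq, covD, ghost, ghostD, sumIdx, zero_mul, Finset.sum_const_zero, D, h,
      D2_QNabla_a, map_neg, pull_smul_one, mul_neg, neg_neg, mul_smul_comm, mul_one, smul_neg,
      trivPhi]
    module
  | b μ =>
    have hB : ∀ i ν, L.eps i * L.BNabla ν = L.BNabla ν * L.eps i := fun i ν =>
      (L.eps_sign i).comm (L.BNabla_sign ν) (by decide)
    have hA : ∀ i b c, L.eps i * (L.A b * L.A c) = L.A b * L.A c * L.eps i := fun i b c =>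
      (L.eps_sign i).comm ((L.A_sign b).mul (L.A_sign c) rfl) (by decide)
    have hc : ∑ a, ∑ b, ∑ c, L.St μ a b c • (L.A b * L.A c * L.eps a)
        = ∑ a, ∑ b, ∑ c, L.St μ a b c • (L.A a * L.A b * L.eps c) := by
      rw [← sum_cycle fun a b c => L.St μ a b c • (L.A a * L.A b * L.eps c)]
      exact Finset.sum_congr rfl fun a _ => Finset.sum_congr rfl fun b _ =>
        Finset.sum_congr rfl fun c _ => by rw [L.St_cycle μ a b c]
    have h : ∑ i, L.eps i * L.pull (L.D1 i (L.QNabla (.b μ)))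
        = -∑ a, ∑ ν, L.nablaRho μ a ν • (L.BNabla ν * L.eps a)
          - ∑ a, ∑ b, ∑ c, L.St μ a b c • (L.A a * L.A b * L.eps c) := by
      simp only [D1_QNabla_b, map_sub, map_neg, map_sum, pull_fsmul, map_mul, pull_ca,
        pull_cbNabla, mul_sub, mul_neg, Finset.mul_sum, mul_smul_comm, hA, hB,
        Finset.sum_sub_distrib, Finset.sum_neg_distrib]
      rw [hc]
    have h' : ∑ ν, -L.psiNabla ν * L.pull (L.D2 ν (L.QNabla (.b μ)))
        = ∑ a, ∑ ν, L.nablaRho μ a ν • (L.psiNabla ν * L.A a) := by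
      simp only [D2_QNabla_b, map_neg, map_sum, pull_fsmul, pull_ca, neg_mul_neg,
        Finset.mul_sum, mul_smul_comm]
      exact Finset.sum_comm
    have hd : L.covDT (fun ν => -L.psiNabla ν) μ = -L.covDT L.psiNabla μ := by
      simp only [covDT, map_neg, mul_neg, smul_neg, Finset.sum_neg_distrib]
      abel
    simp only [nPhi, nB_eq, covD, ghost, ghostD, sumIdx, zero_mul, Finset.sum_const_zero, D, h, h',
      hd, trivPhi]
    module

theorem sgn_zero : sgn 0 = 1 := zpow_zero _

theorem sgn_one : sgn 1 = -1 := zpow_one _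

theorem two_sub_one : (2 : ℤ) - 1 = 1 := rfl

/-- Second derivatives of the quadratic part of Q^a give T, and those of Q_μ give the S̃-term and
two equal mixed terms. The factor ½ accounts for the double counting. -/
theorem nGhost_eq (α : Idx n r) : L.nGhost α = L.covD L.ghost₂ α - L.ghost₂D α
    - (1 / 2 : ℝ) • L.ghostDD α + L.trivGhost α := by
  cases α with
  | x μ =>
    simp only [nGhost, covD, ghost₂, ghost, map_zero, mul_zero, smul_zero, Finset.sum_const_zero,
      ghost₂D, ghostDD, sumIdx, zero_mul, D, D1_QNabla_x, D2_QNabla_x, D1_fsmul, D2_fsmul, D1_one,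
      D2_one, trivGhost, add_zero, sub_zero]
  | a c =>
    have h : ∑ i, ∑ j, L.Tup j i c • (L.eps i * L.eps j)
        = -∑ i, ∑ j, L.Tup i j c • (L.eps i * L.eps j) := by
      rw [← sum_antisymm fun b d => L.Tup_swap b d c, Finset.sum_comm]
    simp only [nGhost, nEps_eq, covD, covDE, ghost₂, ghost, map_zero, mul_zero, smul_zero,
      Finset.sum_const_zero, ghost₂D, ghostDD, sumIdx, zero_mul, D, D1_QNabla_a, D2_QNabla_a,
      map_smul, map_neg, D1_fsmul, D2_fsmul, D1_one, D2_one, D1_sum_ca, D2_sum_ca, pull_smul_one,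
      neg_mul, mul_neg, neg_neg, neg_zero, trivGhost, zero_add, add_zero, Idx.deg,
      mul_smul_comm, mul_one, ← Finset.smul_sum, h]
    simp only [sub_self, mul_zero, sgn_zero, smul_neg, neg_neg]
    module
  | b μ =>
    have hA : ∀ i j c, L.eps i * L.eps j * L.A c = L.A c * L.eps i * L.eps j := fun i j c => by
      rw [mul_assoc, eps_A, ← mul_assoc, eps_A]
    have h : ∑ i, ∑ j, ∑ c, L.St μ j i c • (L.A c * L.eps i * L.eps j)
        = -∑ a, ∑ b, ∑ c, L.St μ a b c • (L.A a * L.eps b * L.eps c) := by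
      rw [← sum_cycle fun i j c => L.St μ j i c • (L.A c * L.eps i * L.eps j)]
      simp only [← Finset.sum_neg_distrib]
      exact Finset.sum_congr rfl fun a _ => Finset.sum_congr rfl fun b _ =>
        Finset.sum_congr rfl fun c _ => by rw [L.St_swap, ← L.St_cycle, neg_smul]
    have h₁ : ∑ i, ∑ j, L.eps i * L.eps j * L.pull (L.D1 i (L.D1 j (L.QNabla (.b μ))))
        = (2 : ℝ) • ∑ a, ∑ b, ∑ c, L.St μ a b c • (L.A a * L.eps b * L.eps c) := by
      simp only [D1_D1_QNabla_b, map_smul, map_sum, pull_fsmul, pull_ca, mul_smul_comm,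
        Finset.mul_sum, ← Finset.smul_sum, hA, h]
      module
    have h₂ : ∑ i, ∑ ν, L.eps i * -L.psiNabla ν * L.pull (L.D1 i (L.D2 ν (L.QNabla (.b μ))))
        = -∑ a, ∑ ν, L.nablaRho μ a ν • (L.psiNabla ν * L.eps a) := by
      have hp : ∀ i ν, L.eps i * -L.psiNabla ν = L.psiNabla ν * L.eps i := fun i ν => by
        rw [mul_neg, (L.eps_sign i).anticomm (L.psiNabla_sign ν) (by decide), neg_neg]
      simp only [D1_D2_QNabla_b, map_neg, pull_smul_one, hp, mul_neg, mul_smul_comm, mul_one,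
        Finset.sum_neg_distrib]
    have h₃ : ∑ ν, ∑ i, -L.psiNabla ν * L.eps i * L.pull (L.D2 ν (L.D1 i (L.QNabla (.b μ))))
        = ∑ a, ∑ ν, L.nablaRho μ a ν • (L.psiNabla ν * L.eps a) := by
      simp only [D2_D1_QNabla_b, map_neg, pull_smul_one, neg_mul, neg_neg, mul_neg, smul_neg,
        mul_smul_comm, mul_one]
      exact Finset.sum_comm
    have h₄ : ∑ ν, -L.tpsiNabla ν * L.pull (L.D2 ν (L.QNabla (.b μ)))
        = ∑ a, ∑ ν, L.nablaRho μ a ν • (L.tpsiNabla ν * L.A a) := by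
      simp only [D2_QNabla_b, map_neg, map_sum, pull_fsmul, pull_ca, neg_mul_neg,
        Finset.mul_sum, mul_smul_comm]
      exact Finset.sum_comm
    have hd : L.covDT (fun ν => -L.tpsiNabla ν) μ = -L.covDT L.tpsiNabla μ := by
      simp only [covDT, map_neg, mul_neg, smul_neg, Finset.sum_neg_distrib]
      abel
    simp only [nGhost, nPsi_eq, covD, ghost₂, ghost, zero_mul, mul_zero, smul_zero, map_zero,
      Finset.sum_const_zero, ghost₂D, ghostDD, sumIdx, D, D2_D2_QNabla_b, Idx.deg,
      Finset.sum_add_distrib, h₄, hd, zero_add, add_zero, trivGhost]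
    -- Among the surviving terms, only D_a moved past the ghost of b, of form degree 1, has Koszul
    -- sign -1. Without it the mixed terms `h₂` and `h₃` would cancel instead of adding.
    simp only [sub_self, mul_zero, mul_one, two_sub_one, sgn_zero, sgn_one, one_smul, neg_smul,
      Finset.sum_neg_distrib, h₁, h₂, h₃]
    module

/-- The only nonzero third derivative is the one along a three times, whose contraction is 2S̃εεε;
divided by 3! it yields the required third. -/
theorem nGhost₂_eq (α : Idx n r) :
    L.nGhost₂ α = L.ghost₂DD α + (1 / 6 : ℝ) • L.ghostDDD α := by
  cases α with
  | x μ =>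
    simp only [nGhost₂, ghost₂, ghost, map_zero, mul_zero, smul_zero, Finset.sum_const_zero,
      ghost₂DD, ghostDDD, sumIdx, zero_mul, D, D1_QNabla_x, D2_QNabla_x, D1_fsmul, D2_fsmul, D1_one,
      D2_one, add_zero]
  | a c =>
    simp only [nGhost₂, ghost₂, ghost, map_zero, mul_zero, smul_zero,
      Finset.sum_const_zero, ghost₂DD, ghostDDD, sumIdx, zero_mul, D, D1_QNabla_a, D2_QNabla_a,
      map_smul, map_neg, D1_fsmul, D2_fsmul, D1_one, D2_one, D1_sum_ca, D2_sum_ca,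
      neg_zero, add_zero]
  | b μ =>
    have h₁ : ∑ i, ∑ j, ∑ k, L.eps i * L.eps j * L.eps k
          * L.pull (L.D1 i (L.D1 j (L.D1 k (L.QNabla (.b μ)))))
        = (2 : ℝ) • ∑ a, ∑ b, ∑ c, L.St μ a b c • (L.eps a * L.eps b * L.eps c) := by
      have hS : ∑ i, ∑ j, ∑ k, L.St μ k j i • (L.eps i * L.eps j * L.eps k)
          = -∑ i, ∑ j, ∑ k, L.St μ i j k • (L.eps i * L.eps j * L.eps k) := by
        simp only [← Finset.sum_neg_distrib, ← neg_smul]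
        exact Finset.sum_congr rfl fun a _ => Finset.sum_congr rfl fun b _ =>
          Finset.sum_congr rfl fun c _ => by rw [L.St_swap, ← L.St_cycle]
      simp only [D1_D1_QNabla_b, map_smul, D1_sum_ca, pull_smul_one, mul_smul_comm, mul_one,
        ← Finset.smul_sum, hS]
      module
    have h₂ : ∑ ν, ∑ i, -L.tpsiNabla ν * L.eps i * L.pull (L.D2 ν (L.D1 i (L.QNabla (.b μ))))
        = ∑ a, ∑ ν, L.nablaRho μ a ν • (L.tpsiNabla ν * L.eps a) := by
      simp only [D2_D1_QNabla_b, map_neg, pull_smul_one, neg_mul, neg_neg, mul_neg, smul_neg,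
        mul_smul_comm, mul_one]
      exact Finset.sum_comm
    have h₃ : ∀ ν i j, L.D2 ν (L.D1 i (L.D1 j (L.QNabla (.b μ)))) = 0 := fun ν i j => by
      rw [D1_D1_QNabla_b, map_smul, D2_sum_ca, smul_zero]
    simp only [nGhost₂, nTpsi_eq, ghost₂DD, ghostDDD, sumIdx, ghost₂, ghost, zero_mul, mul_zero,
      smul_zero, Finset.sum_const_zero, D, D2_D2_QNabla_b, map_zero, h₃, zero_add, add_zero,
      Idx.deg]
    simp only [sub_self, mul_zero, add_zero, sgn_zero, one_smul, Finset.sum_add_distrib, h₁, h₂]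
    -- The mixed second derivatives are functions times 1, hence killed by any further derivative
    -- along a or b^∇.
    simp only [D1_D2_QNabla_b, D2_D1_QNabla_b, map_neg, D1_fsmul, D2_fsmul, D1_one, D2_one,
      smul_zero, neg_zero, map_zero, mul_zero, Finset.sum_const_zero, add_zero]
    module

/-! ### The trivial terms -/

/-- In a noncommutative ring `Ideal.span` is the left ideal; membership is immediate because every
monomial of the trivial terms has a factor F on the right. -/
theorem sum_mem_span_F {ι : Type*} [Fintype ι] {z : ι → FAlg 𝒞 n r}
    (h : ∀ i, z i ∈ Ideal.span (Set.range L.F)) : ∑ i, z i ∈ Ideal.span (Set.range L.F) :=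
  sum_mem fun i _ => h i

theorem mul_F_mem_span (z : FAlg 𝒞 n r) (ν : Fin n) :
    z * L.F ν ∈ Ideal.span (Set.range L.F) :=
  Ideal.mul_mem_left _ _ (Ideal.subset_span ⟨ν, rfl⟩)

theorem fsmul_mul_F_mem_span (f : 𝒞) (z : FAlg 𝒞 n r) (ν : Fin n) :
    f • (z * L.F ν) ∈ Ideal.span (Set.range L.F) :=
  Ideal.mul_mem_left _ (fn f) (L.mul_F_mem_span z ν)

theorem real_smul_mem_span (c : ℝ) {z : FAlg 𝒞 n r} (h : z ∈ Ideal.span (Set.range L.F)) :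
    c • z ∈ Ideal.span (Set.range L.F) := by
  rw [Algebra.smul_def]
  exact Ideal.mul_mem_left _ _ h

theorem trivPsi_mem (μ : Fin n) : L.trivPsi μ ∈ Ideal.span (Set.range L.F) :=
  L.real_smul_mem_span _ (L.sum_mem_span_F fun _ => L.sum_mem_span_F fun _ =>
    L.sum_mem_span_F fun _ => L.fsmul_mul_F_mem_span _ _ _)

theorem trivB_mem (μ : Fin n) : L.trivB μ ∈ Ideal.span (Set.range L.F) :=
  sub_mem (neg_mem (L.real_smul_mem_span _ (L.sum_mem_span_F fun _ => L.sum_mem_span_F fun _ =>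
    L.sum_mem_span_F fun _ => L.fsmul_mul_F_mem_span _ _ _)))
    (L.real_smul_mem_span _ (L.sum_mem_span_F fun _ => L.sum_mem_span_F fun _ =>
    L.sum_mem_span_F fun _ => L.fsmul_mul_F_mem_span _ _ _))

theorem trivPhi_mem : ∀ α : Idx n r, L.trivPhi α ∈ Ideal.span (Set.range L.F)
  | .x _ => zero_mem _
  | .a _ => zero_mem _
  | .b μ => L.trivB_mem μ

theorem trivGhost_mem : ∀ α : Idx n r, L.trivGhost α ∈ Ideal.span (Set.range L.F)
  | .x _ => zero_mem _
  | .a _ => zero_mem _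
  | .b μ => neg_mem (L.trivPsi_mem μ)

end LocalFrame

/-! ## Tensoriality of the torsion, the basic curvature and the curvature -/

theorem IsLinearMap_add {𝒞 : Type*} [CommRing 𝒞] {V : Type*} [AddCommGroup V]
    [Module 𝒞 V] {g g' : V → 𝒞}
    (h : IsLinearMap 𝒞 g) (h' : IsLinearMap 𝒞 g') : IsLinearMap 𝒞 fun x => g x + g' x where
  map_add x y := by rw [h.map_add, h'.map_add]; ring
  map_smul f x := by rw [h.map_smul, h'.map_smul, smul_add]

theorem IsLinearMap_mul {𝒞 : Type*} [CommRing 𝒞] {V : Type*} [AddCommGroup V]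
    [Module 𝒞 V] {g : V → 𝒞} (c : 𝒞)
    (h : IsLinearMap 𝒞 g) : IsLinearMap 𝒞 fun x => c * g x where
  map_add x y := by rw [h.map_add, mul_add]
  map_smul f x := by rw [h.map_smul, smul_eq_mul, smul_eq_mul]; ring

theorem IsLinearMap_sub {𝒞 : Type*} [CommRing 𝒞] {V : Type*} [AddCommGroup V]
    [Module 𝒞 V] {g g' : V → 𝒞}
    (h : IsLinearMap 𝒞 g) (h' : IsLinearMap 𝒞 g') : IsLinearMap 𝒞 fun x => g x - g' x where
  map_add x y := by rw [h.map_add, h'.map_add]; ring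
  map_smul f x := by rw [h.map_smul, h'.map_smul, smul_sub]

theorem IsLinearMap_comp {𝒞 : Type*} [CommRing 𝒞] {V W : Type*} [AddCommGroup V] [Module 𝒞 V] [AddCommGroup W]
    [Module 𝒞 W] {g : W → 𝒞} (h : IsLinearMap 𝒞 g) (k : V →ₗ[𝒞] W) :
    IsLinearMap 𝒞 fun x => g (k x) where
  map_add x y := by rw [map_add, h.map_add]
  map_smul f x := by rw [map_smul, h.map_smul]

section Geometry

variable {𝒞 : Type*} [CommRing 𝒞] [Algebra ℝ 𝒞] {𝓔 : Type*} [AddCommGroup 𝓔] [Module 𝒞 𝓔]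

theorem lie_smul_vec (f : 𝒞) (X Y : Vec 𝒞) : ⁅f • X, Y⁆ = f • ⁅X, Y⁆ - Y f • X := by
  ext g
  simp only [Derivation.commutator_apply, Derivation.smul_apply, Derivation.sub_apply,
    smul_eq_mul, vec_mul]
  ring

theorem lie_vec_smul (f : 𝒞) (X Y : Vec 𝒞) : ⁅X, f • Y⁆ = f • ⁅X, Y⁆ + X f • Y := by
  ext g
  simp only [Derivation.commutator_apply, Derivation.smul_apply, Derivation.add_apply,
    smul_eq_mul, vec_mul]
  ring

/-- Linearity of a 4-form in its first argument. -/
theorem form_lin₁ (H : Vec 𝒞 [⋀^Fin 4]→ₗ[𝒞] 𝒞) (Y Z W : Vec 𝒞) :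
    IsLinearMap 𝒞 fun X => H ![X, Y, Z, W] := by
  have h : ∀ X, ![X, Y, Z, W] = Function.update ![0, Y, Z, W] 0 X := fun X => by
    ext1 i; fin_cases i <;> rfl
  exact ⟨fun X X' => by rw [h (X + X'), h X, h X', AlternatingMap.map_update_add],
    fun f X => by rw [h (f • X), h X, AlternatingMap.map_update_smul]⟩

theorem form_lin₂ (H : Vec 𝒞 [⋀^Fin 4]→ₗ[𝒞] 𝒞) (X Z W : Vec 𝒞) :
    IsLinearMap 𝒞 fun Y => H ![X, Y, Z, W] := by
  have h : ∀ Y, ![X, Y, Z, W] = Function.update ![X, 0, Z, W] 1 Y := fun X => by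
    ext1 i; fin_cases i <;> rfl
  exact ⟨fun X X' => by rw [h (X + X'), h X, h X', AlternatingMap.map_update_add],
    fun f X => by rw [h (f • X), h X, AlternatingMap.map_update_smul]⟩

theorem form_lin₃ (H : Vec 𝒞 [⋀^Fin 4]→ₗ[𝒞] 𝒞) (X Y W : Vec 𝒞) :
    IsLinearMap 𝒞 fun Z => H ![X, Y, Z, W] := by
  have h : ∀ Z, ![X, Y, Z, W] = Function.update ![X, Y, 0, W] 2 Z := fun X => by
    ext1 i; fin_cases i <;> rfl
  exact ⟨fun X X' => by rw [h (X + X'), h X, h X', AlternatingMap.map_update_add],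
    fun f X => by rw [h (f • X), h X, AlternatingMap.map_update_smul]⟩

theorem form_lin₄ (H : Vec 𝒞 [⋀^Fin 4]→ₗ[𝒞] 𝒞) (X Y Z : Vec 𝒞) :
    IsLinearMap 𝒞 fun W => H ![X, Y, Z, W] := by
  have h : ∀ W, ![X, Y, Z, W] = Function.update ![X, Y, Z, 0] 3 W := fun X => by
    ext1 i; fin_cases i <;> rfl
  exact ⟨fun X X' => by rw [h (X + X'), h X, h X', AlternatingMap.map_update_add],
    fun f X => by rw [h (f • X), h X, AlternatingMap.map_update_smul]⟩

/-! ### Linearity over functions, slot by slot. -/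

namespace Target

variable (K : Target 𝒞 𝓔)

/-- The anomaly of -∇_{e₂}(f e) cancels the first anomaly of the Courant bracket, and that of the
half-weighted term cancels the second. -/
theorem torsion_lin₁ (e₂ e₃ : 𝓔) : IsLinearMap 𝒞 fun e => K.torsion e e₂ e₃ where
  map_add e e' := by
    simp only [torsion, eCon, map_add, map_sub, K.conE.add_vec, K.conE.add_sec,
      K.courant_add_left, LinearMap.add_apply, LinearMap.sub_apply]
    ring
  map_smul f e := by
    simp only [torsion, eCon, map_add, map_sub, K.anchor.map_smul, K.pairing.map_smul,
      K.conE.smul_vec, K.conE.leibniz, K.pairing_courant_smul_left, LinearMap.add_apply,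
      LinearMap.sub_apply, LinearMap.smul_apply, map_smul, smul_eq_mul]
    ring

theorem torsion_lin₂ (e₁ e₃ : 𝓔) : IsLinearMap 𝒞 fun e => K.torsion e₁ e e₃ := by
  have h := K.torsion_lin₁ e₁ e₃
  refine ⟨fun e e' => ?_, fun f e => ?_⟩
  · rw [K.torsion_swap, K.torsion_swap e₁ e, K.torsion_swap e₁ e', h.map_add, neg_add]
  · rw [K.torsion_swap, K.torsion_swap e₁ e, h.map_smul, smul_neg]

theorem torsion_lin₃ (e₁ e₂ : 𝓔) : IsLinearMap 𝒞 fun e => K.torsion e₁ e₂ e where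
  map_add e e' := by
    simp only [torsion, eCon, map_add, K.conE.add_vec, LinearMap.add_apply]
    ring
  map_smul f e := by
    simp only [torsion, eCon, map_smul, K.conE.smul_vec, LinearMap.smul_apply, smul_eq_mul]
    ring

/-- The Leibniz term X(f)ρ(e) cancels the opposite term of the Lie bracket. -/
theorem eConT_lin (X : Vec 𝒞) : IsLinearMap 𝒞 fun e => K.eConT e X where
  map_add e e' := by
    simp only [eConT, K.conE.add_sec, map_add, add_lie]
    abel
  map_smul f e := by
    simp only [eConT, K.conE.leibniz, map_add, map_smul, lie_smul_vec, smul_add]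
    abel

theorem eConT_add (e : 𝓔) (X Y : Vec 𝒞) : K.eConT e (X + Y) = K.eConT e X + K.eConT e Y := by
  simp only [eConT, K.conE.add_vec, map_add, lie_add]
  abel

theorem eConT_smul (f : 𝒞) (e : 𝓔) (X : Vec 𝒞) :
    K.eConT e (f • X) = f • K.eConT e X + K.anchor e f • X := by
  simp only [eConT, K.conE.smul_vec, map_smul, lie_vec_smul, smul_add]
  abel

theorem eConT_smul_left (f : 𝒞) (e : 𝓔) (X : Vec 𝒞) : K.eConT (f • e) X = f • K.eConT e X :=
  (K.eConT_lin X).map_smul f e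

theorem eConT_add_left (e e' : 𝓔) (X : Vec 𝒞) :
    K.eConT (e + e') X = K.eConT e X + K.eConT e' X := (K.eConT_lin X).map_add e e'

theorem basicCurv_swap (X : Vec 𝒞) (e₁ e₂ e₃ : 𝓔) :
    K.basicCurv X e₁ e₂ e₃ = -K.basicCurv X e₂ e₁ e₃ := by
  have h : K.conE.nabla X (-K.courant e₂ e₁) = -K.conE.nabla X (K.courant e₂ e₁) :=
    map_neg (K.conE.inSec X) _
  simp only [basicCurv, K.courant_swap e₁ e₂, K.courant_swap e₁ (K.conE.nabla X e₂),
    K.courant_swap (K.conE.nabla X e₁) e₂, h, map_sub, map_add, map_neg, LinearMap.sub_apply,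
    LinearMap.add_apply, LinearMap.neg_apply]
  ring

/-- Differentiating the anomalies of the bracket of f e produces second derivatives of f. They are
matched by ∇̄X acting on f, which appears when the covariant derivative along ∇̄X meets f e. -/
theorem basicCurv_lin₁ (X : Vec 𝒞) (e₂ e₃ : 𝓔) :
    IsLinearMap 𝒞 fun e => K.basicCurv X e e₂ e₃ where
  map_add e e' := by
    simp only [basicCurv, map_add, map_sub, K.conE.add_vec, K.conE.add_sec, K.courant_add_left,
      K.eConT_add_left, LinearMap.add_apply, LinearMap.sub_apply]
    ring
  map_smul f e := by
    have h₁ := K.metric X (K.courant (f • e) e₂) e₃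
    have h₂ := K.metric X (K.courant e e₂) e₃
    have h₃ := K.metric X e e₃
    have h₄ := K.metric X e e₂
    simp only [K.pairing_courant_smul_left, map_add, map_sub, vec_mul,
      vec_half, zero_mul] at h₁
    simp only [basicCurv, map_add, map_sub, K.conE.leibniz, K.courant_add_left,
      K.eConT_smul_left, K.conE.smul_vec, K.pairing.map_smul, map_smul, LinearMap.smul_apply,
      smul_eq_mul, LinearMap.add_apply, LinearMap.sub_apply, K.pairing_courant_smul_left]
    have h₅ : K.eConT e₂ X f
        = K.anchor (K.conE.nabla X e₂) f + (K.anchor e₂ (X f) - X (K.anchor e₂ f)) := rfl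
    have h₆ : K.eConT e₃ X f
        = K.anchor (K.conE.nabla X e₃) f + (K.anchor e₃ (X f) - X (K.anchor e₃ f)) := rfl
    rw [h₅, h₆]
    -- `h₁` and `h₂` eliminate ∇ of a bracket, with and without f; `h₃` and `h₄` eliminate the
    -- derivatives of pairings multiplying the two anomalies.
    linear_combination -h₁ + f * h₂ - K.anchor e₂ f * h₃ + half 𝒞 * K.anchor e₃ f * h₄

theorem basicCurv_lin₂ (X : Vec 𝒞) (e₁ e₃ : 𝓔) :
    IsLinearMap 𝒞 fun e => K.basicCurv X e₁ e e₃ := by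
  have h := K.basicCurv_lin₁ X e₁ e₃
  refine ⟨fun e e' => ?_, fun f e => ?_⟩
  · rw [K.basicCurv_swap, K.basicCurv_swap X e₁ e, K.basicCurv_swap X e₁ e', h.map_add, neg_add]
  · rw [K.basicCurv_swap, K.basicCurv_swap X e₁ e, h.map_smul, smul_neg]

theorem basicCurv_lin₃ (X : Vec 𝒞) (e₁ e₂ : 𝓔) :
    IsLinearMap 𝒞 fun e => K.basicCurv X e₁ e₂ e where
  map_add e e' := by
    simp only [basicCurv, map_add, K.conE.add_vec, K.eConT_add_left, LinearMap.add_apply]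
    ring
  map_smul f e := by
    simp only [basicCurv, map_smul, K.conE.smul_vec, K.eConT_smul_left, LinearMap.smul_apply,
      smul_eq_mul]
    ring

/-- The extra term ρ(e)(f)X in ∇̄(f X) cancels the bracket anomalies caused by ∇_{fX} e = f ∇_X e.
-/
theorem basicCurv_lin₀ (e₁ e₂ e₃ : 𝓔) : IsLinearMap 𝒞 fun X => K.basicCurv X e₁ e₂ e₃ where
  map_add X Y := by
    simp only [basicCurv, map_add, map_sub, K.conE.add_vec, K.courant_add_left,
      K.courant_add_right, K.eConT_add, LinearMap.add_apply, LinearMap.sub_apply]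
    ring
  map_smul f X := by
    simp only [basicCurv, map_add, map_sub, K.conE.add_vec, K.conE.smul_vec,
      K.courant_swap e₁ (_ • _), K.courant_swap e₁ (K.conE.nabla X e₂), K.eConT_smul,
      K.pairing.map_smul, K.pairing.map_neg, LinearMap.smul_apply, smul_eq_mul,
      LinearMap.add_apply, LinearMap.sub_apply, LinearMap.neg_apply, K.pairing_courant_smul_left]
    ring

theorem twistedBasicCurv_lin₀ (e₁ e₂ e₃ : 𝓔) :
    IsLinearMap 𝒞 fun X => K.twistedBasicCurv X e₁ e₂ e₃ :=
  IsLinearMap_add (K.basicCurv_lin₀ e₁ e₂ e₃) (IsLinearMap_mul _ (form_lin₁ K.H _ _ _))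

theorem twistedBasicCurv_lin₁ (X : Vec 𝒞) (e₂ e₃ : 𝓔) :
    IsLinearMap 𝒞 fun e => K.twistedBasicCurv X e e₂ e₃ :=
  IsLinearMap_add (K.basicCurv_lin₁ X e₂ e₃)
    (IsLinearMap_mul _ (IsLinearMap_comp (form_lin₂ K.H X _ _) K.anchor))

theorem twistedBasicCurv_lin₂ (X : Vec 𝒞) (e₁ e₃ : 𝓔) :
    IsLinearMap 𝒞 fun e => K.twistedBasicCurv X e₁ e e₃ :=
  IsLinearMap_add (K.basicCurv_lin₂ X e₁ e₃)
    (IsLinearMap_mul _ (IsLinearMap_comp (form_lin₃ K.H X _ _) K.anchor))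

theorem twistedBasicCurv_lin₃ (X : Vec 𝒞) (e₁ e₂ : 𝓔) :
    IsLinearMap 𝒞 fun e => K.twistedBasicCurv X e₁ e₂ e :=
  IsLinearMap_add (K.basicCurv_lin₃ X e₁ e₂)
    (IsLinearMap_mul _ (IsLinearMap_comp (form_lin₄ K.H X _ _) K.anchor))

theorem nablaAnchor_lin₀ (e : 𝓔) : IsLinearMap 𝒞 fun X => K.nablaAnchor X e where
  map_add X Y := by
    simp only [nablaAnchor, K.conT.add_vec, K.conE.add_vec, map_add]
    abel
  map_smul f X := by
    simp only [nablaAnchor, K.conT.smul_vec, K.conE.smul_vec, map_smul, smul_sub]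

theorem nablaAnchor_lin₁ (X : Vec 𝒞) : IsLinearMap 𝒞 fun e => K.nablaAnchor X e where
  map_add e e' := by
    simp only [nablaAnchor, K.conT.add_sec, K.conE.add_sec, map_add]
    abel
  map_smul f e := by
    simp only [nablaAnchor, K.conT.leibniz, K.conE.leibniz, map_add, map_smul, smul_sub]
    abel

theorem curv_swap (X Y : Vec 𝒞) (e : 𝓔) : K.curv X Y e = -K.curv Y X e := by
  have h : K.conE.nabla ⁅X, Y⁆ e = -K.conE.nabla ⁅Y, X⁆ e := by
    rw [← lie_skew]; exact map_neg (K.conE.inVec e) _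
  simp only [curv, h]
  abel

theorem curv_lin₁ (Y : Vec 𝒞) (e : 𝓔) : IsLinearMap 𝒞 fun X => K.curv X Y e where
  map_add X X' := by
    simp only [curv, add_lie, K.conE.add_vec, K.conE.add_sec]
    abel
  map_smul f X := by
    simp only [curv, lie_smul_vec, K.conE.sub_vec, K.conE.smul_vec, K.conE.leibniz, smul_sub]
    abel

theorem curv_lin₂ (X : Vec 𝒞) (e : 𝓔) : IsLinearMap 𝒞 fun Y => K.curv X Y e := by
  have h := K.curv_lin₁ X e
  refine ⟨fun Y Y' => ?_, fun f Y => ?_⟩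
  · rw [K.curv_swap, K.curv_swap X Y, K.curv_swap X Y', h.map_add, neg_add]
  · rw [K.curv_swap, K.curv_swap X Y, h.map_smul, smul_neg]

theorem curv_lin₃ (X Y : Vec 𝒞) : IsLinearMap 𝒞 fun e => K.curv X Y e where
  map_add e e' := by
    simp only [curv, K.conE.add_sec]
    abel
  map_smul f e := by
    simp only [curv, K.conE.leibniz, K.conE.add_sec, Derivation.commutator_apply, smul_sub,
      sub_smul]
    abel

end Target

end Geometry

namespace LocalFrame

variable {𝒞 : Type*} [CommRing 𝒞] [Algebra ℝ 𝒞] {𝓔 : Type*} [AddCommGroup 𝓔] [Module 𝒞 𝓔]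
  {K : Target 𝒞 𝓔} {n r : ℕ} (L L' : LocalFrame K n r)

/-! ## Change of frame and coordinates -/

theorem dX_eq (μ : Fin n) : L.dX μ = L.d (fn (L.x μ)) := by
  simp only [d_fn, pd_x, ite_smul, one_smul, zero_smul, Finset.sum_ite_eq', Finset.mem_univ,
    if_true]

theorem d_fsmul (f : 𝒞) (z : FAlg 𝒞 n r) : L.d (f • z) = L.d (fn f) * z + f • L.d z := by
  rw [fsmul_def, d_mul, signAut_fn, ← fsmul_def]

/-- Chain rule: the differential of f does not depend on the coordinates in which it is expanded. -/
theorem d_eq_sum (D : Fin n → FAlg 𝒞 n r) (f : 𝒞) (h : ∀ μ, D μ = L'.d (fn (L.x μ))) :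
    ∑ μ, L.pd μ f • D μ = L'.d (fn f) := by
  simp only [h, d_fn, Finset.smul_sum, smul_smul]
  rw [Finset.sum_comm]
  refine Finset.sum_congr rfl fun ν _ => ?_
  rw [← Finset.sum_smul, L.expand (L'.pd ν) f]
  exact congrArg (· • _) (Finset.sum_congr rfl fun μ _ => mul_comm _ _)

theorem dX_anticomm (μ ν : Fin n) : L.dX μ * L.dX ν = -(L.dX ν * L.dX μ) :=
  (L.dX_sign μ).anticomm (L.dX_sign ν) (by decide)

theorem d_d_fn (f : 𝒞) : L.d (L.d (fn f)) = 0 := by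
  have h : L.d (L.d (fn f)) = ∑ μ, ∑ ν, L.pd ν (L.pd μ f) • (L.dX ν * L.dX μ) := by
    rw [d_fn, map_sum]
    refine Finset.sum_congr rfl fun μ _ => ?_
    rw [d_fsmul, d_fn, Finset.sum_mul]
    have h₀ : L.d (L.dX μ) = 0 := L.d_gen (.dX μ)
    rw [h₀, smul_zero, add_zero]
    exact Finset.sum_congr rfl fun ν _ => smul_mul_assoc _ _ _
  -- Symmetric second derivatives contracted with anticommuting differentials: the sum equals its
  -- own negative.
  have h' : L.d (L.d (fn f)) = -L.d (L.d (fn f)) := by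
    conv_lhs => rw [h, Finset.sum_comm]
    rw [h]
    simp only [← Finset.sum_neg_distrib, ← smul_neg, ← dX_anticomm]
    exact Finset.sum_congr rfl fun μ _ => Finset.sum_congr rfl fun ν _ => by rw [pd_comm]
  have h₂ : (2 : ℝ) • L.d (L.d (fn f)) = 0 := by
    rw [two_smul]
    nth_rewrite 1 [h']
    exact neg_add_cancel _
  linear_combination (norm := module) (1 / 2 : ℝ) • h₂

theorem d_d (z : FAlg 𝒞 n r) : L.d (L.d z) = 0 := by
  induction z using gAlg_induction with
  | hf f => exact L.d_d_fn f
  | hg x => rw [d_gen, d_d_gen]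
  | hadd z w hz hw => rw [map_add, map_add, hz, hw, add_zero]
  | hmul z w hz hw =>
    have h : signAut (1, 0) (L.d z) = -L.d (signAut (1, 0) z) := by
      refine (L.dData.signAut_der (1, 0) z).trans ?_
      rw [show pair (1, 0) (1, 0) = 1 from rfl, sgn, zpow_one, neg_one_smul]
      rfl
    rw [d_mul, map_add, d_mul, d_mul, hz, hw, h, zero_mul, mul_zero, zero_add, add_zero, neg_mul,
      neg_add_cancel]

/-- The images of the generators under the change of frame. -/
def frameGen : FGen n r → FAlg 𝒞 n r
  | .dX μ => L'.d (fn (L.x μ))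
  | .A a => ∑ a', L.lamInv L' a' a • L'.A a'
  | .dA a => L'.d (∑ a', L.lamInv L' a' a • L'.A a')
  | .B μ => ∑ μ', L.jac L' μ μ' • L'.B μ'
      + (1 / 2 : ℝ) • ∑ a, ∑ b, L.inhom L' μ a b • (L'.A a * L'.A b)
  | .dB μ => L'.d (∑ μ', L.jac L' μ μ' • L'.B μ'
      + (1 / 2 : ℝ) • ∑ a, ∑ b, L.inhom L' μ a b • (L'.A a * L'.A b))
  | .eps a => ∑ a', L.lamInv L' a' a • L'.eps a'
  | .deps a => L'.d (∑ a', L.lamInv L' a' a • L'.eps a')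
  | .psi μ => ∑ μ', L.jac L' μ μ' • L'.psi μ' + ∑ a, ∑ b, L.inhom L' μ a b • (L'.A a * L'.eps b)
  | .dpsi μ => L'.d (∑ μ', L.jac L' μ μ' • L'.psi μ'
      + ∑ a, ∑ b, L.inhom L' μ a b • (L'.A a * L'.eps b))
  | .tpsi μ => ∑ μ', L.jac L' μ μ' • L'.tpsi μ'
      + (1 / 2 : ℝ) • ∑ a, ∑ b, L.inhom L' μ a b • (L'.eps a * L'.eps b)
  | .dtpsi μ => L'.d (∑ μ', L.jac L' μ μ' • L'.tpsi μ'
      + (1 / 2 : ℝ) • ∑ a, ∑ b, L.inhom L' μ a b • (L'.eps a * L'.eps b))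

theorem frameGen_sign : ∀ x : FGen n r, HasSign (L.frameGen L' x) x.deg := by
  have hA : ∀ a, HasSign (∑ a', L.lamInv L' a' a • L'.A a') (1, 0) := fun a =>
    HasSign.sum fun a' => (L'.A_sign a').fsmul _
  have he : ∀ a, HasSign (∑ a', L.lamInv L' a' a • L'.eps a') (0, 1) := fun a =>
    HasSign.sum fun a' => (L'.eps_sign a').fsmul _
  have hB : ∀ μ, HasSign (∑ μ', L.jac L' μ μ' • L'.B μ'
      + (1 / 2 : ℝ) • ∑ a, ∑ b, L.inhom L' μ a b • (L'.A a * L'.A b)) (2, 0) := fun μ =>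
    (HasSign.sum fun μ' => (L'.B_sign μ').fsmul _).add (HasSign.smul _ (HasSign.sum fun a =>
      HasSign.sum fun b => ((L'.A_sign a).mul (L'.A_sign b) rfl).fsmul _))
  have hp : ∀ μ, HasSign (∑ μ', L.jac L' μ μ' • L'.psi μ'
      + ∑ a, ∑ b, L.inhom L' μ a b • (L'.A a * L'.eps b)) (1, 1) := fun μ =>
    (HasSign.sum fun μ' => (L'.psi_sign μ').fsmul _).add (HasSign.sum fun a =>
      HasSign.sum fun b => ((L'.A_sign a).mul (L'.eps_sign b) rfl).fsmul _)
  have ht : ∀ μ, HasSign (∑ μ', L.jac L' μ μ' • L'.tpsi μ'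
      + (1 / 2 : ℝ) • ∑ a, ∑ b, L.inhom L' μ a b • (L'.eps a * L'.eps b)) (0, 2) := fun μ =>
    (HasSign.sum fun μ' => (L'.tpsi_sign μ').fsmul _).add (HasSign.smul _ (HasSign.sum fun a =>
      HasSign.sum fun b => ((L'.eps_sign a).mul (L'.eps_sign b) rfl).fsmul _))
  intro x
  match x with
  | .dX μ => exact L'.d_sign (HasSign.fn _) rfl
  | .A a => exact hA a
  | .dA a => exact L'.d_sign (hA a) rfl
  | .B μ => exact hB μ
  | .dB μ => exact L'.d_sign (hB μ) rfl
  | .eps a => exact he a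
  | .deps a => exact L'.d_sign (he a) rfl
  | .psi μ => exact hp μ
  | .dpsi μ => exact L'.d_sign (hp μ) rfl
  | .tpsi μ => exact ht μ
  | .dtpsi μ => exact L'.d_sign (ht μ) rfl

/-- The change of frame. -/
def frameChange : FAlg 𝒞 n r →ₐ[ℝ] FAlg 𝒞 n r :=
  lift fn (L.frameGen L') (fun f _ => fn_mul_comm f _)
    fun x y => (L.frameGen_sign L' x).swap (L.frameGen_sign L' y)

theorem frameChange_fn (f : 𝒞) : L.frameChange L' (fn f) = fn f := lift_fn ..

theorem frameChange_gen (x : FGen n r) : L.frameChange L' (gen x) = L.frameGen L' x := lift_gen ..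

theorem frameChange_signAut (p : ℤ × ℤ) (z : FAlg 𝒞 n r) :
    L.frameChange L' (signAut p z) = signAut p (L.frameChange L' z) := by
  induction z using gAlg_induction with
  | hf f => rw [signAut_fn, frameChange_fn, signAut_fn]
  | hg x => rw [signAut_gen, map_smul, frameChange_gen, (L.frameGen_sign L' x).2.2]
  | hadd z w hz hw => simp only [map_add, hz, hw]
  | hmul z w hz hw => simp only [map_mul, hz, hw]

/-- On a basic field the image of its differential was defined to make this hold; on a generator
that is already a differential it is d² = 0. -/
theorem frameChange_d (z : FAlg 𝒞 n r) :
    L.frameChange L' (L.d z) = L'.d (L.frameChange L' z) := by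
  induction z using gAlg_induction with
  | hf f =>
    rw [d_fn, map_sum, frameChange_fn, ← L.d_eq_sum L' _ f fun μ => rfl]
    exact Finset.sum_congr rfl fun μ _ => by
      rw [map_fsmul (L.frameChange_fn L'), dX, frameChange_gen, frameGen]
  | hg x =>
    rw [d_gen, frameChange_gen]
    cases x with
    | dX μ => exact (map_zero _).trans (L'.d_d _).symm
    | A a => exact L.frameChange_gen L' (.dA a)
    | dA a => exact (map_zero _).trans (L'.d_d _).symm
    | B a => exact L.frameChange_gen L' (.dB a)
    | dB a => exact (map_zero _).trans (L'.d_d _).symm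
    | eps a => exact L.frameChange_gen L' (.deps a)
    | deps a => exact (map_zero _).trans (L'.d_d _).symm
    | psi a => exact L.frameChange_gen L' (.dpsi a)
    | dpsi a => exact (map_zero _).trans (L'.d_d _).symm
    | tpsi a => exact L.frameChange_gen L' (.dtpsi a)
    | dtpsi a => exact (map_zero _).trans (L'.d_d _).symm
  | hadd z w hz hw => simp only [map_add, hz, hw]
  | hmul z w hz hw => simp only [d_mul, map_add, map_mul, hz, hw, frameChange_signAut]

theorem isFrameChange_frameChange : L.IsFrameChange L' (L.frameChange L') where
  map_fn := L.frameChange_fn L'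
  map_d := L.frameChange_d L'
  map_A a := L.frameChange_gen L' (.A a)
  map_eps a := L.frameChange_gen L' (.eps a)
  map_B μ := L.frameChange_gen L' (.B μ)
  map_psi μ := L.frameChange_gen L' (.psi μ)
  map_tpsi μ := L.frameChange_gen L' (.tpsi μ)

/-- Uniqueness uses that every remaining generator is a differential, dX^μ being that of the
coordinate function. -/
theorem existsUnique_isFrameChange : ∃! Φ, L.IsFrameChange L' Φ := by
  refine ⟨L.frameChange L', L.isFrameChange_frameChange L', fun Φ h => ?_⟩
  have h' := L.isFrameChange_frameChange L'
  refine algHom_ext (fun f => (h.map_fn f).trans (h'.map_fn f).symm) fun x => ?_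
  have hd : ∀ z, Φ z = L.frameChange L' z → Φ (L.d z) = L.frameChange L' (L.d z) := fun z hz => by
    rw [h.map_d, h'.map_d, hz]
  have hA : ∀ a, Φ (L.A a) = L.frameChange L' (L.A a) := fun a => by rw [h.map_A, h'.map_A]
  have he : ∀ a, Φ (L.eps a) = L.frameChange L' (L.eps a) := fun a => by
    rw [h.map_eps, h'.map_eps]
  have hB : ∀ a, Φ (L.B a) = L.frameChange L' (L.B a) := fun a => by rw [h.map_B, h'.map_B]
  have hp : ∀ a, Φ (L.psi a) = L.frameChange L' (L.psi a) := fun a => by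
    rw [h.map_psi, h'.map_psi]
  have ht : ∀ a, Φ (L.tpsi a) = L.frameChange L' (L.tpsi a) := fun a => by
    rw [h.map_tpsi, h'.map_tpsi]
  match x with
  | .dX μ =>
    have h₀ := hd (fn (L.x μ)) ((h.map_fn _).trans (h'.map_fn _).symm)
    rwa [← dX_eq] at h₀
  | .A a => exact hA a
  | .dA a => exact (congrArg Φ (L.d_gen (.A a)).symm).trans ((hd _ (hA a)).trans
      (congrArg _ (L.d_gen (.A a))))
  | .B μ => exact hB μ
  | .dB μ => exact (congrArg Φ (L.d_gen (.B μ)).symm).trans ((hd _ (hB μ)).trans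
      (congrArg _ (L.d_gen (.B μ))))
  | .eps a => exact he a
  | .deps a => exact (congrArg Φ (L.d_gen (.eps a)).symm).trans ((hd _ (he a)).trans
      (congrArg _ (L.d_gen (.eps a))))
  | .psi μ => exact hp μ
  | .dpsi μ => exact (congrArg Φ (L.d_gen (.psi μ)).symm).trans ((hd _ (hp μ)).trans
      (congrArg _ (L.d_gen (.psi μ))))
  | .tpsi μ => exact ht μ
  | .dtpsi μ => exact (congrArg Φ (L.d_gen (.tpsi μ)).symm).trans ((hd _ (ht μ)).trans
      (congrArg _ (L.d_gen (.tpsi μ))))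

end LocalFrame

/-! ### Linear maps and finite sums. -/

section Linear

variable {R V W ι : Type*} [CommRing R] [AddCommGroup V] [Module R V] [AddCommGroup W] [Module R W]
  [Fintype ι]

theorem IsLinearMap_sum {g : ι → V → W} (h : ∀ i, IsLinearMap R (g i)) :
    IsLinearMap R fun x => ∑ i, g i x where
  map_add x y := by simp only [(h _).map_add, Finset.sum_add_distrib]
  map_smul f x := by simp only [(h _).map_smul, Finset.smul_sum]

theorem IsLinearMap_smul {g : V → R} (h : IsLinearMap R g) (w : W) :
    IsLinearMap R fun x => g x • w where
  map_add x y := by rw [h.map_add, add_smul]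
  map_smul f x := by rw [h.map_smul, smul_assoc]

theorem IsLinearMap_sum_smul {g : V → W} (h : IsLinearMap R g) (f : ι → R) (p : ι → V) :
    g (∑ i, f i • p i) = ∑ i, f i • g (p i) := by
  have h' := map_sum (IsLinearMap.mk' g h) (fun i => f i • p i) Finset.univ
  simpa only [IsLinearMap.mk'_apply, h.map_smul] using h'

end Linear

/-! ### Tensors with values in a graded algebra -/

section SameTensor

variable {𝒞 : Type*} [CommRing 𝒞] [Algebra ℝ 𝒞] {G : Type*} {deg : G → ℤ × ℤ}
  {𝒱 𝒱₁ 𝒱₂ : Type*} [AddCommGroup 𝒱] [Module 𝒞 𝒱] [AddCommGroup 𝒱₁] [Module 𝒞 𝒱₁]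
  [AddCommGroup 𝒱₂] [Module 𝒞 𝒱₂] {ι κ ι₁ κ₁ ι₂ κ₂ : Type*} [Fintype ι] [Fintype κ] [Fintype ι₁]
  [Fintype κ₁] [Fintype ι₂] [Fintype κ₂]

/-- The tensors `p i ⊗ u i` and `q k ⊗ v k` (summed over `i` and `k`) have the same contractions
with linear forms. -/
def SameTensor (p : ι → 𝒱) (u : ι → GAlg 𝒞 deg) (q : κ → 𝒱) (v : κ → GAlg 𝒞 deg) : Prop :=
  ∀ g : 𝒱 → 𝒞, IsLinearMap 𝒞 g → ∑ i, g (p i) • u i = ∑ k, g (q k) • v k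

namespace SameTensor

variable {p : ι → 𝒱} {u : ι → GAlg 𝒞 deg} {q : κ → 𝒱} {v : κ → GAlg 𝒞 deg}
  {p₁ : ι₁ → 𝒱₁} {u₁ : ι₁ → GAlg 𝒞 deg} {q₁ : κ₁ → 𝒱₁} {v₁ : κ₁ → GAlg 𝒞 deg}
  {p₂ : ι₂ → 𝒱₂} {u₂ : ι₂ → GAlg 𝒞 deg} {q₂ : κ₂ → 𝒱₂} {v₂ : κ₂ → GAlg 𝒞 deg}

/-- Frame members and components transform with the same matrix, one with it and the other with its
transpose. -/
theorem of_expand {m : κ → ι → 𝒞} (hq : ∀ k, q k = ∑ i, m k i • p i)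
    (hu : ∀ i, u i = ∑ k, m k i • v k) : SameTensor p u q v := fun g hg => by
  simp only [hq, hu, IsLinearMap_sum_smul hg, smul_eq_mul, Finset.smul_sum, Finset.sum_smul, smul_smul]
  rw [Finset.sum_comm]
  exact Finset.sum_congr rfl fun k _ => Finset.sum_congr rfl fun i _ => by rw [mul_comm]

theorem mul_left (h : SameTensor p u q v) (z : GAlg 𝒞 deg) :
    SameTensor p (fun i => z * u i) q (fun k => z * v k) := fun g hg => by
  simp only [← mul_smul_comm, ← Finset.mul_sum, h g hg]

theorem mul_right (h : SameTensor p u q v) (z : GAlg 𝒞 deg) :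
    SameTensor p (fun i => u i * z) q (fun k => v k * z) := fun g hg => by
  simp only [← smul_mul_assoc, ← Finset.sum_mul, h g hg]

/-- The slots are exchanged one at a time, the other factor being carried along as a fixed
multiplier; the order of the factors, and hence every sign, stays untouched. -/
theorem contract₂ (h : SameTensor p u q v) (h₁ : SameTensor p₁ u₁ q₁ v₁) {g : 𝒱 → 𝒱₁ → 𝒞}
    (hg : ∀ y, IsLinearMap 𝒞 fun x => g x y) (hg₁ : ∀ x, IsLinearMap 𝒞 fun y => g x y) :
    ∑ i, ∑ j, g (p i) (p₁ j) • (u i * u₁ j) = ∑ i, ∑ j, g (q i) (q₁ j) • (v i * v₁ j) := by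
  rw [Finset.sum_congr rfl fun i _ => (h₁.mul_left (u i)) _ (hg₁ (p i)), Finset.sum_comm,
    Finset.sum_congr rfl fun j _ => (h.mul_right (v₁ j)) _ (hg (q₁ j)), Finset.sum_comm]

theorem contract₃ (h : SameTensor p u q v) (h₁ : SameTensor p₁ u₁ q₁ v₁)
    (h₂ : SameTensor p₂ u₂ q₂ v₂) {g : 𝒱 → 𝒱₁ → 𝒱₂ → 𝒞}
    (hg : ∀ y z, IsLinearMap 𝒞 fun x => g x y z) (hg₁ : ∀ x z, IsLinearMap 𝒞 fun y => g x y z)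
    (hg₂ : ∀ x y, IsLinearMap 𝒞 fun z => g x y z) :
    ∑ i, ∑ j, ∑ k, g (p i) (p₁ j) (p₂ k) • (u i * u₁ j * u₂ k)
      = ∑ i, ∑ j, ∑ k, g (q i) (q₁ j) (q₂ k) • (v i * v₁ j * v₂ k) := by
  rw [Finset.sum_congr rfl fun i _ => Finset.sum_congr rfl fun j _ =>
    (h₂.mul_left (u i * u₁ j)) _ (hg₂ (p i) (p₁ j))]
  rw [← sum_cycle fun i j k => g (p i) (p₁ j) (q₂ k) • (u i * u₁ j * v₂ k),
    ← sum_cycle fun i j k => g (q i) (q₁ j) (q₂ k) • (v i * v₁ j * v₂ k)]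
  refine Finset.sum_congr rfl fun k _ => ?_
  have h' := h.contract₂ h₁ (g := fun x y => g x y (q₂ k)) (fun y => hg y _) fun x => hg₁ x _
  simpa only [Finset.sum_mul, smul_mul_assoc] using congrArg (· * v₂ k) h'

end SameTensor

/-- Covariant derivatives of a frame under a change of frame. -/
theorem Connection.sum_nabla_frame (N : Connection 𝒞 𝒱) {p : ι → 𝒱} {u : ι → GAlg 𝒞 deg}
    {q : κ → 𝒱} {v : κ → GAlg 𝒞 deg} {m : κ → ι → 𝒞} (hq : ∀ k, q k = ∑ i, m k i • p i)
    (hu : ∀ i, u i = ∑ k, m k i • v k) (X : Vec 𝒞) {g : 𝒱 → 𝒞} (hg : IsLinearMap 𝒞 g) :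
    ∑ i, g (N.nabla X (p i)) • u i
      = ∑ k, (g (N.nabla X (q k)) - ∑ i, X (m k i) * g (p i)) • v k := by
  have h : ∀ k, g (N.nabla X (q k)) - ∑ i, X (m k i) * g (p i)
      = ∑ i, m k i * g (N.nabla X (p i)) := fun k => by
    have h' := map_sum (IsLinearMap.mk' g hg) (fun i => N.nabla X (m k i • p i)) Finset.univ
    simp only [IsLinearMap.mk'_apply, N.leibniz, hg.map_add, hg.map_smul, smul_eq_mul,
      Finset.sum_add_distrib] at h'
    rw [hq k, N.sum_sec]
    simp only [N.leibniz, Finset.sum_add_distrib, hg.map_add]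
    rw [h', add_sub_cancel_right]
  simp only [h, hu, Finset.smul_sum, Finset.sum_smul, smul_smul]
  rw [Finset.sum_comm]
  exact Finset.sum_congr rfl fun k _ => Finset.sum_congr rfl fun i _ => by rw [mul_comm]

end SameTensor

namespace LocalFrame

variable {𝒞 : Type*} [CommRing 𝒞] [Algebra ℝ 𝒞] {𝓔 : Type*} [AddCommGroup 𝓔] [Module 𝒞 𝓔]
  {K : Target 𝒞 𝓔} {n r : ℕ} {L L' : LocalFrame K n r} {Φ : FAlg 𝒞 n r →ₐ[ℝ] FAlg 𝒞 n r}

/-- The differentials `dx^μ`. -/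
def dx (L : LocalFrame K n r) (μ : Fin n) : Vec 𝒞 →ₗ[𝒞] 𝒞 where
  toFun D := D (L.x μ)
  map_add' _ _ := rfl
  map_smul' _ _ := rfl

theorem e_expand (L L' : LocalFrame K n r) (a' : Fin r) :
    L'.e a' = ∑ a, L.lamInv L' a' a • L.e a := (L.e.sum_repr _).symm

theorem repr_change (L L' : LocalFrame K n r) (v : 𝓔) (a : Fin r) :
    L.e.repr v a = ∑ a', L.lamInv L' a' a * L'.e.repr v a' := by
  conv_lhs => rw [← L'.e.sum_repr v, map_sum, Finset.sum_apply']
  exact Finset.sum_congr rfl fun a' _ => by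
    rw [map_smul, Finsupp.smul_apply, smul_eq_mul, mul_comm, lamInv]

theorem pd_expand (L L' : LocalFrame K n r) (μ : Fin n) :
    L.pd μ = ∑ μ', L.jac L' μ μ' • L'.pd μ' := L'.vec_expand _

theorem dx_expand (L L' : LocalFrame K n r) (ν' : Fin n) :
    L'.dx ν' = ∑ ν, L.jac L' ν ν' • L.dx ν := by
  ext D
  rw [LinearMap.sum_apply]
  exact (L.expand D (L'.x ν')).trans (Finset.sum_congr rfl fun ν _ => mul_comm _ _)

theorem TensorialE.sameTensor {u u' : Fin r → FAlg 𝒞 n r} (h : L.TensorialE L' Φ u u') :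
    SameTensor L.e (fun a => Φ (u a)) L'.e u' := SameTensor.of_expand (L.e_expand L') h

theorem TensorialT.sameTensor {u u' : Fin n → FAlg 𝒞 n r} (h : L.TensorialT L' Φ u u') :
    SameTensor L.dx (fun a => Φ (u a)) L'.dx u' := SameTensor.of_expand (L.dx_expand L') h

/-! ### Closure properties of tensorial families -/

theorem TensorialT.add {u u' v v' : Fin n → FAlg 𝒞 n r} (h : L.TensorialT L' Φ u u')
    (h' : L.TensorialT L' Φ v v') :
    L.TensorialT L' Φ (fun μ => u μ + v μ) fun μ => u' μ + v' μ := fun μ => by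
  simp only [map_add, h μ, h' μ, smul_add, Finset.sum_add_distrib]

theorem TensorialT.smul {u u' : Fin n → FAlg 𝒞 n r} (h : L.TensorialT L' Φ u u') (c : ℝ) :
    L.TensorialT L' Φ (fun μ => c • u μ) fun μ => c • u' μ := fun μ => by
  simp only [map_smul, h μ, Finset.smul_sum, smul_comm c]

theorem TensorialT.neg {u u' : Fin n → FAlg 𝒞 n r} (h : L.TensorialT L' Φ u u') :
    L.TensorialT L' Φ (fun μ => -u μ) fun μ => -u' μ := fun μ => by
  simp only [map_neg, h μ, smul_neg, Finset.sum_neg_distrib]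

theorem TensorialT.sub {u u' v v' : Fin n → FAlg 𝒞 n r} (h : L.TensorialT L' Φ u u')
    (h' : L.TensorialT L' Φ v v') :
    L.TensorialT L' Φ (fun μ => u μ - v μ) fun μ => u' μ - v' μ := by
  simpa only [sub_eq_add_neg] using h.add h'.neg

theorem TensorialE.add {u u' v v' : Fin r → FAlg 𝒞 n r} (h : L.TensorialE L' Φ u u')
    (h' : L.TensorialE L' Φ v v') :
    L.TensorialE L' Φ (fun μ => u μ + v μ) fun μ => u' μ + v' μ := fun μ => by
  simp only [map_add, h μ, h' μ, smul_add, Finset.sum_add_distrib]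

theorem TensorialE.smul {u u' : Fin r → FAlg 𝒞 n r} (h : L.TensorialE L' Φ u u') (c : ℝ) :
    L.TensorialE L' Φ (fun μ => c • u μ) fun μ => c • u' μ := fun μ => by
  simp only [map_smul, h μ, Finset.smul_sum, smul_comm c]

theorem TensorialE.neg {u u' : Fin r → FAlg 𝒞 n r} (h : L.TensorialE L' Φ u u') :
    L.TensorialE L' Φ (fun μ => -u μ) fun μ => -u' μ := fun μ => by
  simp only [map_neg, h μ, smul_neg, Finset.sum_neg_distrib]

theorem TensorialE.sub {u u' v v' : Fin r → FAlg 𝒞 n r} (h : L.TensorialE L' Φ u u')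
    (h' : L.TensorialE L' Φ v v') :
    L.TensorialE L' Φ (fun μ => u μ - v μ) fun μ => u' μ - v' μ := by
  simpa only [sub_eq_add_neg] using h.add h'.neg

/-! ### Tensorial contractions -/

section Contraction

variable {𝒱 𝒱₁ 𝒱₂ : Type*} [AddCommGroup 𝒱] [Module 𝒞 𝒱] [AddCommGroup 𝒱₁] [Module 𝒞 𝒱₁]
  [AddCommGroup 𝒱₂] [Module 𝒞 𝒱₂] {ι κ ι₁ κ₁ ι₂ κ₂ : Type*} [Fintype ι] [Fintype κ] [Fintype ι₁]
  [Fintype κ₁] [Fintype ι₂] [Fintype κ₂]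
  {p : ι → 𝒱} {u : ι → FAlg 𝒞 n r} {q : κ → 𝒱} {v : κ → FAlg 𝒞 n r}
  {p₁ : ι₁ → 𝒱₁} {u₁ : ι₁ → FAlg 𝒞 n r} {q₁ : κ₁ → 𝒱₁} {v₁ : κ₁ → FAlg 𝒞 n r}
  {p₂ : ι₂ → 𝒱₂} {u₂ : ι₂ → FAlg 𝒞 n r} {q₂ : κ₂ → 𝒱₂} {v₂ : κ₂ → FAlg 𝒞 n r}

/-- The free lower index transforms because the whole expression is linear in the vector field
inserted there. -/
theorem sum_jac_smul (L L' : LocalFrame K n r) {N : Vec 𝒞 → FAlg 𝒞 n r}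
    (hN : IsLinearMap 𝒞 N) (μ : Fin n) :
    ∑ μ', L.jac L' μ μ' • N (L'.pd μ') = N (L.pd μ) := by
  rw [L.pd_expand L' μ, IsLinearMap_sum_smul hN]

theorem IsFrameChange.map_fsmul (H : L.IsFrameChange L' Φ) (f : 𝒞) (z : FAlg 𝒞 n r) :
    Φ (f • z) = f • Φ z := TCSM.map_fsmul H.map_fn f z

theorem IsFrameChange.tensorialT₂ (H : L.IsFrameChange L' Φ)
    (h : SameTensor p (fun i => Φ (u i)) q v) (h₁ : SameTensor p₁ (fun i => Φ (u₁ i)) q₁ v₁)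
    {G : Vec 𝒞 → 𝒱 → 𝒱₁ → 𝒞} (hG : ∀ x y, IsLinearMap 𝒞 fun X => G X x y)
    (hg : ∀ X y, IsLinearMap 𝒞 fun x => G X x y) (hg₁ : ∀ X x, IsLinearMap 𝒞 fun y => G X x y) :
    L.TensorialT L' Φ (fun μ => ∑ i, ∑ j, G (L.pd μ) (p i) (p₁ j) • (u i * u₁ j))
      fun μ => ∑ i, ∑ j, G (L'.pd μ) (q i) (q₁ j) • (v i * v₁ j) := fun μ => by
  rw [L.sum_jac_smul L' (N := fun X => ∑ i, ∑ j, G X (q i) (q₁ j) • (v i * v₁ j))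
    (IsLinearMap_sum fun _ => IsLinearMap_sum fun _ => IsLinearMap_smul (hG _ _) _),
    ← h.contract₂ h₁ (g := G (L.pd μ)) (fun _ => hg _ _) fun _ => hg₁ _ _]
  simp only [map_sum, H.map_fsmul, map_mul]

theorem IsFrameChange.tensorialT₃ (H : L.IsFrameChange L' Φ)
    (h : SameTensor p (fun i => Φ (u i)) q v) (h₁ : SameTensor p₁ (fun i => Φ (u₁ i)) q₁ v₁)
    (h₂ : SameTensor p₂ (fun i => Φ (u₂ i)) q₂ v₂)
    {G : Vec 𝒞 → 𝒱 → 𝒱₁ → 𝒱₂ → 𝒞} (hG : ∀ x y z, IsLinearMap 𝒞 fun X => G X x y z)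
    (hg : ∀ X y z, IsLinearMap 𝒞 fun x => G X x y z)
    (hg₁ : ∀ X x z, IsLinearMap 𝒞 fun y => G X x y z)
    (hg₂ : ∀ X x y, IsLinearMap 𝒞 fun z => G X x y z) :
    L.TensorialT L' Φ
      (fun μ => ∑ i, ∑ j, ∑ k, G (L.pd μ) (p i) (p₁ j) (p₂ k) • (u i * u₁ j * u₂ k))
      fun μ => ∑ i, ∑ j, ∑ k, G (L'.pd μ) (q i) (q₁ j) (q₂ k) • (v i * v₁ j * v₂ k) := fun μ => by
  rw [L.sum_jac_smul L'
    (N := fun X => ∑ i, ∑ j, ∑ k, G X (q i) (q₁ j) (q₂ k) • (v i * v₁ j * v₂ k))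
    (IsLinearMap_sum fun _ => IsLinearMap_sum fun _ => IsLinearMap_sum fun _ =>
      IsLinearMap_smul (hG _ _ _) _),
    ← h.contract₃ h₁ h₂ (g := G (L.pd μ)) (fun _ _ => hg _ _ _) (fun _ _ => hg₁ _ _ _) fun _ _ => hg₂ _ _ _]
  simp only [map_sum, H.map_fsmul, map_mul]

/-- By nondegeneracy g is twice the pairing with some section v, and raising the index yields the
components of v; these transform like those of any section. -/
theorem sum_etaInv_change (L L' : LocalFrame K n r) {g : 𝓔 → 𝒞} (hg : IsLinearMap 𝒞 g)
    (a : Fin r) : ∑ d, L.etaInv a d * g (L.e d)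
      = ∑ a', L.lamInv L' a' a * ∑ d, L'.etaInv a' d * g (L'.e d) := by
  obtain ⟨v, hv⟩ := K.nondeg.surjective (half 𝒞 • IsLinearMap.mk' g hg)
  have h : ∀ e, g e = 2 * K.pairing v e := fun e => by
    rw [hv, LinearMap.smul_apply, IsLinearMap.mk'_apply, smul_eq_mul, ← mul_assoc, two_mul_half,
      one_mul]
  simp only [h, ← repr_eq_sum_etaInv]
  exact L.repr_change L' v a

theorem IsFrameChange.tensorialE₁ (H : L.IsFrameChange L' Φ)
    (h : SameTensor p (fun i => Φ (u i)) q v) {G : 𝓔 → 𝒱 → 𝒞}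
    (hG : ∀ x, IsLinearMap 𝒞 fun e => G e x) (hg : ∀ e, IsLinearMap 𝒞 fun x => G e x) :
    L.TensorialE L' Φ (fun a => ∑ i, (∑ d, L.etaInv a d * G (L.e d) (p i)) • u i)
      fun a => ∑ i, (∑ d, L'.etaInv a d * G (L'.e d) (q i)) • v i := fun a => by
  have h' := h (fun x => ∑ d, L.etaInv a d * G (L.e d) x)
    (IsLinearMap_sum fun d => IsLinearMap_mul _ (hg _))
  simp only [map_sum, H.map_fsmul, Finset.smul_sum, smul_smul]
  rw [h', Finset.sum_comm]
  refine Finset.sum_congr rfl fun i _ => ?_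
  rw [← Finset.sum_smul, ← L.sum_etaInv_change L' (hG (q i))]

theorem IsFrameChange.tensorialE₂ (H : L.IsFrameChange L' Φ)
    (h : SameTensor p (fun i => Φ (u i)) q v) (h₁ : SameTensor p₁ (fun i => Φ (u₁ i)) q₁ v₁)
    {G : 𝓔 → 𝒱 → 𝒱₁ → 𝒞} (hG : ∀ x y, IsLinearMap 𝒞 fun e => G e x y)
    (hg : ∀ e y, IsLinearMap 𝒞 fun x => G e x y) (hg₁ : ∀ e x, IsLinearMap 𝒞 fun y => G e x y) :
    L.TensorialE L' Φ
      (fun a => ∑ i, ∑ j, (∑ d, L.etaInv a d * G (L.e d) (p i) (p₁ j)) • (u i * u₁ j))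
      fun a => ∑ i, ∑ j, (∑ d, L'.etaInv a d * G (L'.e d) (q i) (q₁ j)) • (v i * v₁ j) :=
  fun a => by
  have h' := h.contract₂ h₁ (g := fun x y => ∑ d, L.etaInv a d * G (L.e d) x y)
    (fun y => IsLinearMap_sum fun d => IsLinearMap_mul _ (hg _ _))
    (fun x => IsLinearMap_sum fun d => IsLinearMap_mul _ (hg₁ _ _))
  simp only [map_sum, H.map_fsmul, map_mul, Finset.smul_sum, smul_smul]
  rw [h', sum_cycle fun i j a' => (L.lamInv L' a' a
    * ∑ d, L'.etaInv a' d * G (L'.e d) (q i) (q₁ j)) • (v i * v₁ j)]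
  refine Finset.sum_congr rfl fun i _ => Finset.sum_congr rfl fun j _ => ?_
  rw [← Finset.sum_smul, ← L.sum_etaInv_change L' (hG (q i) (q₁ j))]

end Contraction

end LocalFrame

namespace LocalFrame

variable {𝒞 : Type*} [CommRing 𝒞] [Algebra ℝ 𝒞] {𝓔 : Type*} [AddCommGroup 𝓔] [Module 𝒞 𝓔]
  {K : Target 𝒞 𝓔} {n r : ℕ} {L L' : LocalFrame K n r} {Φ : FAlg 𝒞 n r →ₐ[ℝ] FAlg 𝒞 n r}

/-! ### Fields and their covariant redefinitions -/

theorem inhom_eq (L L' : LocalFrame K n r) (μ : Fin n) (a b : Fin r) : L.inhom L' μ a b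
    = ∑ c, L.pd μ (L.lamInv L' a c) * (2 * K.pairing (L.e c) (L'.e b)) := by
  simp only [inhom, mul_assoc, ← Finset.mul_sum, lam, sum_repr_eta]

theorem pairing_nabla_lin (X : Vec 𝒞) (e : 𝓔) :
    IsLinearMap 𝒞 fun e' => 2 * K.pairing (K.conE.nabla X e) e' :=
  IsLinearMap_mul _ (K.pairing _).isLinear

/-- The Leibniz rule applied to the changed frame produces an inhomogeneous term in ω, which is
precisely `inhom`. It is stated for two families so as to serve AA, Aε and εε alike. -/
theorem sum_omegaLow_change {u u' v v' : Fin r → FAlg 𝒞 n r} (hu : L.TensorialE L' Φ u u')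
    (hv : L.TensorialE L' Φ v v') (μ : Fin n) :
    ∑ a, ∑ b, L.omegaLow μ a b • (Φ (u a) * Φ (v b))
        + ∑ a, ∑ b, L.inhom L' μ a b • (u' a * v' b)
      = ∑ μ', L.jac L' μ μ' • ∑ a, ∑ b, L'.omegaLow μ' a b • (u' a * v' b) := by
  have h₁ : ∀ b', ∑ a, (2 * K.pairing (K.conE.nabla (L.pd μ) (L.e a)) (L'.e b')) • Φ (u a)
      = ∑ a', (2 * K.pairing (K.conE.nabla (L.pd μ) (L'.e a')) (L'.e b')
        - L.inhom L' μ a' b') • u' a' := fun b' => by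
    simp only [inhom_eq]
    exact K.conE.sum_nabla_frame (L.e_expand L') hu (L.pd μ)
      (IsLinearMap_mul 2 (K.pairing.flip (L'.e b')).isLinear)
  have h₂ : ∑ μ', L.jac L' μ μ' • ∑ a, ∑ b, L'.omegaLow μ' a b • (u' a * v' b)
      = ∑ a, ∑ b, (2 * K.pairing (K.conE.nabla (L.pd μ) (L'.e a)) (L'.e b)) • (u' a * v' b) := by
    simp only [omegaLow_eq]
    exact L.sum_jac_smul L' (N := fun X => ∑ a, ∑ b,
      (2 * K.pairing (K.conE.nabla X (L'.e a)) (L'.e b)) • (u' a * v' b))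
      (IsLinearMap_sum fun a => IsLinearMap_sum fun b => IsLinearMap_smul (IsLinearMap_mul 2
        (IsLinearMap_comp (K.pairing.flip (L'.e b)).isLinear (K.conE.inVec _))) _) μ
  have h₃ : ∑ a, ∑ b, L.omegaLow μ a b • (Φ (u a) * Φ (v b))
      = ∑ a, ∑ b, (2 * K.pairing (K.conE.nabla (L.pd μ) (L'.e a)) (L'.e b)
        - L.inhom L' μ a b) • (u' a * v' b) := by
    simp only [omegaLow_eq]
    rw [Finset.sum_congr rfl fun a _ => (hv.sameTensor.mul_left (Φ (u a))) _
      (pairing_nabla_lin (K := K) (L.pd μ) (L.e a)), Finset.sum_comm]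
    conv_rhs => rw [Finset.sum_comm]
    refine Finset.sum_congr rfl fun b _ => ?_
    simp only [← smul_mul_assoc, ← Finset.sum_mul, h₁ b]
  rw [h₂, h₃]
  simp only [← Finset.sum_add_distrib, ← add_smul, sub_add_cancel]

namespace IsFrameChange

theorem tensorial_A (H : L.IsFrameChange L' Φ) : L.TensorialE L' Φ L.A L'.A := H.map_A

theorem tensorial_eps (H : L.IsFrameChange L' Φ) : L.TensorialE L' Φ L.eps L'.eps := H.map_eps

theorem tensorial_BNabla (H : L.IsFrameChange L' Φ) :
    L.TensorialT L' Φ L.BNabla L'.BNabla := fun μ => by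
  have h := sum_omegaLow_change H.tensorial_A H.tensorial_A μ
  simp only [BNabla, map_add, map_smul, map_sum, H.map_fsmul, map_mul, H.map_B, smul_add,
    Finset.sum_add_distrib, ← smul_comm (1 / 2 : ℝ) (L.jac L' μ _),
    ← Finset.smul_sum (r := (1 / 2 : ℝ))]
  rw [← h]
  module

theorem tensorial_psiNabla (H : L.IsFrameChange L' Φ) :
    L.TensorialT L' Φ L.psiNabla L'.psiNabla := fun μ => by
  have h := sum_omegaLow_change H.tensorial_A H.tensorial_eps μ
  simp only [psiNabla, map_add, map_sum, H.map_fsmul, map_mul, H.map_psi, smul_add,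
    Finset.sum_add_distrib]
  rw [← h]
  abel

theorem tensorial_tpsiNabla (H : L.IsFrameChange L' Φ) :
    L.TensorialT L' Φ L.tpsiNabla L'.tpsiNabla := fun μ => by
  have h := sum_omegaLow_change H.tensorial_eps H.tensorial_eps μ
  simp only [tpsiNabla, map_add, map_smul, map_sum, H.map_fsmul, map_mul, H.map_tpsi, smul_add,
    Finset.sum_add_distrib, ← smul_comm (1 / 2 : ℝ) (L.jac L' μ _),
    ← Finset.smul_sum (r := (1 / 2 : ℝ))]
  rw [← h]
  module

/-! ### The equations of motion -/

theorem map_dX (H : L.IsFrameChange L' Φ) (μ : Fin n) : Φ (L.dX μ) = ∑ μ', L'.jac L μ' μ • L'.dX μ' := by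
  rw [dX_eq, H.map_d, H.map_fn, d_fn]
  rfl

/-- F is a one-form with values in the pulled-back tangent bundle. Its upper index brings in the
Jacobian of the inverse coordinate change. -/
theorem map_F (H : L.IsFrameChange L' Φ) (μ : Fin n) : Φ (L.F μ) = ∑ μ', L'.jac L μ' μ • L'.F μ' := by
  have h := H.tensorial_A.sameTensor (fun e => K.anchor e (L.x μ)) ((L.dx μ).comp K.anchor).isLinear
  simp only [F, map_sub, map_sum, H.map_fsmul, H.map_dX, smul_sub, Finset.sum_sub_distrib]
  refine congrArg _ (h.trans ?_)
  simp only [Finset.smul_sum, smul_smul]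
  rw [Finset.sum_comm]
  refine Finset.sum_congr rfl fun a _ => ?_
  rw [← Finset.sum_smul, L'.expand (K.anchor (L'.e a)) (L.x μ)]
  exact congrArg (· • _) (Finset.sum_congr rfl fun μ _ => mul_comm _ _)

theorem sameTensor_dX (H : L.IsFrameChange L' Φ) : SameTensor L.pd (fun μ => Φ (L.dX μ)) L'.pd L'.dX :=
  SameTensor.of_expand (L'.pd_expand L) H.map_dX

theorem sameTensor_F (H : L.IsFrameChange L' Φ) : SameTensor L.pd (fun μ => Φ (L.F μ)) L'.pd L'.F :=
  SameTensor.of_expand (L'.pd_expand L) H.map_F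

/-! ### Exterior covariant derivatives -/

/-- The inhomogeneous term of ω is minus the derivative of the change-of-frame matrix, and cancels
that derivative in the differential of the transformed components. -/
theorem tensorial_covDE (H : L.IsFrameChange L' Φ) {u u' : Fin r → FAlg 𝒞 n r}
    (hu : L.TensorialE L' Φ u u') :
    L.TensorialE L' Φ (L.covDE u) (L'.covDE u') := fun a => by
  have h₁ : ∀ X : Vec 𝒞, ∑ b, L.e.repr (K.conE.nabla X (L.e b)) a • Φ (u b)
      = ∑ b, (L.e.repr (K.conE.nabla X (L'.e b)) a - X (L.lamInv L' b a)) • u' b := fun X => by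
    refine (K.conE.sum_nabla_frame (L.e_expand L') hu X (L.e.coord a).isLinear).trans ?_
    refine Finset.sum_congr rfl fun b _ => ?_
    congr 2
    simp [Finsupp.single_apply]
  have h₂ : ∑ μ, ∑ b, L.omega μ b a • (Φ (L.dX μ) * Φ (u b))
      = ∑ μ, ∑ b, (L.e.repr (K.conE.nabla (L'.pd μ) (L'.e b)) a
        - L'.pd μ (L.lamInv L' b a)) • (L'.dX μ * u' b) := by
    simp only [omega]
    rw [Finset.sum_comm]
    rw [Finset.sum_congr rfl fun b _ => (H.sameTensor_dX.mul_right (Φ (u b)))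
      (fun X => L.e.repr (K.conE.nabla X (L.e b)) a)
      (IsLinearMap_comp (L.e.coord a).isLinear (K.conE.inVec (L.e b))), Finset.sum_comm]
    refine Finset.sum_congr rfl fun μ _ => ?_
    simp only [← mul_smul_comm, ← Finset.mul_sum, h₁]
  have h₃ : ∑ b, L.lamInv L' b a • ∑ μ, ∑ c, L'.omega μ c b • (L'.dX μ * u' c)
      = ∑ μ, ∑ c, L.e.repr (K.conE.nabla (L'.pd μ) (L'.e c)) a • (L'.dX μ * u' c) := by
    simp only [Finset.smul_sum, smul_smul]
    rw [sum_cycle fun μ c b => (L.lamInv L' b a * L'.omega μ c b) • (L'.dX μ * u' c)]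
    refine Finset.sum_congr rfl fun μ _ => Finset.sum_congr rfl fun c _ => ?_
    rw [← Finset.sum_smul, L.repr_change L']
    rfl
  simp only [covDE, map_add, H.map_d, hu a, map_sum, H.map_fsmul, map_mul, smul_add,
    Finset.sum_add_distrib, h₂, h₃, d_fsmul, d_fn, Finset.sum_mul, sub_smul,
    Finset.sum_sub_distrib, smul_mul_assoc]
  rw [Finset.sum_comm]
  abel

theorem tensorial_covDT (H : L.IsFrameChange L' Φ) {u u' : Fin n → FAlg 𝒞 n r}
    (hu : L.TensorialT L' Φ u u') :
    L.TensorialT L' Φ (L.covDT u) (L'.covDT u') := fun μ => by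
  -- From differentiating the chain rule for the two Jacobians, whose product is constant: it
  -- transfers the inhomogeneous term of Γ from the inverse Jacobian to the Jacobian acting on u.
  have h₀ : ∀ σ ν, ∑ τ, L.pd μ (L'.jac L σ τ) * L.jac L' τ ν = -L'.pd σ (L.jac L' μ ν) :=
    fun σ ν => by
    have h := congrArg (L.pd μ) (L.expand (L'.pd σ) (L'.x ν))
    rw [vec_pd_x, map_sum] at h
    simp only [vec_mul, Finset.sum_add_distrib] at h
    have h' := L.expand (L'.pd σ) (L.jac L' μ ν)
    simp only [jac] at h' ⊢
    simp only [L.pd_comm _ μ] at h'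
    rw [h', eq_neg_iff_add_eq_zero]
    exact h.symm
  have h₁ : ∀ ν, ∑ σ, L.Gamma ν μ σ • Φ (L.dX σ)
      = ∑ σ, (K.conT.nabla (L.pd μ) (L'.pd σ)
        - ∑ τ, L.pd μ (L'.jac L σ τ) • L.pd τ) (L.x ν) • L'.dX σ := fun ν => by
    rw [show ∑ σ, L.Gamma ν μ σ • Φ (L.dX σ) = _ from
      K.conT.sum_nabla_frame (L'.pd_expand L) H.map_dX (L.pd μ) (L.dx ν).isLinear]
    refine Finset.sum_congr rfl fun σ _ => ?_
    rw [Derivation.sub_apply, vec_sum_apply]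
    rfl
  have h₂ : ∑ ν, ∑ σ, L.Gamma ν μ σ • (Φ (L.dX σ) * Φ (u ν))
      = ∑ ν, ∑ σ, (K.conT.nabla (L.pd μ) (L'.pd σ) (L'.x ν) + L'.pd σ (L.jac L' μ ν))
        • (L'.dX σ * u' ν) := by
    simp only [← smul_mul_assoc, ← Finset.sum_mul, h₁]
    simp only [Finset.sum_mul, smul_mul_assoc]
    rw [Finset.sum_comm]
    refine (Finset.sum_congr rfl fun σ _ => (hu.sameTensor.mul_left (L'.dX σ))
      (fun φ => φ (K.conT.nabla (L.pd μ) (L'.pd σ) - ∑ τ, L.pd μ (L'.jac L σ τ) • L.pd τ))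
      ⟨fun _ _ => rfl, fun _ _ => rfl⟩).trans ?_
    rw [Finset.sum_comm]
    refine Finset.sum_congr rfl fun ν _ => Finset.sum_congr rfl fun σ _ => ?_
    congr 1
    have h := h₀ σ ν
    rw [map_sub, map_sum]
    simp only [map_smul, smul_eq_mul]
    exact (congrArg _ h).trans (sub_neg_eq_add _ _)
  have h₃ : ∑ μ', L.jac L' μ μ' • ∑ ν, ∑ σ, L'.Gamma ν μ' σ • (L'.dX σ * u' ν)
      = ∑ ν, ∑ σ, K.conT.nabla (L.pd μ) (L'.pd σ) (L'.x ν) • (L'.dX σ * u' ν) :=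
    L.sum_jac_smul L' (N := fun X => ∑ ν, ∑ σ, K.conT.nabla X (L'.pd σ) (L'.x ν)
        • (L'.dX σ * u' ν))
      (IsLinearMap_sum fun ν => IsLinearMap_sum fun σ => IsLinearMap_smul
        (IsLinearMap_comp (L'.dx ν).isLinear (K.conT.inVec _)) _) μ
  simp only [covDT, map_sub, H.map_d, hu μ, map_sum, H.map_fsmul, map_mul, smul_sub,
    Finset.sum_sub_distrib, h₂, h₃, d_fsmul, d_fn, Finset.sum_mul, add_smul,
    Finset.sum_add_distrib, smul_mul_assoc]
  abel

end IsFrameChange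

end LocalFrame

namespace LocalFrame

variable {𝒞 : Type*} [CommRing 𝒞] [Algebra ℝ 𝒞] {𝓔 : Type*} [AddCommGroup 𝓔] [Module 𝒞 𝓔]
  {K : Target 𝒞 𝓔} {n r : ℕ} {L L' : LocalFrame K n r} {Φ : FAlg 𝒞 n r →ₐ[ℝ] FAlg 𝒞 n r}

theorem s₀_fn_eq (L : LocalFrame K n r) (f : 𝒞) :
    L.s₀ (fn f) = ∑ a, K.anchor (L.e a) f • L.eps a := by
  simp only [s₀_fn, sX, Finset.smul_sum, smul_smul]
  rw [Finset.sum_comm]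
  refine Finset.sum_congr rfl fun a _ => ?_
  rw [← Finset.sum_smul, L.expand (K.anchor (L.e a)) f]
  exact congrArg (· • _) (Finset.sum_congr rfl fun μ _ => mul_comm _ _)

namespace IsFrameChange

/-! ### The terms of the covariant transformations -/

theorem tensorial_rhoStar (H : L.IsFrameChange L' Φ) {u u' : Fin n → FAlg 𝒞 n r}
    (hu : L.TensorialT L' Φ u u') :
    L.TensorialE L' Φ (fun a => ∑ μ, L.rhoStar a μ • u μ) fun a => ∑ μ, L'.rhoStar a μ • u' μ :=
  H.tensorialE₁ hu.sameTensor (G := fun e φ => φ (K.anchor e))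
    (fun φ => (φ.comp K.anchor).isLinear) fun _ => ⟨fun _ _ => rfl, fun _ _ => rfl⟩

theorem tensorial_Tup (H : L.IsFrameChange L' Φ) {u u' v v' : Fin r → FAlg 𝒞 n r}
    (hu : L.TensorialE L' Φ u u') (hv : L.TensorialE L' Φ v v') :
    L.TensorialE L' Φ (fun a => ∑ b, ∑ c, L.Tup b c a • (u b * v c))
      fun a => ∑ b, ∑ c, L'.Tup b c a • (u' b * v' c) := by
  have h : ∀ (M : LocalFrame K n r) a b c, M.Tup b c a
      = ∑ d, M.etaInv a d * K.torsion (M.e b) (M.e c) (M.e d) := fun M a b c =>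
    Finset.sum_congr rfl fun d _ => by rw [M.etaInv_symm d a, mul_comm, T]
  simp only [h]
  exact H.tensorialE₂ hu.sameTensor hv.sameTensor (G := fun e x y => K.torsion x y e)
    (fun _ _ => K.torsion_lin₃ _ _) (fun _ _ => K.torsion_lin₁ _ _) fun _ _ => K.torsion_lin₂ _ _

theorem tensorial_nablaRho (H : L.IsFrameChange L' Φ) {u u' : Fin n → FAlg 𝒞 n r}
    {v v' : Fin r → FAlg 𝒞 n r} (hu : L.TensorialT L' Φ u u') (hv : L.TensorialE L' Φ v v') :
    L.TensorialT L' Φ (fun μ => ∑ a, ∑ ν, L.nablaRho μ a ν • (u ν * v a))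
      fun μ => ∑ a, ∑ ν, L'.nablaRho μ a ν • (u' ν * v' a) := by
  have h := H.tensorialT₂ hu.sameTensor hv.sameTensor (G := fun X φ e => φ (K.nablaAnchor X e))
    (fun φ e => ⟨fun X Y => by rw [(K.nablaAnchor_lin₀ e).map_add, map_add],
      fun f X => by rw [(K.nablaAnchor_lin₀ e).map_smul, map_smul]⟩)
    (fun _ _ => ⟨fun _ _ => rfl, fun _ _ => rfl⟩)
    (fun X φ => ⟨fun e e' => by rw [(K.nablaAnchor_lin₁ X).map_add, map_add],
      fun f e => by rw [(K.nablaAnchor_lin₁ X).map_smul, map_smul]⟩)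
  -- The sums are interchanged since the monomial has the cotangent factor u in front of v, while
  -- the formula sums over the bundle index first.
  intro μ
  beta_reduce
  rw [Finset.sum_comm]
  refine (h μ).trans (Finset.sum_congr rfl fun μ' _ => ?_)
  beta_reduce
  rw [Finset.sum_comm]
  rfl

theorem tensorial_St (H : L.IsFrameChange L' Φ) {u u' v v' w w' : Fin r → FAlg 𝒞 n r}
    (hu : L.TensorialE L' Φ u u') (hv : L.TensorialE L' Φ v v') (hw : L.TensorialE L' Φ w w') :
    L.TensorialT L' Φ (fun μ => ∑ a, ∑ b, ∑ c, L.St μ a b c • (u a * v b * w c))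
      fun μ => ∑ a, ∑ b, ∑ c, L'.St μ a b c • (u' a * v' b * w' c) :=
  H.tensorialT₃ hu.sameTensor hv.sameTensor hw.sameTensor (G := K.twistedBasicCurv)
    (fun _ _ _ => K.twistedBasicCurv_lin₀ _ _ _) (fun _ _ _ => K.twistedBasicCurv_lin₁ _ _ _)
    (fun _ _ _ => K.twistedBasicCurv_lin₂ _ _ _) fun _ _ _ => K.twistedBasicCurv_lin₃ _ _ _

theorem tensorial_H₂_sub_R (H : L.IsFrameChange L' Φ) {u u' v v' : Fin r → FAlg 𝒞 n r}
    (hu : L.TensorialE L' Φ u u') (hv : L.TensorialE L' Φ v v') :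
    L.TensorialT L' Φ
      (fun μ => ∑ ν, ∑ a, ∑ b, (L.H₂ μ ν a b - L.R a b μ ν) • (u a * v b * L.F ν))
      fun μ => ∑ ν, ∑ a, ∑ b, (L'.H₂ μ ν a b - L'.R a b μ ν) • (u' a * v' b * L'.F ν) := by
  have h := H.tensorialT₃ hu.sameTensor hv.sameTensor H.sameTensor_F
    (G := fun X e e' Y => K.H ![X, Y, K.anchor e, K.anchor e'] - 2 * K.pairing e (K.curv X Y e'))
    (fun e e' Y => IsLinearMap_sub (form_lin₁ K.H _ _ _)
      (IsLinearMap_mul 2 ⟨fun X X' => by rw [(K.curv_lin₁ Y e').map_add, map_add],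
        fun f X => by rw [(K.curv_lin₁ Y e').map_smul, map_smul]⟩))
    (fun X e' Y => IsLinearMap_sub (IsLinearMap_comp (form_lin₃ K.H X Y _) K.anchor)
      (IsLinearMap_mul 2 (K.pairing.flip _).isLinear))
    (fun X e Y => IsLinearMap_sub (IsLinearMap_comp (form_lin₄ K.H X Y _) K.anchor)
      (IsLinearMap_mul 2 ⟨fun e' e'' => by rw [(K.curv_lin₃ X Y).map_add, map_add],
        fun f e' => by rw [(K.curv_lin₃ X Y).map_smul, map_smul]⟩))
    (fun X e e' => IsLinearMap_sub (form_lin₂ K.H _ _ _)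
      (IsLinearMap_mul 2 ⟨fun Y Y' => by rw [(K.curv_lin₂ X e').map_add, map_add],
        fun f Y => by rw [(K.curv_lin₂ X e').map_smul, map_smul]⟩))
  intro μ
  beta_reduce
  rw [sum_cycle fun a b ν => (L.H₂ μ ν a b - L.R a b μ ν) • (u a * v b * L.F ν)]
  refine (h μ).trans (Finset.sum_congr rfl fun μ' _ => ?_)
  beta_reduce
  rw [sum_cycle fun a b ν => (L'.H₂ μ' ν a b - L'.R a b μ' ν) • (u' a * v' b * L'.F ν)]
  rfl

theorem tensorial_H₁ (H : L.IsFrameChange L' Φ) :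
    L.TensorialT L' Φ
      (fun μ => ∑ ν, ∑ σ, ∑ a, L.H₁ μ ν σ a • (L.eps a * L.F ν * L.F σ))
      fun μ => ∑ ν, ∑ σ, ∑ a, L'.H₁ μ ν σ a • (L'.eps a * L'.F ν * L'.F σ) := by
  have h := H.tensorialT₃ H.tensorial_eps.sameTensor H.sameTensor_F H.sameTensor_F
    (G := fun X e Y Z => K.H ![X, Y, Z, K.anchor e]) (fun _ _ _ => form_lin₁ K.H _ _ _)
    (fun _ _ _ => IsLinearMap_comp (form_lin₄ K.H _ _ _) K.anchor)
    (fun _ _ _ => form_lin₂ K.H _ _ _) (fun _ _ _ => form_lin₃ K.H _ _ _)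
  intro μ
  beta_reduce
  rw [← sum_cycle fun ν σ a => L.H₁ μ ν σ a • (L.eps a * L.F ν * L.F σ)]
  refine (h μ).trans (Finset.sum_congr rfl fun μ' _ => ?_)
  beta_reduce
  rw [← sum_cycle fun ν σ a => L'.H₁ μ' ν σ a • (L'.eps a * L'.F ν * L'.F σ)]
  rfl

/-! ### The covariant transformations -/

theorem map_s₀_fn (H : L.IsFrameChange L' Φ) (f : 𝒞) : Φ (L.s₀ (fn f)) = L'.s₀ (fn f) := by
  simp only [s₀_fn_eq, map_sum, H.map_fsmul]
  exact H.tensorial_eps.sameTensor (fun e => K.anchor e f)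
    ⟨fun e e' => by rw [map_add]; rfl, fun g e => by rw [map_smul]; rfl⟩

/-- Here and below covariance is read off the explicit formula; the definition through s₀ and ω has
no manifestly covariant term. -/
theorem tensorial_nEps (H : L.IsFrameChange L' Φ) : L.TensorialE L' Φ L.nEps L'.nEps := by
  rw [funext L.nEps_eq, funext L'.nEps_eq]
  exact (H.tensorial_rhoStar H.tensorial_tpsiNabla).neg.add
    (H.tensorial_Tup H.tensorial_eps H.tensorial_eps)

theorem tensorial_nA (H : L.IsFrameChange L' Φ) : L.TensorialE L' Φ L.nA L'.nA := by
  rw [funext L.nA_eq, funext L'.nA_eq]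
  exact ((H.tensorial_covDE H.tensorial_eps).add (H.tensorial_rhoStar H.tensorial_psiNabla)).sub
    ((H.tensorial_Tup H.tensorial_A H.tensorial_eps).smul 2)

theorem tensorial_nTpsi (H : L.IsFrameChange L' Φ) : L.TensorialT L' Φ L.nTpsi L'.nTpsi := by
  rw [funext L.nTpsi_eq, funext L'.nTpsi_eq]
  exact (H.tensorial_nablaRho H.tensorial_tpsiNabla H.tensorial_eps).neg.sub
    ((H.tensorial_St H.tensorial_eps H.tensorial_eps H.tensorial_eps).smul _)

theorem tensorial_nPsi (H : L.IsFrameChange L' Φ) : L.TensorialT L' Φ L.nPsi L'.nPsi := by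
  rw [funext L.nPsi_eq, funext L'.nPsi_eq]
  exact ((((H.tensorial_covDT H.tensorial_tpsiNabla).add
    (H.tensorial_nablaRho H.tensorial_tpsiNabla H.tensorial_A)).add
    (H.tensorial_nablaRho H.tensorial_psiNabla H.tensorial_eps)).add
    (H.tensorial_St H.tensorial_A H.tensorial_eps H.tensorial_eps)).add
    ((H.tensorial_H₂_sub_R H.tensorial_eps H.tensorial_eps).smul _)

theorem tensorial_nB (H : L.IsFrameChange L' Φ) : L.TensorialT L' Φ L.nB L'.nB := by
  rw [funext L.nB_eq, funext L'.nB_eq]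
  exact ((((H.tensorial_covDT H.tensorial_psiNabla).neg.add
    (H.tensorial_nablaRho H.tensorial_psiNabla H.tensorial_A)).sub
    (H.tensorial_nablaRho H.tensorial_BNabla H.tensorial_eps)).sub
    (H.tensorial_St H.tensorial_A H.tensorial_A H.tensorial_eps)).add
    (((H.tensorial_H₂_sub_R H.tensorial_eps H.tensorial_A).smul _).neg.sub
      (H.tensorial_H₁.smul _))

end IsFrameChange

end LocalFrame

end

end TCSM

/-! ### The proposition over the smooth functions of a manifold. -/

theorem proposition3p2 {n r : ℕ} {M : Type*} [TopologicalSpace M]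
    [ChartedSpace (EuclideanSpace ℝ (Fin n)) M] [IsManifold (𝓡 n) ∞ M]
    {𝓔 : Type*} [AddCommGroup 𝓔] [Module C^∞⟮𝓡 n, M; 𝓘(ℝ, ℝ), ℝ⟯ 𝓔]
    (K : TCSM.Target C^∞⟮𝓡 n, M; 𝓘(ℝ, ℝ), ℝ⟯ 𝓔) (L : TCSM.LocalFrame K n r) :
    -- the covariant components of the homological vector field
    (∀ g, L.QH g = TCSM.sumIdx fun α => L.QNabla α * L.D α g) ∧
    -- the transformations in terms of `D_α` and `Q_∇^α`
    (∀ α, L.nPhi α = L.covD L.ghost α + L.ghostD α + L.trivPhi α) ∧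
    (∀ α, L.nGhost α = L.covD L.ghost₂ α - L.ghost₂D α - (1 / 2 : ℝ) • L.ghostDD α
      + L.trivGhost α) ∧
    (∀ α, L.nGhost₂ α = L.ghost₂DD α + (1 / 6 : ℝ) • L.ghostDDD α) ∧
    -- the explicit tensorial form
    (∀ μ, L.nX μ = ∑ a, L.rho a μ • L.eps a) ∧
    (∀ a, L.nEps a = -∑ μ, L.rhoStar a μ • L.tpsiNabla μ
      + ∑ b, ∑ c, L.Tup b c a • (L.eps b * L.eps c)) ∧
    (∀ a, L.nA a = L.covDE L.eps a + ∑ μ, L.rhoStar a μ • L.psiNabla μ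
      - (2 : ℝ) • ∑ b, ∑ c, L.Tup b c a • (L.A b * L.eps c)) ∧
    (∀ μ, L.nTpsi μ = -∑ a, ∑ ν, L.nablaRho μ a ν • (L.tpsiNabla ν * L.eps a)
      - (1 / 3 : ℝ) • ∑ a, ∑ b, ∑ c, L.St μ a b c • (L.eps a * L.eps b * L.eps c)) ∧
    (∀ μ, L.nPsi μ = L.covDT L.tpsiNabla μ
      + ∑ a, ∑ ν, L.nablaRho μ a ν • (L.tpsiNabla ν * L.A a)
      + ∑ a, ∑ ν, L.nablaRho μ a ν • (L.psiNabla ν * L.eps a)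
      + ∑ a, ∑ b, ∑ c, L.St μ a b c • (L.A a * L.eps b * L.eps c)
      + L.trivPsi μ) ∧
    (∀ μ, L.nB μ = -L.covDT L.psiNabla μ
      + ∑ a, ∑ ν, L.nablaRho μ a ν • (L.psiNabla ν * L.A a)
      - ∑ a, ∑ ν, L.nablaRho μ a ν • (L.BNabla ν * L.eps a)
      - ∑ a, ∑ b, ∑ c, L.St μ a b c • (L.A a * L.A b * L.eps c)
      + L.trivB μ) ∧
    -- the trivial terms vanish on the stationary surface
    (∀ α, L.trivPhi α ∈ Ideal.span (Set.range L.F)) ∧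
    (∀ α, L.trivGhost α ∈ Ideal.span (Set.range L.F)) ∧
    -- independence of the coordinates and of the frame
    (∀ L' : TCSM.LocalFrame K n r, (∃! Φ, L.IsFrameChange L' Φ) ∧
      ∀ Φ, L.IsFrameChange L' Φ →
        L.TensorialT L' Φ L.BNabla L'.BNabla ∧
        L.TensorialT L' Φ L.psiNabla L'.psiNabla ∧
        L.TensorialT L' Φ L.tpsiNabla L'.tpsiNabla ∧
        (∀ f, Φ (L.s₀ (TCSM.fn f)) = L'.s₀ (TCSM.fn f)) ∧
        L.TensorialE L' Φ L.nEps L'.nEps ∧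
        L.TensorialE L' Φ L.nA L'.nA ∧
        L.TensorialT L' Φ L.nTpsi L'.nTpsi ∧
        L.TensorialT L' Φ L.nPsi L'.nPsi ∧
        L.TensorialT L' Φ L.nB L'.nB) := by
  exact ⟨L.QH_eq_QD, L.nPhi_eq, L.nGhost_eq, L.nGhost₂_eq, L.nX_eq, L.nEps_eq, L.nA_eq, L.nTpsi_eq,
    L.nPsi_eq, L.nB_eq, L.trivPhi_mem, L.trivGhost_mem, fun L' =>
    ⟨L.existsUnique_isFrameChange L', fun _ H => ⟨H.tensorial_BNabla, H.tensorial_psiNabla,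
      H.tensorial_tpsiNabla, H.map_s₀_fn, H.tensorial_nEps, H.tensorial_nA, H.tensorial_nTpsi,
      H.tensorial_nPsi, H.tensorial_nB⟩⟩⟩
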